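/- **Setting.** Let $\nu\ge 1$, $\mathtt m\ge 0$, $\rho>0$, and let $V:\mathbb T^\nu\times[0,\pi]\to\mathbb R$ be such that its even $2\pi$-periodic extension in $x$ (still denoted $V$) is smooth on $\mathbb T^{\nu}\times\mathbb T$ and extends analytically in $\theta$ to $|\mathrm{Im}\,\theta|<\rho$, smoothly in $x$, with $\sup_{|\mathrm{Im}\,\theta|<\rho,\,x}|\partial_x^\ell V(\theta,x)|<\infty$ for every $\ell\in\mathbb N_0$; assume also $\int_{\mathbb T^\nu}V(\theta,x)\,d\theta=0$ for all $x\in[0,\pi]$. Let $\mathcal H^r$ be the space of odd functions $\sum_{j\in\mathbb Z} u_je^{ijx}$ on $\mathbb T$ with $\sum_j\langle j\rangle^{2r}|u_j|^2<\infty$, where $\langle y\rangle=(1+|y|^2)^{1/2}$ (equivalently, sine series on $[0,\pi]$). Put $B=\sqrt{-\partial_{xx}+\mathtt m^2}$ with Dirichlet boundary conditions ($B^{-1/2}$ is set to $0$ on constants if $\mathtt m=0$), $$\boldsymbol\sigma_3=\begin{pmatrix}1&0\\0&-1\end{pmatrix},\quad \boldsymbol\sigma_4=\begin{pmatrix}1&1\\-1&-1\end{pmatrix},\quad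 \mathbf H_0=B\boldsymbol\sigma_3,\quad \mathbf W(\theta)=\tfrac12 B^{-1/2}V(\theta,x)B^{-1/2}\boldsymbol\sigma_4 ,$$ and consider on $\mathcal H^r\times\mathcal H^r$, $r\ge 0$, the system $$i\dot\varphi(t)=\big(\mathbf H_0+\mathbf W(\omega t)\big)\varphi(t).\qquad(1)$$ Solutions are understood in $C^0(\mathbb R,\mathcal H^r\times\mathcal H^r)\cap C^1(\mathbb R,\mathcal H^{r-1}\times\mathcal H^{r-1})$. For $m\in\mathbb R$ and $\varrho>0$, $\mathcal P\mathcal A^m_\varrho$ is the set of operators $f(\theta,x,D)\psi=\sum_j f(\theta,x,j)\psi_je^{ijx}$ which for $\theta\in\mathbb T^\nu$ map even (odd) functions of $L^2(\mathbb T)$ to even (odd) functions of $L^2(\mathbb T)$, and whose complex-valued symbol $f$ is $2\pi$-periodic in $\theta$ and $x$, smooth in $x$, analytic in $\theta$ in a neighbourhood of $\{|\mathrm{Im}\,\theta|\le\varrho\}$, with all the following seminorms finite ($\triangle f(j)=f(j+1)-f(j)$): $$\wp^{m,\varrho}_\ell(f)=\sup_{|\mathrm{Im}\,\theta|\le\varrho}\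 \sum_{\alpha+\beta\le\ell}\ \sup_{x\in\mathbb T,\,j\in\mathbb Z}\langle j\rangle^{-m+\beta}\,|\partial_x^\alpha\triangle^\beta f(\theta,x,j)| .$$ For $\mathtt w>0$ and a family $F=(F(\omega))_{\omega\in\Omega}$, $\Omega\subset\mathbb R^\nu$, put $$\wp^{m,\varrho}_\ell(F)^{\mathrm{Lip}(\mathtt w)}_{\Omega}=\sup_{\omega\in\Omega}\wp^{m,\varrho}_\ell(F(\omega))+\mathtt w\sup_{\omega_1\ne\omega_2\in\Omega}\frac{\wp^{m,\varrho}_\ell(F(\omega_1)-F(\omega_2))}{|\omega_1-\omega_2|};$$ $\mathrm{Lip}_{\mathtt w}(\Omega,\mathcal P\mathcal A^m_\varrho)$ is the set of families in $\mathcal P\mathcal A^m_\varrho$ for which these are finite for all $\ell\in\mathbb N_0$. Finally $\bar A\psi=\overline{A\bar\psi}$, and $A^*$ is the adjoint for the scalar product of $\mathcal H^0$. For $M>0$ let $R_M=\overline{B_{2M}(0)}\setminus B_M(0)\subset\mathbb R^\nu$ (Euclidean balls), and for $\gamma_0>0$, $\tau_0>\nu-1$ let $$\Omega_0=\Omega_0(M,\gamma_0,\tau_0)=\Big\{\omega\in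 R_M:\ |\omega\cdot k|\ge\frac{\gamma_0}{\langle k\rangle^{\tau_0}}M\quad\forall k\in\mathbb Z^\nu\setminus\{0\}\Big\}.$$ **Theorem 3.1 (Magnus normal form).** Let $\tau_0>\nu-1$. There is a constant $c_0>0$ depending only on $\nu$ and $\tau_0$ such that, for all $\mathtt m,\rho,V$ as above, all $0<\gamma_0<1$ and all $M>0$, $$\frac{\mathrm{meas}(R_M\setminus\Omega_0)}{\mathrm{meas}(R_M)}\le c_0\gamma_0 ,$$ and the following holds. There are families $X,V^d,V^o$ of operators, indexed by $\omega\in\Omega_0$, such that for every $\mathtt w>0$ $$X\in\mathrm{Lip}_{\mathtt w}(\Omega_0,\mathcal P\mathcal A^{-1}_{\rho/2}),\qquad V^d\in\mathrm{Lip}_{\mathtt w}(\Omega_0,\mathcal P\mathcal A^{-1}_{\rho/2}),\qquad V^o\in\mathrm{Lip}_{\mathtt w}(\Omega_0,\mathcal P\mathcal A^{0}_{\rho/2}),$$ with $[V^d]^*=V^d$ and $[V^o]^*=\overline{V^o}$ for all $\omega\in\Omega_0$, $\theta\in\mathbb T^\nu$, and such that, for every $\omega\in\Omega_0$ and $r\ge0$,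 $X(\theta;\omega)\boldsymbol\sigma_4$ is bounded on $\mathcal H^r\times\mathcal H^r$ and the change of coordinates $\varphi(t)=e^{-iX(\omega t;\omega)\boldsymbol\sigma_4}\psi(t)$ conjugates (1) to $$i\dot\psi(t)=\big(\mathbf H_0+\mathbf V(\omega t;\omega)\big)\psi(t),\qquad \mathbf V=\begin{pmatrix}V^d&V^o\\-\overline{V^o}&-\overline{V^d}\end{pmatrix},$$ that is, $\varphi$ solves (1) if and only if $\psi$ solves this equation. Furthermore, for every $\mathtt w>0$ and $\ell\in\mathbb N_0$ there is $C_\ell>0$, independent of $M$, such that, if $M\ge1$, $$\wp^{-1,\rho/2}_\ell(V^d)^{\mathrm{Lip}(\mathtt w)}_{\Omega_0}+\wp^{0,\rho/2}_\ell(V^o)^{\mathrm{Lip}(\mathtt w)}_{\Omega_0}\le\frac{C_\ell}{M}.$$ -/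

import Mathlib

open scoped ENNReal

noncomputable section

namespace MagnusKG

/-! ### Fourier coefficients, Sobolev scale of odd functions -/

/-- A function (or distribution) `∑ⱼ u j e^{ijx}` on the circle, given by its Fourier
coefficients. -/
abbrev Coeffs : Type := ℤ → ℂ

/-- The Japanese bracket `⟨x⟩ = (1 + |x|²)^{1/2}`. -/
def bracket (x : ℝ) : ℝ := Real.sqrt (1 + x ^ 2)

theorem bracket_pos (x : ℝ) : 0 < bracket x := Real.sqrt_pos.2 (by positivity)

/-- The Fourier multiplier `⟨D⟩^r`. -/
def bracketD (r : ℝ) : Coeffs →ₗ[ℂ] Coeffs where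
  toFun u := fun j => ((bracket j ^ r : ℝ) : ℂ) * u j
  map_add' u v := by ext j; simp [mul_add]
  map_smul' c u := by ext j; simp [mul_left_comm]

/-- The odd sequences with `∑ⱼ ⟨j⟩^{2r} |u j|² < ∞`. -/
def oddSubmodule (r : ℝ) : Submodule ℂ Coeffs where
  carrier := {u | (∀ j, u (-j) = -u j) ∧ Memℓp (E := fun _ : ℤ => ℂ) (bracketD r u) 2}
  add_mem' := by
    rintro u v ⟨hu, hu'⟩ ⟨hv, hv'⟩
    refine ⟨fun j => by simp [hu, hv]; ring, ?_⟩
    rw [map_add]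
    exact hu'.add hv'
  zero_mem' := ⟨fun j => by simp, by rw [map_zero]; exact zero_memℓp⟩
  smul_mem' := by
    rintro c u ⟨hu, hu'⟩
    refine ⟨fun j => by simp [hu], ?_⟩
    rw [map_smul]
    exact hu'.const_smul c

/-- The space `𝓗^r`: odd functions on the circle (that is, sine series on `[0, π]`) with
`∑ⱼ ⟨j⟩^{2r} |u j|² < ∞`. A separate type, so that its topology is the one of its norm and not
the one of coefficientwise convergence. -/
def OddSobolev (r : ℝ) : Type := oddSubmodule r

instance (r : ℝ) : AddCommGroup (OddSobolev r) :=
  inferInstanceAs (AddCommGroup (oddSubmodule r))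

instance (r : ℝ) : Module ℂ (OddSobolev r) := inferInstanceAs (Module ℂ (oddSubmodule r))

/-- The Fourier coefficients of an element of `𝓗^r`. -/
def OddSobolev.coeffs {r : ℝ} (u : OddSobolev r) : Coeffs := u.1

/-- `u ↦ ⟨D⟩^r u` from `𝓗^r` to `ℓ²`, which induces the norm of `𝓗^r`. -/
def toEll2 (r : ℝ) : OddSobolev r →ₗ[ℂ] lp (fun _ : ℤ => ℂ) 2 where
  toFun u := ⟨bracketD r u.coeffs, u.2.2⟩
  map_add' u v := Subtype.ext ((bracketD r).map_add u.coeffs v.coeffs)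
  map_smul' c u := Subtype.ext ((bracketD r).map_smul c u.coeffs)

theorem bracket_rpow_ne (r : ℝ) (j : ℤ) : ((bracket j ^ r : ℝ) : ℂ) ≠ 0 := by
  exact_mod_cast (Real.rpow_pos_of_pos (bracket_pos j) r).ne'

theorem toEll2_injective (r : ℝ) : Function.Injective (toEll2 r) := by
  intro u v h
  apply Subtype.ext
  funext j
  exact mul_left_cancel₀ (bracket_rpow_ne r j)
    (congrArg (fun w : lp (fun _ : ℤ => ℂ) 2 => w j) h)

instance (r : ℝ) : NormedAddCommGroup (OddSobolev r) :=
  NormedAddCommGroup.induced (OddSobolev r) (lp (fun _ : ℤ => ℂ) 2) (toEll2 r) (toEll2_injective r)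

instance (r : ℝ) : NormedSpace ℂ (OddSobolev r) := NormedSpace.induced ℂ _ _ (toEll2 r)

/-- The spaces `𝓗^r` are complete, so that exponentials of bounded operators on them converge. -/
instance (r : ℝ) : CompleteSpace (OddSobolev r) := by
  have hiso : Isometry (toEll2 r) := AddMonoidHomClass.isometry_of_norm (toEll2 r) fun _ => rfl
  have hr : Set.range (toEll2 r) = {w | ∀ j : ℤ, w (-j) = -w j} := by
    ext w
    constructor
    · rintro ⟨u, rfl⟩ j
      change ((bracket ((-j : ℤ) : ℝ) ^ r : ℝ) : ℂ) * u.1 (-j) = -(_ * u.1 j)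
      rw [u.2.1 j]
      simp [bracket]
    · intro hw
      have hm : bracketD r (fun j => ((bracket j ^ r : ℝ) : ℂ)⁻¹ * w j) = fun j => w j := by
        ext j
        exact mul_inv_cancel_left₀ (bracket_rpow_ne r j) _
      refine ⟨⟨fun j => ((bracket j ^ r : ℝ) : ℂ)⁻¹ * w j, fun j => ?_, ?_⟩, ?_⟩
      · have : bracket ((-j : ℤ) : ℝ) = bracket j := by simp [bracket]
        simp only [this]
        rw [hw j]; ring
      · rw [hm]; exact w.2
      · ext j
        exact congrFun hm j
  refine (completeSpace_iff_isComplete_range hiso.isUniformInducing).2 (IsClosed.isComplete ?_)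
  rw [hr, Set.ofPred_forall]
  have hc : ∀ j : ℤ, Continuous fun w : lp (fun _ : ℤ => ℂ) 2 => w j := fun j =>
    (continuous_apply j).comp (lp.uniformContinuous_coe (E := fun _ : ℤ => ℂ) (p := 2)).continuous
  exact isClosed_iInter fun j => isClosed_eq (hc (-j)) (hc j).neg

/-- The phase space `𝓗^r × 𝓗^r`. -/
abbrev Phase (r : ℝ) : Type := Fin 2 → OddSobolev r

/-- `L²_even(𝕋)` through Fourier coefficients. -/
def L2even : Set Coeffs := {u | (Summable fun j => ‖u j‖ ^ 2) ∧ ∀ j, u (-j) = u j}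

/-- `L²_odd(𝕋)` through Fourier coefficients. -/
def L2odd : Set Coeffs := {u | (Summable fun j => ‖u j‖ ^ 2) ∧ ∀ j, u (-j) = -u j}

/-! ### Operators on Fourier coefficients -/

/-- Operators acting on functions on the circle. -/
abbrev Oper : Type := Coeffs → Coeffs

/-- Complex conjugation of functions: `∑ⱼ uⱼ e^{ijx} ↦ ∑ⱼ conj(u₋ⱼ) e^{ijx}`. -/
def conjFun (u : Coeffs) : Coeffs := fun j => starRingEnd ℂ (u (-j))

/-- The conjugate operator `Ā ψ = conj (A (conj ψ))`. -/
def conjOp (A : Oper) : Oper := fun u => conjFun (A (conjFun u))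

/-- `A^* = A'` with respect to the scalar product of `𝓗⁰` (odd functions). -/
def IsAdjointOnOdd (A A' : Oper) : Prop :=
  ∀ u v : OddSobolev 0,
    ∑' j : ℤ, A u.coeffs j * starRingEnd ℂ (v.coeffs j) =
      ∑' j : ℤ, u.coeffs j * starRingEnd ℂ (A' v.coeffs j)

/-- The operator preserves the parity of `L²` functions. -/
def ParityPreserving (A : Oper) : Prop :=
  Set.MapsTo A L2even L2even ∧ Set.MapsTo A L2odd L2odd

/-- Standard quantization: the `n`-th Fourier coefficient of
`a(x, D)ψ (x) = ∑ⱼ a(x, j) ψⱼ e^{ijx}`. -/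
def quantize (a : ℝ → ℤ → ℂ) : Oper := fun ψ n =>
  ∑' j : ℤ, (((2 * Real.pi : ℝ) : ℂ)⁻¹ *
    ∫ x in (-Real.pi)..Real.pi, a x j * Complex.exp (Complex.I * j * x) *
      Complex.exp (-(Complex.I * n * x))) * ψ j

/-- `2 × 2` matrices of operators. -/
abbrev BlockOper : Type := Matrix (Fin 2) (Fin 2) Oper

/-- Action of a matrix of operators on a vector of functions. -/
def BlockOper.act (A : BlockOper) (φ : Fin 2 → Coeffs) : Fin 2 → Coeffs :=
  fun a => ∑ b, A a b (φ b)

/-- The matrix of operators `A σ`, for an operator `A` and a complex matrix `σ`. -/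
def tensorPauli (A : Oper) (σ : Matrix (Fin 2) (Fin 2) ℂ) : BlockOper := fun a b u => σ a b • A u

def sigma3 : Matrix (Fin 2) (Fin 2) ℂ := !![1, 0; 0, -1]

def sigma4 : Matrix (Fin 2) (Fin 2) ℂ := !![1, 1; -1, -1]

/-- The block operator with rows `(Aᵈ, Aᵒ)` and `(-conj Aᵒ, -conj Aᵈ)`. -/
def hamBlock (Ad Ao : Oper) : BlockOper := !![Ad, Ao; -conjOp Ao, -conjOp Ad]

/-! ### Symbols -/

variable {ν : ℕ}

/-- The torus `𝕋^ν` is `ℝ^ν` modulo `2πℤ^ν`; this embeds real angles into complex ones. -/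
def toComplex (θ : Fin ν → ℝ) : Fin ν → ℂ := fun i => (θ i : ℂ)

/-- Translation of complex angles by `2πk`. -/
def shift (k : Fin ν → ℤ) (θ : Fin ν → ℂ) : Fin ν → ℂ :=
  fun i => θ i + ((2 * Real.pi * k i : ℝ) : ℂ)

/-- Euclidean length `|Im θ|`. -/
def imNorm (θ : Fin ν → ℂ) : ℝ := Real.sqrt (∑ i, (θ i).im ^ 2)

/-- The closed complex strip `|Im θ| ≤ ρ`. -/
def strip (ν : ℕ) (ρ : ℝ) : Set (Fin ν → ℂ) := {θ | imNorm θ ≤ ρ}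

/-- The open complex strip `|Im θ| < ρ`. -/
def openStrip (ν : ℕ) (ρ : ℝ) : Set (Fin ν → ℂ) := {θ | imNorm θ < ρ}

/-- Symbols `f(θ, x, j)` depending on complex angles `θ`. Only their values for `θ` in a strip
matter. -/
abbrev Symb (ν : ℕ) : Type := (Fin ν → ℂ) → ℝ → ℤ → ℂ

/-- `∂ₓ^α △^β f (θ, x, j)`, where `△ f (j) = f (j + 1) - f (j)`. -/
def symbDeriv (f : Symb ν) (α β : ℕ) (θ : Fin ν → ℂ) (x : ℝ) (j : ℤ) : ℂ :=
  iteratedDeriv α (fun y => (fwdDiff (1 : ℤ))^[β] (f θ y) j) x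

/-- The class `S^m_ρ`. -/
structure IsSymbol (m ρ : ℝ) (f : Symb ν) : Prop where
  periodic_x : ∀ θ ∈ strip ν ρ, ∀ x j, f θ (x + 2 * Real.pi) j = f θ x j
  periodic_θ : ∀ θ ∈ strip ν ρ, ∀ k x j, f (shift k θ) x j = f θ x j
  smooth_x : ∀ θ ∈ strip ν ρ, ∀ j, ContDiff ℝ (⊤ : ℕ∞) fun x => f θ x j
  /-- holomorphic in a neighbourhood of the closed strip -/
  analytic_θ : ∀ x j, ∃ U : Set (Fin ν → ℂ), IsOpen U ∧ strip ν ρ ⊆ U ∧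
    DifferentiableOn ℂ (fun θ => f θ x j) U
  bound : ∀ α β : ℕ, ∃ C > 0, ∀ θ ∈ strip ν ρ, ∀ x j,
    ‖symbDeriv f α β θ x j‖ ≤ C * bracket j ^ (m - β)

/-- The seminorm `℘^{m,ρ}_ℓ`, with values in `[0, ∞]`. -/
def seminorm (m ρ : ℝ) (ℓ : ℕ) (f : Symb ν) : ℝ≥0∞ :=
  ⨆ θ ∈ strip ν ρ, ∑ p ∈ (Finset.range (ℓ + 1) ×ˢ Finset.range (ℓ + 1)).filter
      (fun p => p.1 + p.2 ≤ ℓ),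
    ⨆ (x : ℝ) (j : ℤ), ENNReal.ofReal (bracket j ^ (-m + p.2)) * ‖symbDeriv f p.1 p.2 θ x j‖ₑ

/-- Frequency vectors, with the Euclidean norm. -/
abbrev Freq (ν : ℕ) : Type := EuclideanSpace ℝ (Fin ν)

/-- The weighted Lipschitz seminorm: `sup + w · Lip` of `℘^{m,ρ}_ℓ` over `Ω`. -/
def lipSeminorm (w : ℝ) (Ω : Set (Freq ν)) (m ρ : ℝ) (ℓ : ℕ) (F : Freq ν → Symb ν) : ℝ≥0∞ :=
  (⨆ ω ∈ Ω, seminorm m ρ ℓ (F ω)) +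
    ENNReal.ofReal w * ⨆ ω₁ ∈ Ω, ⨆ ω₂ ∈ Ω, ⨆ _ : ω₁ ≠ ω₂,
      seminorm m ρ ℓ (F ω₁ - F ω₂) / ‖ω₁ - ω₂‖ₑ

/-- The operator `f(θ, x, D)` at a real angle `θ`. -/
def opAt (f : Symb ν) (θ : Fin ν → ℝ) : Oper := quantize (f (toComplex θ))

/-- The class `Lip_w(Ω, 𝒫𝒜^m_ρ)` of Lipschitz families of parity preserving analytic
pseudodifferential operators, identified with their symbols. -/
structure IsLipParityPseudo (w : ℝ) (Ω : Set (Freq ν)) (m ρ : ℝ) (F : Freq ν → Symb ν) :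
    Prop where
  symbol : ∀ ω ∈ Ω, IsSymbol m ρ (F ω)
  parity : ∀ ω ∈ Ω, ∀ θ : Fin ν → ℝ, ParityPreserving (opAt (F ω) θ)
  lipschitz : ∀ ℓ, lipSeminorm w Ω m ρ ℓ F < ∞

/-! ### The driven Klein–Gordon system -/

/-- The even `2π`-periodic extension in `x` of a function on `[0, π]`: for every real `x`,
`arccos (cos x)` is the point of `[0, π]` congruent to `x` or to `-x` modulo `2π`. -/
def evenExt (V : (Fin ν → ℝ) → ℝ → ℝ) : (Fin ν → ℝ) → ℝ → ℝ :=
  fun θ x => V θ (Real.arccos (Real.cos x))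

/-- The driving is a smooth function on `𝕋^ν × [0, π]` with a smooth even extension that is
analytic in the angles in the strip of width `ρ`, with bounded `x`-derivatives there. -/
structure AnalyticDriving (ρ : ℝ) (V : (Fin ν → ℝ) → ℝ → ℝ) : Prop where
  periodic : ∀ (k : Fin ν → ℤ) (θ : Fin ν → ℝ), ∀ x ∈ Set.Icc 0 Real.pi,
    V (fun i => θ i + 2 * Real.pi * k i) x = V θ x
  smooth : ContDiff ℝ (⊤ : ℕ∞) fun p : (Fin ν → ℝ) × ℝ => evenExt V p.1 p.2
  analytic : ∃ Vc : (Fin ν → ℂ) → ℝ → ℂ,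
    (∀ θ x, Vc (toComplex θ) x = (evenExt V θ x : ℂ)) ∧
    (∀ x, DifferentiableOn ℂ (fun θ => Vc θ x) (openStrip ν ρ)) ∧
    (∀ θ ∈ openStrip ν ρ, ContDiff ℝ (⊤ : ℕ∞) (Vc θ)) ∧
    ∀ ℓ : ℕ, ∃ C > 0, ∀ θ ∈ openStrip ν ρ, ∀ x, ‖iteratedDeriv ℓ (Vc θ) x‖ ≤ C

/-- The driving has zero average in the angles. -/
def ZeroAverage (V : (Fin ν → ℝ) → ℝ → ℝ) : Prop :=
  ∀ x ∈ Set.Icc 0 Real.pi,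
    ∫ θ in Set.Icc (0 : Fin ν → ℝ) (fun _ => 2 * Real.pi), V θ x = 0

/-- The eigenvalues `λⱼ = (j² + 𝗆²)^{1/2}`. -/
def eigB (mass : ℝ) (j : ℤ) : ℝ := Real.sqrt ((j : ℝ) ^ 2 + mass ^ 2)

/-- `B = (-Δ + 𝗆²)^{1/2}`. -/
def opB (mass : ℝ) : Oper := fun u j => (eigB mass j : ℂ) * u j

/-- `B^{-1/2}`, which is set to zero on the kernel of `B` (the constants, when `𝗆 = 0`). -/
def opBinvSqrt (mass : ℝ) : Oper := fun u j =>
  if eigB mass j = 0 then 0 else ((eigB mass j ^ (-(1 / 2) : ℝ) : ℝ) : ℂ) * u j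

/-- Multiplication by `V(θ, ·)`. -/
def opV (V : (Fin ν → ℝ) → ℝ → ℝ) (θ : Fin ν → ℝ) : Oper :=
  quantize fun x _ => (evenExt V θ x : ℂ)

/-- `𝐇₀ = B σ₃`. -/
def blockH0 (mass : ℝ) : BlockOper := tensorPauli (opB mass) sigma3

/-- `𝐖(θ) = ½ B^{-1/2} V(θ, x) B^{-1/2} σ₄`. -/
def blockW (mass : ℝ) (V : (Fin ν → ℝ) → ℝ → ℝ) (θ : Fin ν → ℝ) : BlockOper :=
  tensorPauli (fun u => (1 / 2 : ℂ) • opBinvSqrt mass (opV V θ (opBinvSqrt mass u))) sigma4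

/-- The angles `ω t`. -/
def angle (ω : Freq ν) (t : ℝ) : Fin ν → ℝ := fun i => ω i * t

/-- `φ ∈ C⁰(ℝ, 𝓗^r × 𝓗^r) ∩ C¹(ℝ, 𝓗^{r-1} × 𝓗^{r-1})` solves `i ∂ₜ φ = H(t) φ`, the equation being
an identity in `𝓗^{r-1} × 𝓗^{r-1}`. -/
structure IsSolution (r : ℝ) (H : ℝ → BlockOper) (φ : ℝ → Phase r) : Prop where
  continuous : Continuous φ
  /-- `φ₁` is `φ` with values in the larger space, and `d` its derivative -/
  equation : ∃ φ₁ d : ℝ → Phase (r - 1),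
    (∀ t a, (φ₁ t a).coeffs = (φ t a).coeffs) ∧ Continuous d ∧ (∀ t, HasDerivAt φ₁ (d t) t) ∧
    ∀ t a, Complex.I • (d t a).coeffs = (H t).act (fun b => (φ t b).coeffs) a

/-- The change of coordinates `φ(t) = exp(-i X(ωt) σ₄) ψ(t)` of `𝓗^r × 𝓗^r` conjugates
`i ∂ₜ φ = H(t) φ` to `i ∂ₜ ψ = H'(t) ψ`. Part of the claim is that `X(θ) σ₄` is a bounded operator
on `𝓗^r × 𝓗^r`; the exponential is the one of the Banach algebra of bounded operators. -/
def Conjugates (r : ℝ) (ω : Freq ν) (X : (Fin ν → ℝ) → Oper) (H H' : ℝ → BlockOper) : Prop :=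
  ∃ bX : (Fin ν → ℝ) → (Phase r →L[ℂ] Phase r),
    (∀ θ (u : Phase r) a,
      (bX θ u a).coeffs = (tensorPauli (X θ) sigma4).act (fun b => (u b).coeffs) a) ∧
    ∀ φ ψ : ℝ → Phase r,
      (∀ t, φ t = NormedSpace.exp (-(Complex.I • bX (angle ω t))) (ψ t)) →
      (IsSolution r H φ ↔ IsSolution r H' ψ)

/-! ### Frequencies -/

/-- The annulus `R_M`. -/
def annulus (ν : ℕ) (M : ℝ) : Set (Freq ν) := Metric.closedBall 0 (2 * M) \ Metric.ball 0 M

/-- The Diophantine frequencies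
`|ω · k| ≥ γ₀ ⟨k⟩^{-τ₀} M` for all `k ∈ ℤ^ν \ {0}`, in the annulus `R_M`. -/
def diophantine (ν : ℕ) (M γ₀ τ₀ : ℝ) : Set (Freq ν) :=
  {ω ∈ annulus ν M | ∀ k : Fin ν → ℤ, k ≠ 0 →
    γ₀ / bracket (Real.sqrt (∑ i, (k i : ℝ) ^ 2)) ^ τ₀ * M ≤ |∑ i, ω i * (k i : ℝ)|}

end MagnusKG

end

open scoped ENNReal

noncomputable section

namespace MagnusKG

variable {ν : ℕ}

/-! ### Discrete symbol calculus on the lattice -/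

/-! Let `Y` be the zero-average solution of `ω · ∂_θ Y = V` and put `X = ½ B^{-1/2} Y B^{-1/2}`, so
that the time derivative of `X(ωt) σ₄` is exactly `W(ωt)`. Since `σ₄² = 0`, the exponential of
`-iXσ₄` is `1 - iXσ₄`, with inverse `1 + iXσ₄`, and every Lie expansion terminates. `W` commutes
with `Xσ₄` (both products vanish) and is cancelled by the time derivative of the change of
coordinates. Because `σ₄σ₃σ₄ = 2σ₄`, what remains is `H₀` plus `Vᵈ = i[X, B] + 2XBX` and `Vᵒ = -i(XB
+ BX) + 2XBX`.

No general composition theorem for pseudodifferential operators is needed. The factors `B^{-1/2} B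
B^{-1/2}` inside `XBX` cancel, so that `2XBX = ½ B^{-1/2} Y² B^{-1/2}`. All symbols are therefore
series `∑ (y(k,m) K(m,j) + (y*y)(k,m) L(m,j)) e^{ik·θ+imx}`, where `K` and `L` are explicit
functions of the eigenvalues of `B` at `j` and at `j + m`. Orders are counted by finite differences
in `j`, with polynomial losses in `m` (`IsAmplitude`). The anticommutator has order `-1 + 1 = 0`. In
the commutator the difference `λ_{j+m} - λ_j` has order `0` instead of `1`, by
`IsAmplitude.translate_sub`, which gives order `-1`.

Polynomial losses in `m` are absorbed by smoothness in `x`, and those in `k`, caused by the small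
divisors `ω·k`, by analyticity in `θ`. Both are encoded in `modeNorm`, an algebra norm for
convolution. A divisor is bounded below by `γ₀ M ⟨k⟩^{-τ₀}`, so `Y` has size `1/M` and Lipschitz
constant in `ω` of size `1/M²`; this yields the final bound (`exists_isModeFamily_solveCohom`,
`exists_lipSeminorm_symb_quadAmp_le`).

The other ingredients are the Fourier expansion of the driving (`exists_modes_of_analyticDriving`),
the identification of symbols with operators on coefficients (`opAt_symb`, `twist_ampV`), the
conjugation itself (`conjugates_of_cohomological`), and the slab estimate for resonant frequencies
(`exists_volume_ratio_le`). -/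

theorem one_le_bracket (x : ℝ) : 1 ≤ bracket x := by
  rw [bracket, Real.one_le_sqrt]; nlinarith [sq_nonneg x]

theorem abs_le_bracket (x : ℝ) : |x| ≤ bracket x := by
  rw [bracket, ← Real.sqrt_sq_eq_abs]
  exact Real.sqrt_le_sqrt (by linarith)

theorem bracket_sq (x : ℝ) : bracket x ^ 2 = 1 + x ^ 2 := Real.sq_sqrt (by positivity)

theorem bracket_zero : bracket 0 = 1 := by simp [bracket]

theorem bracket_add_le (x y : ℝ) : bracket (x + y) ≤ (1 + |y|) * bracket x := by
  have h1 := abs_le_bracket x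
  have h2 := one_le_bracket x
  have h3 : bracket (x + y) ≤ bracket x + |y| := by
    have h0 : 0 ≤ bracket x + |y| := by positivity
    rw [bracket]
    refine Real.sqrt_le_iff.2 ⟨h0, ?_⟩
    have h4 : x * y ≤ bracket x * |y| :=
      (le_abs_self _).trans (by rw [abs_mul]; exact mul_le_mul_of_nonneg_right h1 (abs_nonneg y))
    nlinarith [bracket_sq x, sq_abs y]
  nlinarith [abs_nonneg y]

/-- Peetre's inequality. -/
theorem bracket_rpow_add_le (s x y : ℝ) {p : ℕ} (hp : |s| ≤ p) :
    bracket (x + y) ^ s ≤ (1 + |y|) ^ p * bracket x ^ s := by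
  have hy : 1 ≤ 1 + |y| := by linarith [abs_nonneg y]
  have hpow : ∀ t : ℝ, t ≤ |s| → (1 + |y|) ^ t ≤ (1 + |y|) ^ p := fun t ht => by
    rw [← Real.rpow_natCast]
    exact Real.rpow_le_rpow_of_exponent_le hy (ht.trans hp)
  rcases le_total 0 s with hs | hs
  · calc bracket (x + y) ^ s ≤ ((1 + |y|) * bracket x) ^ s :=
          Real.rpow_le_rpow (bracket_pos _).le (bracket_add_le x y) hs
      _ = (1 + |y|) ^ s * bracket x ^ s :=
          Real.mul_rpow (by positivity) (bracket_pos _).le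
      _ ≤ _ := mul_le_mul_of_nonneg_right (hpow s (le_abs_self s))
          (Real.rpow_nonneg (bracket_pos _).le _)
  · have h1 : bracket x ≤ (1 + |y|) * bracket (x + y) := by
      simpa using bracket_add_le (x + y) (-y)
    have h2 : ((1 + |y|) * bracket (x + y)) ^ s ≤ bracket x ^ s :=
      Real.rpow_le_rpow_of_nonpos (bracket_pos _) h1 hs
    rw [Real.mul_rpow (by positivity) (bracket_pos _).le] at h2
    calc bracket (x + y) ^ s
        = (1 + |y|) ^ (-s) * ((1 + |y|) ^ s * bracket (x + y) ^ s) := by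
          rw [← mul_assoc, ← Real.rpow_add (by positivity)]; simp
      _ ≤ (1 + |y|) ^ (-s) * bracket x ^ s :=
          mul_le_mul_of_nonneg_left h2 (by positivity)
      _ ≤ _ := mul_le_mul_of_nonneg_right (hpow _ (neg_le_abs s))
          (Real.rpow_nonneg (bracket_pos _).le _)

theorem one_le_one_add_abs (m : ℤ) : (1 : ℝ) ≤ 1 + |(m : ℝ)| := by linarith [abs_nonneg (m : ℝ)]

/-- `‖K m j‖ ≤ C (1 + |m|)^p ⟨j⟩^s` for some `C` and `p`. -/
def HasOrder (s : ℝ) (K : ℤ → ℤ → ℂ) : Prop :=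
  ∃ C : ℝ, 0 ≤ C ∧ ∃ p : ℕ, ∀ m j : ℤ, ‖K m j‖ ≤ C * (1 + |(m : ℝ)|) ^ p * bracket j ^ s

/-- Amplitudes of order `s`, up to `N` differences in the second variable. -/
def IsAmplitude : ℕ → ℝ → (ℤ → ℤ → ℂ) → Prop
  | 0, s, K => HasOrder s K
  | N + 1, s, K => HasOrder s K ∧ IsAmplitude N (s - 1) fun m => fwdDiff 1 (K m)

theorem HasOrder.mono {s t : ℝ} (h : s ≤ t) {K : ℤ → ℤ → ℂ} (hK : HasOrder s K) :
    HasOrder t K := by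
  obtain ⟨C, hC, p, hp⟩ := hK
  refine ⟨C, hC, p, fun m j => (hp m j).trans ?_⟩
  have := Real.rpow_le_rpow_of_exponent_le (one_le_bracket j) h
  gcongr

theorem HasOrder.add {s : ℝ} {K L : ℤ → ℤ → ℂ} (hK : HasOrder s K) (hL : HasOrder s L) :
    HasOrder s fun m j => K m j + L m j := by
  obtain ⟨C, hC, p, hp⟩ := hK
  obtain ⟨D, hD, q, hq⟩ := hL
  refine ⟨C + D, by positivity, max p q, fun m j => (norm_add_le _ _).trans ?_⟩
  have h1 := pow_le_pow_right₀ (one_le_one_add_abs m) (le_max_left p q)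
  have h2 := pow_le_pow_right₀ (one_le_one_add_abs m) (le_max_right p q)
  have hb := Real.rpow_nonneg (bracket_pos j).le s
  calc _ ≤ C * (1 + |(m : ℝ)|) ^ p * bracket j ^ s + D * (1 + |(m : ℝ)|) ^ q * bracket j ^ s :=
        add_le_add (hp m j) (hq m j)
    _ ≤ C * (1 + |(m : ℝ)|) ^ max p q * bracket j ^ s
        + D * (1 + |(m : ℝ)|) ^ max p q * bracket j ^ s := by gcongr
    _ = _ := by ring

theorem HasOrder.mul {s t : ℝ} {K L : ℤ → ℤ → ℂ} (hK : HasOrder s K) (hL : HasOrder t L) :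
    HasOrder (s + t) fun m j => K m j * L m j := by
  obtain ⟨C, hC, p, hp⟩ := hK
  obtain ⟨D, hD, q, hq⟩ := hL
  refine ⟨C * D, by positivity, p + q, fun m j => ?_⟩
  rw [norm_mul]
  calc _ ≤ (C * (1 + |(m : ℝ)|) ^ p * bracket j ^ s) * (D * (1 + |(m : ℝ)|) ^ q * bracket j ^ t) :=
        mul_le_mul (hp m j) (hq m j) (norm_nonneg _)
          (by have := Real.rpow_nonneg (bracket_pos j).le s; positivity)
    _ = _ := by rw [Real.rpow_add (bracket_pos j), pow_add]; ring

theorem HasOrder.shift {s : ℝ} {K : ℤ → ℤ → ℂ} (hK : HasOrder s K) :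
    HasOrder s fun m j => K m (j + 1) := by
  obtain ⟨C, hC, p, hp⟩ := hK
  obtain ⟨q, hq⟩ := exists_nat_ge |s|
  refine ⟨C * 2 ^ q, by positivity, p, fun m j => (hp m (j + 1)).trans ?_⟩
  have h := bracket_rpow_add_le s j 1 hq
  push_cast
  calc _ ≤ C * (1 + |(m : ℝ)|) ^ p * ((1 + |(1 : ℝ)|) ^ q * bracket j ^ s) := by gcongr
    _ = _ := by norm_num; ring

theorem IsAmplitude.hasOrder {N : ℕ} {s : ℝ} {K : ℤ → ℤ → ℂ} (hK : IsAmplitude N s K) :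
    HasOrder s K := by
  cases N with
  | zero => exact hK
  | succ N => exact hK.1

theorem IsAmplitude.mono {N : ℕ} {s t : ℝ} (h : s ≤ t) {K : ℤ → ℤ → ℂ} (hK : IsAmplitude N s K) :
    IsAmplitude N t K := by
  induction N generalizing s t K with
  | zero => exact HasOrder.mono h hK
  | succ N ih => exact ⟨hK.1.mono h, ih (by linarith) hK.2⟩

theorem IsAmplitude.pred {N : ℕ} {s : ℝ} {K : ℤ → ℤ → ℂ} (hK : IsAmplitude (N + 1) s K) :
    IsAmplitude N s K := by
  induction N generalizing s K with
  | zero => exact hK.1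
  | succ N ih => exact ⟨hK.1, ih hK.2⟩

theorem IsAmplitude.shift {N : ℕ} {s : ℝ} {K : ℤ → ℤ → ℂ} (hK : IsAmplitude N s K) :
    IsAmplitude N s fun m j => K m (j + 1) := by
  induction N generalizing s K with
  | zero => exact HasOrder.shift hK
  | succ N ih => exact ⟨hK.1.shift, ih hK.2⟩

theorem IsAmplitude.add {N : ℕ} {s : ℝ} {K L : ℤ → ℤ → ℂ} (hK : IsAmplitude N s K)
    (hL : IsAmplitude N s L) : IsAmplitude N s fun m j => K m j + L m j := by
  induction N generalizing s K L with
  | zero => exact HasOrder.add hK hL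
  | succ N ih =>
    refine ⟨hK.1.add hL.1, ?_⟩
    convert ih hK.2 hL.2 using 3 with m j
    simp only [fwdDiff]; ring

/-- Discrete Leibniz rule: `△(KL) = △K · L + K(· + 1) · △L`. The translate is harmless by
`IsAmplitude.shift`. -/
theorem IsAmplitude.mul {N : ℕ} {s t : ℝ} {K L : ℤ → ℤ → ℂ} (hK : IsAmplitude N s K)
    (hL : IsAmplitude N t L) : IsAmplitude N (s + t) fun m j => K m j * L m j := by
  induction N generalizing s t K L with
  | zero => exact HasOrder.mul hK hL
  | succ N ih =>
    refine ⟨hK.1.mul hL.1, ?_⟩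
    have h1 := ih hK.2 hL.pred
    have h2 := ih hK.pred.shift hL.2
    rw [show s - 1 + t = s + t - 1 by ring] at h1
    rw [show s + (t - 1) = s + t - 1 by ring] at h2
    convert h1.add h2 using 3 with m j
    simp only [fwdDiff]; ring

theorem IsAmplitude.const (N : ℕ) (c : ℂ) : IsAmplitude N 0 fun _ _ => c := by
  have h0 : ∀ N (s : ℝ), IsAmplitude N s fun _ _ => 0 := by
    intro N
    have hb : ∀ s, HasOrder s fun _ _ => 0 := fun s => ⟨0, le_rfl, 0, fun m j => by simp⟩
    induction N with
    | zero => exact hb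
    | succ N ih => exact fun s => ⟨hb s, by simpa [fwdDiff] using ih (s - 1)⟩
  have hb : HasOrder 0 fun _ _ => c := ⟨‖c‖, norm_nonneg c, 0, fun m j => by simp⟩
  cases N with
  | zero => exact hb
  | succ N => exact ⟨hb, by simpa [fwdDiff] using h0 N (0 - 1)⟩

theorem IsAmplitude.const_mul {N : ℕ} {s : ℝ} {K : ℤ → ℤ → ℂ} (c : ℂ) (hK : IsAmplitude N s K) :
    IsAmplitude N s fun m j => c * K m j := by
  simpa using (IsAmplitude.const N c).mul hK

/-- From `△(1/c) = -△c · (1/c) · (1/c)(· + 1)`: a size bound on the reciprocal is enough, and the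
differences follow by induction. -/
theorem IsAmplitude.inv {N : ℕ} {s : ℝ} {c d : ℤ → ℤ → ℂ} (hc : IsAmplitude N s c)
    (hd : HasOrder (-s) d) (hcd : ∀ m j, c m j * d m j = 1) : IsAmplitude N (-s) d := by
  induction N generalizing s with
  | zero => exact hd
  | succ N ih =>
    refine ⟨hd, ?_⟩
    have h1 := ih hc.pred hd
    have h2 := ((hc.2.mul h1).mul h1.shift).const_mul (-1)
    rw [show s - 1 + -s + -s = -s - 1 by ring] at h2
    convert h2 using 3 with m j
    simp only [fwdDiff]
    linear_combination (-d m (j + 1)) * hcd m j + (d m j) * hcd m (j + 1)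

/-- From `△√a = △a / (√a + √a(· + 1))`, where `e` is the reciprocal of the denominator. This
identity takes the place of differentiating `(ξ² + m²)^{1/2}` in a continuous variable `ξ`. -/
theorem IsAmplitude.sqrt {N : ℕ} {s : ℝ} {a b e : ℤ → ℤ → ℂ} (ha : IsAmplitude N (s + s) a)
    (hb : HasOrder s b) (hba : ∀ m j, b m j * b m j = a m j) (he : HasOrder (-s) e)
    (hbe : ∀ m j, (b m j + b m (j + 1)) * e m j = 1) : IsAmplitude N s b := by
  induction N with
  | zero => exact hb
  | succ N ih =>
    refine ⟨hb, ?_⟩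
    have h1 := ih ha.pred
    have h2 := ha.2.mul ((h1.add h1.shift).inv he hbe)
    rw [show s + s - 1 + -s = s - 1 by ring] at h2
    convert h2 using 3 with m j
    simp only [fwdDiff, ← hba]
    linear_combination (-(b m (j + 1) - b m j)) * hbe m j

/-- Allows the eigenvalue at `j = 0` to be modified in the massless case without affecting any
order. -/
theorem isAmplitude_of_finite_support {f : ℤ → ℂ} (hf : f.support.Finite) (N : ℕ) (s : ℝ) :
    IsAmplitude N s fun _ => f := by
  have hb : ∀ (g : ℤ → ℂ) (s : ℝ), g.support.Finite → HasOrder s fun _ => g := by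
    intro g s hg
    refine ⟨∑ i ∈ hg.toFinset, ‖g i‖ * bracket i ^ (-s), Finset.sum_nonneg fun i _ => ?_, 0,
      fun m j => ?_⟩
    · have := Real.rpow_nonneg (bracket_pos i).le (-s); positivity
    by_cases hj : g j = 0
    · simp only [hj, norm_zero]
      have h0 : ∀ (i : ℤ) (t : ℝ), 0 ≤ bracket i ^ t := fun i t =>
        Real.rpow_nonneg (bracket_pos i).le t
      have : 0 ≤ ∑ i ∈ hg.toFinset, ‖g i‖ * bracket i ^ (-s) :=
        Finset.sum_nonneg fun i _ => mul_nonneg (norm_nonneg _) (h0 i _)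
      have := h0 j s
      positivity
    · have h1 : ‖g j‖ * bracket j ^ (-s) ≤ ∑ i ∈ hg.toFinset, ‖g i‖ * bracket i ^ (-s) :=
        Finset.single_le_sum (f := fun i : ℤ => ‖g i‖ * bracket i ^ (-s))
          (fun i _ => mul_nonneg (norm_nonneg _) (Real.rpow_nonneg (bracket_pos i).le _))
          (by simpa using hj)
      have h2 := mul_le_mul_of_nonneg_right h1 (Real.rpow_nonneg (bracket_pos j).le s)
      rw [mul_assoc, ← Real.rpow_add (bracket_pos j)] at h2
      simpa using h2
  induction N generalizing f s with
  | zero => exact hb f s hf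
  | succ N ih =>
    refine ⟨hb f s hf, ih ?_ _⟩
    refine (hf.union (hf.preimage (f := fun j : ℤ => j + 1)
      (add_left_injective (1 : ℤ)).injOn)).subset fun j hj => ?_
    by_contra h
    simp only [Set.mem_union, Function.mem_support, Set.mem_preimage, not_or, not_not] at h
    exact hj (by simp [fwdDiff, h.1, h.2])

/-- Peetre's inequality trades `⟨j + m⟩^s` for `⟨j⟩^s` at the price of a power of `1 + |m|`, which
`HasOrder` tolerates. -/
theorem IsAmplitude.translate {N : ℕ} {s : ℝ} {f : ℤ → ℂ} (hf : IsAmplitude N s fun _ => f) :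
    IsAmplitude N s fun m j => f (j + m) := by
  have hb : ∀ (g : ℤ → ℂ) (s : ℝ), HasOrder s (fun _ => g) → HasOrder s fun m j => g (j + m) := by
    rintro g s ⟨C, hC, p, hp⟩
    obtain ⟨q, hq⟩ := exists_nat_ge |s|
    refine ⟨C, hC, q, fun m j => (hp 0 (j + m)).trans ?_⟩
    have h := bracket_rpow_add_le s j m hq
    push_cast
    simp only [abs_zero, add_zero, one_pow, mul_one]
    rw [mul_assoc]
    gcongr
  induction N generalizing f s with
  | zero => exact hb f s hf
  | succ N ih =>
    refine ⟨hb f s hf.1, ?_⟩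
    convert ih hf.2 using 3 with m j
    simp only [fwdDiff, add_right_comm]

/-- The gain of one order behind the commutator `[X, B]`. The increment telescopes into `|m|` unit
differences of order `s - 1`, each compared with its value at `j` by Peetre's inequality. All `N`
are assumed because the conclusion consumes one difference more than it provides. -/
theorem IsAmplitude.translate_sub {s : ℝ} {f : ℤ → ℂ} (hf : ∀ N, IsAmplitude N s fun _ => f)
    (N : ℕ) : IsAmplitude N (s - 1) fun m j => f (j + m) - f j := by
  have hb : ∀ (g : ℤ → ℂ) (s : ℝ), HasOrder s (fun _ => fwdDiff 1 g) →
      HasOrder s fun m j => g (j + m) - g j := by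
    rintro g s ⟨C, hC, p, hp⟩
    obtain ⟨q, hq⟩ := exists_nat_ge |s|
    have hC' : ∀ j : ℤ, ‖g (j + 1) - g j‖ ≤ C * bracket j ^ s := fun j => by
      simpa [fwdDiff] using hp 0 j
    -- The base point `m` of the estimate is separate from the start `j` of the telescoping sum,
    -- because for a negative translation the sum starts at the far end.
    have hn : ∀ (n : ℕ) (j m : ℤ), (∀ i : ℕ, i ≤ n → |((j + i - m : ℤ) : ℝ)| ≤ n) →
        ‖g (j + n) - g j‖ ≤ n * (C * ((1 + n) ^ q * bracket m ^ s)) := by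
      intro n j m hm
      have hd : ∀ i ∈ Finset.range n, ‖g (j + (i + 1 : ℕ)) - g (j + i)‖ ≤
          C * ((1 + n) ^ q * bracket m ^ s) := by
        intro i hi
        have h1 := hC' (j + i)
        rw [add_assoc] at h1
        push_cast
        refine h1.trans (mul_le_mul_of_nonneg_left ?_ hC)
        have h2 := bracket_rpow_add_le s m ((j + i - m : ℤ) : ℝ) hq
        have h3 := hm i (Finset.mem_range.1 hi).le
        have h4 : (m : ℝ) + ((j + i - m : ℤ) : ℝ) = ((j + i : ℤ) : ℝ) := by push_cast; ring
        rw [h4] at h2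
        refine h2.trans ?_
        have := Real.rpow_nonneg (bracket_pos m).le s
        gcongr
      have h5 := Finset.sum_range_sub (fun i : ℕ => g (j + i)) n
      simp only [Nat.cast_zero, add_zero] at h5
      rw [← h5]
      refine (norm_sum_le _ _).trans ((Finset.sum_le_sum hd).trans ?_)
      simp
    refine ⟨C, hC, q + 1, fun m j => ?_⟩
    have hfin : ∀ n : ℕ, (n : ℝ) = |(m : ℝ)| → (n : ℝ) * (C * ((1 + n) ^ q * bracket j ^ s)) ≤
        C * (1 + |(m : ℝ)|) ^ (q + 1) * bracket j ^ s := by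
      intro n hn
      rw [hn, pow_succ]
      have := Real.rpow_nonneg (bracket_pos j).le s
      have h6 : 0 ≤ C * (1 + |(m : ℝ)|) ^ q * bracket j ^ s := by positivity
      nlinarith
    obtain ⟨n, rfl | rfl⟩ := m.eq_nat_or_neg
    · refine (hn n j j fun i hi => ?_).trans (hfin n (by simp))
      simpa using hi
    · have h := hn n (j - n) j fun i hi => ?_
      · rw [sub_add_cancel, norm_sub_rev] at h
        simpa [sub_eq_add_neg] using h.trans (hfin n (by simp))
      · have : ((j - n + i - j : ℤ) : ℝ) = i - n := by push_cast; ring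
        have hi' : (i : ℝ) ≤ n := by exact_mod_cast hi
        rw [this, abs_le]
        constructor <;> linarith [(Nat.cast_nonneg i : (0 : ℝ) ≤ i)]
  induction N generalizing f s with
  | zero => exact hb f _ (hf 1).2
  | succ N ih =>
    refine ⟨hb f _ (hf 1).2, ?_⟩
    convert ih (s := s - 1) (f := fwdDiff 1 f) (fun N => (hf (N + 1)).2) using 3 with m j
    simp only [fwdDiff, add_right_comm]
    ring

theorem IsAmplitude.exists_bound {N : ℕ} {s : ℝ} {K : ℤ → ℤ → ℂ} (hK : IsAmplitude N s K) :
    HasOrder (s - N) fun m => (fwdDiff 1)^[N] (K m) := by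
  induction N generalizing s K with
  | zero => simpa [IsAmplitude] using hK
  | succ N ih =>
    have h := ih hK.2
    simp only [Function.iterate_succ, Function.comp]
    convert h using 1
    push_cast; ring

/-! ### The eigenvalues of `B` as symbols -/

/-- `λⱼ²`, with the value at a vanishing eigenvalue replaced by `1`. -/
def regEigSq (mass : ℝ) (j : ℤ) : ℝ :=
  (j : ℝ) ^ 2 + mass ^ 2 + if mass = 0 ∧ j = 0 then 1 else 0

/-- The eigenvalues `λⱼ`, a vanishing eigenvalue being replaced by `1`. -/
def regEig (mass : ℝ) (j : ℤ) : ℝ := Real.sqrt (regEigSq mass j)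

/-- The symbol `λⱼ^{-1/2}`, a vanishing eigenvalue being replaced by `1`. -/
def invSqrtEig (mass : ℝ) (j : ℤ) : ℝ := regEig mass j ^ (-(1 / 2) : ℝ)

/-- Ellipticity. The fourth power is chosen so that two successive square roots leave the constants
`c²` and `c`. -/
theorem exists_le_regEigSq (mass : ℝ) :
    ∃ c : ℝ, 0 < c ∧ ∀ j : ℤ, c ^ 4 * bracket j ^ 2 ≤ regEigSq mass j := by
  by_cases hm : mass = 0
  · refine ⟨1 / 2, by norm_num, fun j => ?_⟩
    rw [bracket_sq, regEigSq]
    by_cases hj : j = 0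
    · simp [hm, hj]; norm_num
    · have : (1 : ℝ) ≤ (j : ℝ) ^ 2 := by
        have : 1 ≤ j ^ 2 := (sq_pos_of_ne_zero hj)
        exact_mod_cast this
      simp [hm, hj]; nlinarith
  · have hm2 : 0 < mass ^ 2 := by positivity
    obtain ⟨c, hc, hc1, hc2⟩ : ∃ c : ℝ, 0 < c ∧ c ^ 4 ≤ 1 ∧ c ^ 4 ≤ mass ^ 2 := by
      have hd : 0 < min 1 (mass ^ 2) := lt_min one_pos hm2
      have h1 : min 1 (mass ^ 2) ^ 4 ≤ min 1 (mass ^ 2) :=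
        pow_le_of_le_one hd.le (min_le_left _ _) (by norm_num)
      exact ⟨_, hd, h1.trans (min_le_left _ _), h1.trans (min_le_right _ _)⟩
    refine ⟨c, hc, fun j => ?_⟩
    rw [bracket_sq, regEigSq]
    simp only [hm, false_and, if_false]
    nlinarith [sq_nonneg (j : ℝ)]

theorem regEigSq_pos (mass : ℝ) (j : ℤ) : 0 < regEigSq mass j := by
  obtain ⟨c, hc, h⟩ := exists_le_regEigSq mass
  have := bracket_pos j
  exact lt_of_lt_of_le (by positivity) (h j)

theorem regEig_pos (mass : ℝ) (j : ℤ) : 0 < regEig mass j := Real.sqrt_pos.2 (regEigSq_pos mass j)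

theorem regEig_neg (mass : ℝ) (j : ℤ) : regEig mass (-j) = regEig mass j := by
  simp [regEig, regEigSq]

theorem invSqrtEig_neg (mass : ℝ) (j : ℤ) : invSqrtEig mass (-j) = invSqrtEig mass j := by
  simp [invSqrtEig, regEig_neg]

/-- The cancellation that reduces `XBX` to a sandwich of the multiplication by `Y²`. -/
theorem invSqrtEig_mul_regEig (mass : ℝ) (j : ℤ) :
    invSqrtEig mass j * regEig mass j * invSqrtEig mass j = 1 := by
  have h := regEig_pos mass j
  calc _ = regEig mass j ^ (-(1 / 2) : ℝ) * regEig mass j ^ (1 : ℝ) *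
        regEig mass j ^ (-(1 / 2) : ℝ) := by rw [Real.rpow_one, invSqrtEig]
    _ = 1 := by rw [← Real.rpow_add h, ← Real.rpow_add h]; norm_num

theorem regEig_eq_eigB (mass : ℝ) {j : ℤ} (h : eigB mass j ≠ 0) : regEig mass j = eigB mass j := by
  rw [regEig, eigB, regEigSq, if_neg, add_zero]
  rintro ⟨h1, h2⟩
  exact h (by simp [eigB, h1, h2])

theorem eigB_ne_zero (mass : ℝ) {j : ℤ} (h : j ≠ 0) : eigB mass j ≠ 0 := by
  have : (j : ℝ) ≠ 0 := by exact_mod_cast h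
  exact (Real.sqrt_pos.2 (by positivity)).ne'

/-- The size of `a` bounds the root from above; ellipticity bounds the denominator `b j + b (j + 1)`
from below, as `IsAmplitude.sqrt` requires. It is applied twice, for `λⱼ` and for `λⱼ^{1/2}`. -/
theorem isAmplitude_sqrt_of_elliptic {a b : ℤ → ℝ} {s c : ℝ} (hc : 0 < c)
    (ha : ∀ N, IsAmplitude N (s + s) fun _ j => ((a j : ℝ) : ℂ)) (hb : ∀ j, 0 ≤ b j)
    (hab : ∀ j, b j * b j = a j) (hbc : ∀ j : ℤ, c * bracket j ^ s ≤ b j) (N : ℕ) :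
    IsAmplitude N s fun _ j => ((b j : ℝ) : ℂ) := by
  have hbr : ∀ j : ℤ, 0 < bracket j ^ s := fun j => Real.rpow_pos_of_pos (bracket_pos j) s
  have hpos : ∀ j, 0 < b j := fun j => lt_of_lt_of_le (mul_pos hc (hbr j)) (hbc j)
  refine (ha N).sqrt (e := fun _ j => (((b j + b (j + 1))⁻¹ : ℝ) : ℂ)) ?_ ?_ ?_ ?_
  · obtain ⟨C, hC, p, hp⟩ := (ha 0).hasOrder
    refine ⟨Real.sqrt C, Real.sqrt_nonneg C, 0, fun m j => ?_⟩
    have h := hp 0 j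
    simp only [Int.cast_zero, abs_zero, add_zero, one_pow, mul_one, Complex.norm_real,
      Real.norm_eq_abs] at h
    rw [pow_zero, mul_one, Complex.norm_real, Real.norm_eq_abs, abs_of_nonneg (hb j)]
    refine le_of_sq_le_sq ?_ (by have := (hbr j).le; positivity)
    rw [mul_pow, Real.sq_sqrt hC, sq, sq, hab, ← Real.rpow_add (bracket_pos j)]
    exact (le_abs_self _).trans h
  · intro m j
    exact_mod_cast hab j
  · refine ⟨c⁻¹, by positivity, 0, fun m j => ?_⟩
    have h1 := hpos j
    have h2 := hpos (j + 1)
    rw [pow_zero, mul_one, Complex.norm_real, Real.norm_eq_abs, abs_of_nonneg (by positivity),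
      Real.rpow_neg (bracket_pos j).le, ← mul_inv]
    exact inv_anti₀ (mul_pos hc (hbr j)) ((hbc j).trans (by linarith))
  · intro m j
    have h1 := hpos j
    have h2 := hpos (j + 1)
    have : b j + b (j + 1) ≠ 0 := by positivity
    exact_mod_cast mul_inv_cancel₀ this

theorem isAmplitude_regEigSq (mass : ℝ) (N : ℕ) :
    IsAmplitude N 2 fun _ j => ((regEigSq mass j : ℝ) : ℂ) := by
  have hj : ∀ N, IsAmplitude N 1 fun _ j => (j : ℂ) := by
    have hb : HasOrder 1 fun _ j => (j : ℂ) := by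
      refine ⟨1, zero_le_one, 0, fun m j => ?_⟩
      simpa using abs_le_bracket j
    intro N
    cases N with
    | zero => exact hb
    | succ N =>
      refine ⟨hb, ?_⟩
      convert IsAmplitude.const N 1 using 3 <;> simp [fwdDiff]
  have h1 := (hj N).mul (hj N)
  norm_num at h1
  have h2 : IsAmplitude N 2 fun _ _ => ((mass : ℂ) ^ 2) :=
    (IsAmplitude.const N _).mono (by norm_num)
  have h3 : IsAmplitude N 2 fun _ j => (if mass = 0 ∧ j = 0 then (1 : ℂ) else 0) := by
    refine isAmplitude_of_finite_support ((Set.finite_singleton (0 : ℤ)).subset fun j hj => ?_) N 2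
    by_contra h
    exact hj (if_neg fun h' => h h'.2)
  convert (h1.add h2).add h3 using 3 with m j
  rw [regEigSq]
  push_cast
  split_ifs <;> simp [sq]

theorem isAmplitude_regEig (mass : ℝ) (N : ℕ) :
    IsAmplitude N 1 fun _ j => ((regEig mass j : ℝ) : ℂ) := by
  obtain ⟨c, hc, h⟩ := exists_le_regEigSq mass
  refine isAmplitude_sqrt_of_elliptic (c := c ^ 2) (by positivity)
    (fun N => by norm_num; exact isAmplitude_regEigSq mass N)
    (fun j => (regEig_pos mass j).le) (fun j => Real.mul_self_sqrt (regEigSq_pos mass j).le)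
    (fun j => ?_) N
  refine Real.le_sqrt_of_sq_le ?_
  rw [Real.rpow_one]
  calc _ = c ^ 4 * bracket j ^ 2 := by ring
    _ ≤ _ := h j

theorem isAmplitude_invSqrtEig (mass : ℝ) (N : ℕ) :
    IsAmplitude N (-(1 / 2)) fun _ j => ((invSqrtEig mass j : ℝ) : ℂ) := by
  obtain ⟨c, hc, h⟩ := exists_le_regEigSq mass
  have hle : ∀ j : ℤ, c * bracket j ^ (1 / 2 : ℝ) ≤ Real.sqrt (regEig mass j) := by
    intro j
    refine Real.le_sqrt_of_sq_le (Real.le_sqrt_of_sq_le ?_)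
    rw [← Real.sqrt_eq_rpow, mul_pow, Real.sq_sqrt (bracket_pos j).le]
    calc _ = c ^ 4 * bracket j ^ 2 := by ring
      _ ≤ _ := h j
  have hs : IsAmplitude N (1 / 2) fun _ j => ((Real.sqrt (regEig mass j) : ℝ) : ℂ) := by
    refine isAmplitude_sqrt_of_elliptic hc
      (fun N => by norm_num; exact isAmplitude_regEig mass N)
      (fun j => Real.sqrt_nonneg _) (fun j => Real.mul_self_sqrt (regEig_pos mass j).le) hle N
  have hinv : ∀ j, invSqrtEig mass j = (Real.sqrt (regEig mass j))⁻¹ := fun j => by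
    rw [invSqrtEig, Real.rpow_neg (regEig_pos mass j).le, ← Real.sqrt_eq_rpow]
  refine hs.inv ⟨c⁻¹, by positivity, 0, fun m j => ?_⟩ fun m j => ?_
  · simp only [hinv]
    rw [pow_zero, mul_one, Complex.norm_real, Real.norm_eq_abs,
      abs_of_nonneg (by positivity), Real.rpow_neg (bracket_pos j).le, ← mul_inv]
    exact inv_anti₀ (mul_pos hc (Real.rpow_pos_of_pos (bracket_pos j) _)) (hle j)
  · simp only [hinv]
    have := (Real.sqrt_pos.2 (regEig_pos mass j)).ne'
    exact_mod_cast mul_inv_cancel₀ this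

/-! ### Fourier modes in the angles and in space -/

/-- Indices `(k, m)` of the Fourier modes `e^{ik·θ + imx}`. -/
abbrev Modes (ν : ℕ) : Type := (Fin ν → ℤ) × ℤ

/-- The Euclidean length of `k`. -/
def waveLen (k : Fin ν → ℤ) : ℝ := Real.sqrt (∑ i, (k i : ℝ) ^ 2)

/-- `k · θ`. -/
def phase (k : Fin ν → ℤ) (θ : Fin ν → ℂ) : ℂ := ∑ i, (k i : ℂ) * θ i

/-- `e^{ik·θ}`. -/
def angleMode (k : Fin ν → ℤ) (θ : Fin ν → ℂ) : ℂ := Complex.exp (Complex.I * phase k θ)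

/-- `e^{imx}`. -/
def spaceMode (m : ℤ) (x : ℝ) : ℂ := Complex.exp (Complex.I * m * x)

/-- The weight `e^{σ|k|} (1 + |m|)^N`. -/
def weight (σ : ℝ) (N : ℕ) (g : Modes ν) : ℝ :=
  Real.exp (σ * waveLen g.1) * (1 + |(g.2 : ℝ)|) ^ N

/-- The weighted `ℓ¹` norm of a family of Fourier coefficients. -/
def modeNorm (σ : ℝ) (N : ℕ) (y : Modes ν → ℂ) : ℝ≥0∞ :=
  ∑' g, ENNReal.ofReal (weight σ N g) * ‖y g‖ₑ

/-- The weighted `ℓ¹` norm of a family of functions of `j`, with `β` differences taken. -/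
def ampNorm (σ s : ℝ) (β N : ℕ) (A : Modes ν → ℤ → ℂ) : ℝ≥0∞ :=
  ∑' g, ENNReal.ofReal (weight σ N g) *
    ⨆ j : ℤ, ENNReal.ofReal (bracket j ^ (-s + β)) * ‖(fwdDiff 1)^[β] (A g) j‖ₑ

/-- The symbol `∑ A (k, m) j e^{ik·θ + imx}`. -/
def symb (A : Modes ν → ℤ → ℂ) : Symb ν :=
  fun θ x j => ∑' g : Modes ν, A g j * (angleMode g.1 θ * spaceMode g.2 x)

/-- Absolute convergence, with weights, of the series defining `symb A`. -/
def WeightSummable (σ : ℝ) (A : Modes ν → ℤ → ℂ) : Prop :=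
  ∀ j N, Summable fun g => weight σ N g * ‖A g j‖

theorem weight_pos (σ : ℝ) (N : ℕ) (g : Modes ν) : 0 < weight σ N g := by
  rw [weight]; positivity

theorem waveLen_eq_norm (k : Fin ν → ℤ) :
    waveLen k = ‖(WithLp.toLp 2 fun i => (k i : ℝ) : EuclideanSpace ℝ (Fin ν))‖ := by
  simp [waveLen, EuclideanSpace.norm_eq]

theorem waveLen_nonneg (k : Fin ν → ℤ) : 0 ≤ waveLen k := Real.sqrt_nonneg _

theorem waveLen_neg (k : Fin ν → ℤ) : waveLen (-k) = waveLen k := by simp [waveLen]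

theorem waveLen_add_le (k l : Fin ν → ℤ) : waveLen (k + l) ≤ waveLen k + waveLen l := by
  simp only [waveLen_eq_norm]
  refine le_of_eq_of_le ?_ (norm_add_le _ _)
  congr 1
  ext i
  simp

theorem abs_le_waveLen (k : Fin ν → ℤ) (i : Fin ν) : |(k i : ℝ)| ≤ waveLen k := by
  rw [waveLen_eq_norm]
  exact PiLp.norm_apply_le (p := 2)
    (WithLp.toLp 2 fun i => (k i : ℝ) : EuclideanSpace ℝ (Fin ν)) i

theorem imNorm_eq_norm (θ : Fin ν → ℂ) :
    imNorm θ = ‖(WithLp.toLp 2 fun i => (θ i).im : EuclideanSpace ℝ (Fin ν))‖ := by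
  simp [imNorm, EuclideanSpace.norm_eq]

theorem abs_im_phase_le (k : Fin ν → ℤ) (θ : Fin ν → ℂ) :
    |(phase k θ).im| ≤ waveLen k * imNorm θ := by
  rw [waveLen_eq_norm, imNorm_eq_norm]
  refine le_of_eq_of_le ?_ (abs_real_inner_le_norm _ _)
  simp [phase, PiLp.inner_apply, mul_comm]

theorem norm_angleMode (k : Fin ν → ℤ) (θ : Fin ν → ℂ) :
    ‖angleMode k θ‖ = Real.exp (-(phase k θ).im) := by
  rw [angleMode, Complex.norm_exp]; simp

theorem norm_angleMode_le {σ : ℝ} (k : Fin ν → ℤ) {θ : Fin ν → ℂ} (hθ : imNorm θ ≤ σ) :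
    ‖angleMode k θ‖ ≤ Real.exp (σ * waveLen k) := by
  rw [norm_angleMode]
  refine Real.exp_le_exp.2 ((neg_le_abs _).trans ((abs_im_phase_le k θ).trans ?_))
  rw [mul_comm]
  exact mul_le_mul_of_nonneg_right hθ (waveLen_nonneg k)

theorem norm_spaceMode (m : ℤ) (x : ℝ) : ‖spaceMode m x‖ = 1 := by
  rw [spaceMode, Complex.norm_exp]; simp

theorem angleMode_add (k l : Fin ν → ℤ) (θ : Fin ν → ℂ) :
    angleMode (k + l) θ = angleMode k θ * angleMode l θ := by
  rw [angleMode, angleMode, angleMode, ← Complex.exp_add]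
  congr 1
  simp [phase, add_mul, Finset.sum_add_distrib, mul_add]

theorem angleMode_shift (k l : Fin ν → ℤ) (θ : Fin ν → ℂ) :
    angleMode k (shift l θ) = angleMode k θ := by
  rw [angleMode, angleMode, Complex.exp_eq_exp_iff_exists_int]
  refine ⟨∑ i, k i * l i, ?_⟩
  simp only [phase, shift, mul_add, Finset.sum_add_distrib]
  push_cast
  rw [add_right_inj, Finset.sum_mul, Finset.mul_sum]
  exact Finset.sum_congr rfl fun i _ => by ring

theorem spaceMode_add_two_pi (m : ℤ) (x : ℝ) : spaceMode m (x + 2 * Real.pi) = spaceMode m x := by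
  rw [spaceMode, spaceMode, Complex.exp_eq_exp_iff_exists_int]
  exact ⟨m, by push_cast; ring⟩

theorem hasDerivAt_spaceMode (m : ℤ) (x : ℝ) :
    HasDerivAt (spaceMode m) (Complex.I * m * spaceMode m x) x := by
  have h : HasDerivAt (fun x : ℝ => Complex.I * m * (x : ℂ)) (Complex.I * m) x := by
    simpa using (Complex.ofRealCLM.hasDerivAt (x := x)).const_mul (Complex.I * m)
  exact h.cexp.congr_deriv (mul_comm _ _)

theorem norm_angleMode_mul_spaceMode_le {σ : ℝ} (g : Modes ν) {θ : Fin ν → ℂ}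
    (hθ : imNorm θ ≤ σ) (x : ℝ) : ‖angleMode g.1 θ * spaceMode g.2 x‖ ≤ weight σ 0 g := by
  rw [norm_mul, norm_spaceMode, mul_one, weight, pow_zero, mul_one]
  exact norm_angleMode_le g.1 hθ

/-! ### Convergence and differentiation of the symbol series. -/

theorem WeightSummable.of_ampNorm {σ s : ℝ} {A : Modes ν → ℤ → ℂ}
    (h : ∀ N, ampNorm σ s 0 N A < ∞) : WeightSummable σ A := by
  intro j N
  have hb : 0 < bracket j ^ (-s) := Real.rpow_pos_of_pos (bracket_pos j) _
  have h1 : ∑' g, ENNReal.ofReal (weight σ N g * ‖A g j‖) ≠ ∞ := by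
    have h2 : ENNReal.ofReal (bracket j ^ (-s)) * ∑' g, ENNReal.ofReal (weight σ N g * ‖A g j‖) ≤
        ampNorm σ s 0 N A := by
      rw [← ENNReal.tsum_mul_left, ampNorm]
      refine ENNReal.tsum_le_tsum fun g => ?_
      rw [ENNReal.ofReal_mul (weight_pos σ N g).le, ofReal_norm, mul_left_comm]
      gcongr
      refine le_of_eq_of_le ?_ (le_iSup _ j)
      simp
    intro h3
    rw [h3, ENNReal.mul_top (by simpa using hb)] at h2
    exact absurd (h N) (by simpa using h2)
  have h4 := ENNReal.summable_toReal h1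
  refine h4.congr fun g => ENNReal.toReal_ofReal (mul_nonneg (weight_pos σ N g).le (norm_nonneg _))

theorem WeightSummable.summable {σ : ℝ} {A : Modes ν → ℤ → ℂ} (hA : WeightSummable σ A)
    {θ : Fin ν → ℂ} (hθ : imNorm θ ≤ σ) (x : ℝ) (j : ℤ) :
    Summable fun g : Modes ν => A g j * (angleMode g.1 θ * spaceMode g.2 x) := by
  refine Summable.of_norm_bounded (hA j 0) fun g => ?_
  rw [norm_mul, mul_comm]
  exact mul_le_mul_of_nonneg_right (norm_angleMode_mul_spaceMode_le g hθ x) (norm_nonneg _)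

theorem WeightSummable.fwdDiff {σ : ℝ} {A : Modes ν → ℤ → ℂ} (hA : WeightSummable σ A) :
    WeightSummable σ fun g => fwdDiff 1 (A g) := by
  intro j N
  refine Summable.of_nonneg_of_le (fun g => mul_nonneg (weight_pos σ N g).le (norm_nonneg _))
    (fun g => ?_) ((hA (j + 1) N).add (hA j N))
  rw [← mul_add]
  exact mul_le_mul_of_nonneg_left (norm_sub_le _ _) (weight_pos σ N g).le

theorem WeightSummable.sub {σ : ℝ} {A B : Modes ν → ℤ → ℂ} (hA : WeightSummable σ A)
    (hB : WeightSummable σ B) : WeightSummable σ (A - B) := by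
  intro j N
  refine Summable.of_nonneg_of_le (fun g => mul_nonneg (weight_pos σ N g).le (norm_nonneg _))
    (fun g => ?_) ((hA j N).add (hB j N))
  rw [← mul_add]
  exact mul_le_mul_of_nonneg_left (norm_sub_le _ _) (weight_pos σ N g).le

theorem WeightSummable.deriv {σ : ℝ} {A : Modes ν → ℤ → ℂ} (hA : WeightSummable σ A) :
    WeightSummable σ fun g j => Complex.I * g.2 * A g j := by
  intro j N
  refine Summable.of_nonneg_of_le (fun g => mul_nonneg (weight_pos σ N g).le (norm_nonneg _))
    (fun g => ?_) (hA j (N + 1))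
  simp only [norm_mul, Complex.norm_I, one_mul, Complex.norm_intCast, weight, pow_succ]
  rw [← mul_assoc, ← mul_assoc]
  refine mul_le_mul_of_nonneg_right ?_ (norm_nonneg _)
  exact mul_le_mul_of_nonneg_left (by linarith) (by positivity)

theorem fwdDiff_iterate_symb {σ : ℝ} {A : Modes ν → ℤ → ℂ} (hA : WeightSummable σ A)
    {θ : Fin ν → ℂ} (hθ : imNorm θ ≤ σ) (x : ℝ) (β : ℕ) :
    (fwdDiff (1 : ℤ))^[β] (symb A θ x) = symb (fun g => (fwdDiff 1)^[β] (A g)) θ x := by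
  induction β generalizing A with
  | zero => rfl
  | succ β ih =>
    rw [Function.iterate_succ, Function.comp]
    have : fwdDiff (1 : ℤ) (symb A θ x) = symb (fun g => fwdDiff 1 (A g)) θ x := by
      funext j
      simp only [fwdDiff, symb, sub_mul]
      rw [(hA.summable hθ x (j + 1)).tsum_sub (hA.summable hθ x j)]
    rw [this, ih hA.fwdDiff]
    rfl

theorem WeightSummable.fwdDiff_iterate {σ : ℝ} {A : Modes ν → ℤ → ℂ} (hA : WeightSummable σ A)
    (β : ℕ) : WeightSummable σ fun g => (_root_.fwdDiff 1)^[β] (A g) := by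
  induction β generalizing A with
  | zero => exact hA
  | succ β ih => exact ih hA.fwdDiff

theorem hasDerivAt_symb {σ : ℝ} {A : Modes ν → ℤ → ℂ} (hA : WeightSummable σ A)
    {θ : Fin ν → ℂ} (hθ : imNorm θ ≤ σ) (x : ℝ) (j : ℤ) :
    HasDerivAt (fun x => symb A θ x j) (symb (fun g j => Complex.I * g.2 * A g j) θ x j) x := by
  refine hasDerivAt_tsum (u := fun g : Modes ν => weight σ 0 g * ‖Complex.I * g.2 * A g j‖)
    (y₀ := 0) (g' := fun (g : Modes ν) x =>
      Complex.I * g.2 * A g j * (angleMode g.1 θ * spaceMode g.2 x)) (hA.deriv j 0)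
    (fun g x => ?_) (fun g x => ?_) (hA.summable hθ 0 j) x
  · have h := ((hasDerivAt_spaceMode g.2 x).const_mul (angleMode g.1 θ)).const_mul (A g j)
    refine h.congr_deriv ?_
    ring
  · rw [norm_mul, mul_comm]
    exact mul_le_mul_of_nonneg_right (norm_angleMode_mul_spaceMode_le g hθ x) (norm_nonneg _)

theorem iteratedDeriv_symb {σ : ℝ} {A : Modes ν → ℤ → ℂ} (hA : WeightSummable σ A)
    {θ : Fin ν → ℂ} (hθ : imNorm θ ≤ σ) (j : ℤ) (α : ℕ) :
    iteratedDeriv α (fun x => symb A θ x j) =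
      fun x => symb (fun g j => (Complex.I * g.2) ^ α * A g j) θ x j := by
  induction α generalizing A with
  | zero => simp
  | succ α ih =>
    rw [iteratedDeriv_succ']
    have : deriv (fun x => symb A θ x j) =
        fun x => symb (fun g j => Complex.I * g.2 * A g j) θ x j :=
      funext fun x => (hasDerivAt_symb hA hθ x j).deriv
    rw [this, ih hA.deriv]
    simp only [pow_succ, mul_assoc]

theorem contDiff_symb {σ : ℝ} {A : Modes ν → ℤ → ℂ} (hA : WeightSummable σ A)
    {θ : Fin ν → ℂ} (hθ : imNorm θ ≤ σ) (j : ℤ) :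
    ContDiff ℝ (⊤ : ℕ∞) fun x => symb A θ x j := by
  refine contDiff_of_differentiable_iteratedDeriv fun α _ => ?_
  rw [iteratedDeriv_symb hA hθ j α]
  have h : ∀ α : ℕ, WeightSummable σ fun g j => (Complex.I * (g.2 : ℂ)) ^ α * A g j := by
    intro α
    induction α with
    | zero => simpa using hA
    | succ α ih => simpa only [pow_succ', mul_assoc] using ih.deriv
  exact fun x => (hasDerivAt_symb (h α) hθ x j).differentiableAt

theorem symbDeriv_symb {σ : ℝ} {A : Modes ν → ℤ → ℂ} (hA : WeightSummable σ A)
    {θ : Fin ν → ℂ} (hθ : imNorm θ ≤ σ) (α β : ℕ) (x : ℝ) (j : ℤ) :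
    symbDeriv (symb A) α β θ x j =
      symb (fun g j => (Complex.I * g.2) ^ α * (fwdDiff 1)^[β] (A g) j) θ x j := by
  rw [symbDeriv]
  have : (fun y => (fwdDiff (1 : ℤ))^[β] (symb A θ y) j) =
      fun y => symb (fun g => (fwdDiff 1)^[β] (A g)) θ y j :=
    funext fun y => by rw [fwdDiff_iterate_symb hA hθ]
  rw [this, iteratedDeriv_symb (hA.fwdDiff_iterate β) hθ]

/-- In the strip a mode `e^{ik·θ}` is at most `e^{σ|k|}`, and each derivative in `x` costs `|m|`:
together they are bounded by `weight σ α`, so the series can be estimated term by term. -/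
theorem iSup_symbDeriv_le {σ : ℝ} {A : Modes ν → ℤ → ℂ} (hA : WeightSummable σ A)
    {θ : Fin ν → ℂ} (hθ : imNorm θ ≤ σ) (s : ℝ) (α β : ℕ) :
    ⨆ (x : ℝ) (j : ℤ), ENNReal.ofReal (bracket j ^ (-s + β)) * ‖symbDeriv (symb A) α β θ x j‖ₑ ≤
      ampNorm σ s β α A := by
  refine iSup₂_le fun x j => ?_
  rw [symbDeriv_symb hA hθ, ampNorm, symb]
  refine (mul_le_mul_right enorm_tsum_le_tsum_enorm _).trans ?_
  rw [← ENNReal.tsum_mul_left]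
  refine ENNReal.tsum_le_tsum fun g => ?_
  have h1 : ‖(Complex.I * (g.2 : ℂ)) ^ α * (angleMode g.1 θ * spaceMode g.2 x)‖ₑ ≤
      ENNReal.ofReal (weight σ α g) := by
    rw [← ofReal_norm]
    refine ENNReal.ofReal_le_ofReal ?_
    rw [norm_mul, norm_pow, norm_mul, Complex.norm_I, one_mul, Complex.norm_intCast, weight,
      mul_comm, norm_mul, norm_spaceMode, mul_one]
    exact mul_le_mul (norm_angleMode_le g.1 hθ)
      (pow_le_pow_left₀ (abs_nonneg _) (by linarith) α) (by positivity) (by positivity)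
  calc _ = ‖(Complex.I * (g.2 : ℂ)) ^ α * (angleMode g.1 θ * spaceMode g.2 x)‖ₑ *
        (ENNReal.ofReal (bracket j ^ (-s + β)) * ‖(fwdDiff 1)^[β] (A g) j‖ₑ) := by
        simp only [enorm_mul]; ring
    _ ≤ _ := mul_le_mul' h1 (le_iSup (fun j : ℤ =>
        ENNReal.ofReal (bracket j ^ (-s + β)) * ‖(fwdDiff 1)^[β] (A g) j‖ₑ) j)

/-- The pairs `(α, β)` that enter the seminorm of index `ℓ`. -/
def derivIndices (ℓ : ℕ) : Finset (ℕ × ℕ) :=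
  (Finset.range (ℓ + 1) ×ˢ Finset.range (ℓ + 1)).filter fun p => p.1 + p.2 ≤ ℓ

theorem seminorm_symb_le {σ ρ : ℝ} (hρ : ρ ≤ σ) {A : Modes ν → ℤ → ℂ} (hA : WeightSummable σ A)
    (s : ℝ) (ℓ : ℕ) :
    seminorm s ρ ℓ (symb A) ≤ ∑ p ∈ derivIndices ℓ, ampNorm σ s p.2 p.1 A :=
  iSup₂_le fun _ hθ => Finset.sum_le_sum fun p _ =>
    iSup_symbDeriv_le hA (le_trans hθ hρ) s p.1 p.2

theorem seminorm_congr {s ρ : ℝ} {ℓ : ℕ} {f g : Symb ν} (h : ∀ θ ∈ strip ν ρ, f θ = g θ) :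
    seminorm s ρ ℓ f = seminorm s ρ ℓ g := by
  unfold seminorm
  refine iSup_congr fun θ => iSup_congr fun hθ => ?_
  simp only [symbDeriv, h θ hθ]

theorem seminorm_symb_sub_le {σ ρ : ℝ} (hρ : ρ ≤ σ) {A B : Modes ν → ℤ → ℂ}
    (hA : WeightSummable σ A) (hB : WeightSummable σ B) (s : ℝ) (ℓ : ℕ) :
    seminorm s ρ ℓ (symb A - symb B) ≤ ∑ p ∈ derivIndices ℓ, ampNorm σ s p.2 p.1 (A - B) := by
  -- The difference of two series is the series of the differences where both converge, which is
  -- known only inside the strip.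
  refine le_of_eq_of_le (seminorm_congr fun θ hθ => ?_) (seminorm_symb_le hρ (hA.sub hB) s ℓ)
  funext x j
  have hθ' : imNorm θ ≤ σ := le_trans hθ hρ
  simp only [Pi.sub_apply, symb, sub_mul]
  rw [(hA.summable hθ' x j).tsum_sub (hB.summable hθ' x j)]

/-! ### Analyticity of the symbols in the angles. -/

theorem isOpen_openStrip (σ : ℝ) : IsOpen (openStrip ν σ) := by
  refine isOpen_lt ?_ continuous_const
  unfold imNorm
  fun_prop

theorem convex_openStrip (σ : ℝ) : Convex ℝ (openStrip ν σ) := by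
  have hl : IsLinearMap ℝ fun θ : Fin ν → ℂ =>
      (WithLp.toLp 2 fun i => (θ i).im : EuclideanSpace ℝ (Fin ν)) :=
    { map_add := fun a b => by ext i; simp
      map_smul := fun c a => by ext i; simp }
  have : openStrip ν σ = (fun θ : Fin ν → ℂ =>
      (WithLp.toLp 2 fun i => (θ i).im : EuclideanSpace ℝ (Fin ν))) ⁻¹' Metric.ball 0 σ := by
    ext θ
    simp [openStrip, imNorm_eq_norm]
  rw [this]
  exact (convex_ball 0 σ).is_linear_preimage hl

theorem hasFDerivAt_angleMode (k : Fin ν → ℤ) (θ : Fin ν → ℂ) :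
    HasFDerivAt (angleMode k) (angleMode k θ • Complex.I •
      ∑ i, (k i : ℂ) • (ContinuousLinearMap.proj i : (Fin ν → ℂ) →L[ℂ] ℂ)) θ := by
  have h : HasFDerivAt (phase k)
      (∑ i, (k i : ℂ) • (ContinuousLinearMap.proj i : (Fin ν → ℂ) →L[ℂ] ℂ)) θ := by
    unfold phase
    exact HasFDerivAt.fun_sum fun i _ => (hasFDerivAt_apply i θ).const_mul (k i : ℂ)
  exact (h.const_mul Complex.I).cexp

theorem norm_sum_proj_le (k : Fin ν → ℤ) :
    ‖∑ i, (k i : ℂ) • (ContinuousLinearMap.proj i : (Fin ν → ℂ) →L[ℂ] ℂ)‖ ≤ ν * waveLen k := by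
  have h : ∀ i ∈ Finset.univ,
      ‖(k i : ℂ) • (ContinuousLinearMap.proj i : (Fin ν → ℂ) →L[ℂ] ℂ)‖ ≤ waveLen k := by
    intro i _
    rw [norm_smul, Complex.norm_intCast]
    have h1 : ‖(ContinuousLinearMap.proj i : (Fin ν → ℂ) →L[ℂ] ℂ)‖ ≤ 1 :=
      ContinuousLinearMap.opNorm_le_bound _ zero_le_one fun x => by
        simpa using norm_le_pi_norm x i
    calc _ ≤ waveLen k * 1 :=
          mul_le_mul (abs_le_waveLen k i) h1 (norm_nonneg _) (waveLen_nonneg k)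
      _ = _ := mul_one _
  refine (norm_sum_le_of_le _ h).trans ?_
  simp

/-- Differentiating in `θ` costs a factor `|k|`, paid by shrinking the strip: `|k| ≤ (σ - σ')⁻¹
e^{(σ-σ')|k|}`. -/
theorem differentiableOn_symb {σ σ' : ℝ} (h : σ' < σ) {A : Modes ν → ℤ → ℂ}
    (hA : WeightSummable σ A) (x : ℝ) (j : ℤ) :
    DifferentiableOn ℂ (fun θ => symb A θ x j) (openStrip ν σ') := by
  intro θ₀ hθ₀
  refine (HasFDerivAt.differentiableAt (hasFDerivAt_tsum_of_isPreconnected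
    (u := fun g : Modes ν => (ν * (σ - σ')⁻¹) * (weight σ 0 g * ‖A g j‖))
    (f' := fun (g : Modes ν) θ => A g j • (spaceMode g.2 x • (angleMode g.1 θ • Complex.I •
      ∑ i, (g.1 i : ℂ) • (ContinuousLinearMap.proj i : (Fin ν → ℂ) →L[ℂ] ℂ))))
    ((hA j 0).mul_left _) (isOpen_openStrip σ') (convex_openStrip σ').isPreconnected
    (fun g θ _ => ?_) (fun g θ hθ => ?_) hθ₀
    (hA.summable (le_of_lt (lt_trans hθ₀ h)) x j) hθ₀)).differentiableWithinAt
  · have := ((hasFDerivAt_angleMode g.1 θ).const_mul (spaceMode g.2 x)).const_mul (A g j)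
    simpa only [mul_comm (angleMode _ _)] using this
  · rw [norm_smul, norm_smul, norm_smul, norm_smul, norm_spaceMode, Complex.norm_I,
      one_mul, one_mul]
    have h1 := norm_angleMode_le g.1 (le_of_lt hθ)
    have h2 := norm_sum_proj_le g.1
    have h3 : waveLen g.1 ≤ (σ - σ')⁻¹ * Real.exp ((σ - σ') * waveLen g.1) := by
      rw [← div_eq_inv_mul, le_div_iff₀ (by linarith), mul_comm]
      linarith [Real.add_one_le_exp ((σ - σ') * waveLen g.1)]
    have h4 : Real.exp (σ' * waveLen g.1) * Real.exp ((σ - σ') * waveLen g.1) = weight σ 0 g := by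
      rw [← Real.exp_add, weight, pow_zero, mul_one]; congr 1; ring
    have hw := waveLen_nonneg g.1
    calc _ ≤ ‖A g j‖ * (Real.exp (σ' * waveLen g.1) *
          (ν * ((σ - σ')⁻¹ * Real.exp ((σ - σ') * waveLen g.1)))) := by
          gcongr
          exact h2.trans (by gcongr)
      _ = _ := by rw [← h4]; ring

theorem isSymbol_symb {σ ρ s : ℝ} (h : ρ < σ) {A : Modes ν → ℤ → ℂ}
    (hA : ∀ β N, ampNorm σ s β N A < ∞) : IsSymbol s ρ (symb A) := by
  have hW : WeightSummable σ A := WeightSummable.of_ampNorm (hA 0)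
  refine ⟨fun θ _ x j => ?_, fun θ _ k x j => ?_,
    fun θ hθ j => contDiff_symb hW (le_trans hθ h.le) j, fun x j => ?_, fun α β => ?_⟩
  · simp only [symb, spaceMode_add_two_pi]
  · simp only [symb, angleMode_shift]
  -- Holomorphy is required on a neighbourhood of the closed strip `ρ`, while the series can be
  -- differentiated only strictly inside `σ`; the midpoint serves both.
  · refine ⟨openStrip ν ((ρ + σ) / 2), isOpen_openStrip _, fun θ hθ => ?_,
      differentiableOn_symb (by linarith) hW x j⟩
    exact lt_of_le_of_lt (show imNorm θ ≤ ρ from hθ) (by linarith)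
  · refine ⟨(ampNorm σ s β α A).toReal + 1, by positivity, fun θ hθ x j => ?_⟩
    have h1 := (le_iSup₂ (f := fun (x : ℝ) (j : ℤ) => ENNReal.ofReal (bracket j ^ (-s + β)) *
      ‖symbDeriv (symb A) α β θ x j‖ₑ) x j).trans (iSup_symbDeriv_le hW (le_trans hθ h.le) s α β)
    have hb : 0 < bracket j ^ (-s + β) := Real.rpow_pos_of_pos (bracket_pos j) _
    have h2 := ENNReal.toReal_mono (hA β α).ne h1
    rw [ENNReal.toReal_mul, ENNReal.toReal_ofReal hb.le, toReal_enorm] at h2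
    have h3 : bracket j ^ (s - β) * bracket j ^ (-s + β) = 1 := by
      rw [← Real.rpow_add (bracket_pos j)]; simp
    have hb' : 0 < bracket j ^ (s - β) := Real.rpow_pos_of_pos (bracket_pos j) _
    calc _ = bracket j ^ (s - β) * (bracket j ^ (-s + β) * ‖symbDeriv (symb A) α β θ x j‖) := by
          rw [← mul_assoc, h3, one_mul]
      _ ≤ bracket j ^ (s - β) * (ampNorm σ s β α A).toReal := by gcongr
      _ ≤ _ := by nlinarith

/-! ### Estimates for the weighted norms -/

theorem fwdDiff_iterate_add (f g : ℤ → ℂ) (β : ℕ) (j : ℤ) :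
    (fwdDiff 1)^[β] (fun j => f j + g j) j = (fwdDiff 1)^[β] f j + (fwdDiff 1)^[β] g j := by
  exact congrFun (fwdDiff_iter_add (1 : ℤ) f g β) j

theorem ampNorm_add_le (σ s : ℝ) (β N : ℕ) (A B : Modes ν → ℤ → ℂ) :
    ampNorm σ s β N (fun g j => A g j + B g j) ≤ ampNorm σ s β N A + ampNorm σ s β N B := by
  rw [ampNorm, ampNorm, ampNorm, ← ENNReal.tsum_add]
  refine ENNReal.tsum_le_tsum fun g => ?_
  rw [← mul_add]
  gcongr
  refine iSup_le fun j => ?_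
  rw [fwdDiff_iterate_add]
  refine (mul_le_mul_right (enorm_add_le _ _) _).trans ?_
  rw [mul_add]
  exact add_le_add
    (le_iSup (fun j : ℤ => ENNReal.ofReal (bracket j ^ (-s + β)) * ‖(fwdDiff 1)^[β] (A g) j‖ₑ) j)
    (le_iSup (fun j : ℤ => ENNReal.ofReal (bracket j ^ (-s + β)) * ‖(fwdDiff 1)^[β] (B g) j‖ₑ) j)

/-- Differences in `j` act on `K` alone, and its growth `(1 + |m|)^p` is moved into the weight. The
constants depend on neither `y` nor `σ` nor `N`, which later gives uniformity in `ω` and `M`. -/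
theorem exists_ampNorm_mul_le {s : ℝ} {K : ℤ → ℤ → ℂ} {β : ℕ} (hK : IsAmplitude β s K) :
    ∃ C : ℝ, 0 ≤ C ∧ ∃ p : ℕ, ∀ (σ : ℝ) (N : ℕ) (y : Modes ν → ℂ),
      ampNorm σ s β N (fun g j => y g * K g.2 j) ≤ ENNReal.ofReal C * modeNorm σ (N + p) y := by
  obtain ⟨C, hC, p, hp⟩ := hK.exists_bound
  refine ⟨C, hC, p, fun σ N y => ?_⟩
  rw [ampNorm, modeNorm, ← ENNReal.tsum_mul_left]
  refine ENNReal.tsum_le_tsum fun g => ?_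
  have h1 : ⨆ j : ℤ, ENNReal.ofReal (bracket j ^ (-s + β)) *
      ‖(fwdDiff 1)^[β] (fun j => y g * K g.2 j) j‖ₑ ≤
      ENNReal.ofReal (C * (1 + |(g.2 : ℝ)|) ^ p) * ‖y g‖ₑ := by
    refine iSup_le fun j => ?_
    have h2 : (fwdDiff 1)^[β] (fun j => y g * K g.2 j) j = y g * (fwdDiff 1)^[β] (K g.2) j := by
      exact congrFun (fwdDiff_iter_const_smul (1 : ℤ) (y g) (K g.2) β) j
    have hb : 0 < bracket j ^ (-s + β) := Real.rpow_pos_of_pos (bracket_pos j) _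
    rw [h2, ← ofReal_norm, ← ofReal_norm, ← ENNReal.ofReal_mul hb.le,
      ← ENNReal.ofReal_mul (by positivity), norm_mul]
    refine ENNReal.ofReal_le_ofReal ?_
    have h3 : bracket j ^ (-s + β) * bracket j ^ (s - β) = 1 := by
      rw [← Real.rpow_add (bracket_pos j)]; simp
    calc _ ≤ bracket j ^ (-s + β) * (‖y g‖ *
          (C * (1 + |(g.2 : ℝ)|) ^ p * bracket j ^ (s - β))) := by
          have := hp g.2 j
          gcongr
      _ = (bracket j ^ (-s + β) * bracket j ^ (s - β)) * (C * (1 + |(g.2 : ℝ)|) ^ p) * ‖y g‖ := by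
          ring
      _ = _ := by rw [h3, one_mul]
  refine (mul_le_mul_right h1 _).trans (le_of_eq ?_)
  rw [← mul_assoc, ← mul_assoc, ← ENNReal.ofReal_mul (weight_pos σ N g).le, ← ENNReal.ofReal_mul hC]
  congr 2
  rw [weight, weight, pow_add]
  ring

/-- Convolution of families of Fourier coefficients. -/
def conv (y z : Modes ν → ℂ) : Modes ν → ℂ := fun g => ∑' h, y h * z (g - h)

theorem weight_add_le {σ : ℝ} (hσ : 0 ≤ σ) (N : ℕ) (g h : Modes ν) :
    weight σ N (g + h) ≤ weight σ N g * weight σ N h := by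
  have h1 := waveLen_add_le g.1 h.1
  have h2 : 1 + |((g.2 + h.2 : ℤ) : ℝ)| ≤ (1 + |(g.2 : ℝ)|) * (1 + |(h.2 : ℝ)|) := by
    push_cast
    nlinarith [abs_add_le (g.2 : ℝ) h.2, abs_nonneg (g.2 : ℝ), abs_nonneg (h.2 : ℝ)]
  calc weight σ N (g + h) ≤ Real.exp (σ * (waveLen g.1 + waveLen h.1)) *
        ((1 + |(g.2 : ℝ)|) * (1 + |(h.2 : ℝ)|)) ^ N := by
        rw [weight]
        refine mul_le_mul (Real.exp_le_exp.2 (mul_le_mul_of_nonneg_left h1 hσ))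
          (pow_le_pow_left₀ (by positivity) h2 N) (by positivity) (by positivity)
    _ = _ := by rw [mul_add, Real.exp_add, mul_pow, weight, weight]; ring

/-- Young's inequality for `ℓ¹` with a submultiplicative weight. Hence `Y²` is controlled in the
same strip as `Y`. -/
theorem modeNorm_conv_le {σ : ℝ} (hσ : 0 ≤ σ) (N : ℕ) (y z : Modes ν → ℂ) :
    modeNorm σ N (conv y z) ≤ modeNorm σ N y * modeNorm σ N z := by
  have h1 : ∀ g, ENNReal.ofReal (weight σ N g) * ‖conv y z g‖ₑ ≤
      ∑' h, ENNReal.ofReal (weight σ N h) * ‖y h‖ₑ *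
        (ENNReal.ofReal (weight σ N (g - h)) * ‖z (g - h)‖ₑ) := by
    intro g
    refine (mul_le_mul_right enorm_tsum_le_tsum_enorm _).trans ?_
    rw [← ENNReal.tsum_mul_left]
    refine ENNReal.tsum_le_tsum fun h => ?_
    have h2 := weight_add_le hσ N h (g - h)
    rw [add_sub_cancel] at h2
    calc _ ≤ ENNReal.ofReal (weight σ N h * weight σ N (g - h)) * ‖y h * z (g - h)‖ₑ := by
          gcongr
      _ = _ := by
          rw [ENNReal.ofReal_mul (weight_pos σ N h).le, enorm_mul]; ring
  refine (ENNReal.tsum_le_tsum h1).trans (le_of_eq ?_)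
  rw [ENNReal.tsum_comm, modeNorm, ← ENNReal.tsum_mul_right]
  refine tsum_congr fun h => ?_
  rw [ENNReal.tsum_mul_left]
  congr 1
  exact (Equiv.subRight h).tsum_eq fun g => ENNReal.ofReal (weight σ N g) * ‖z g‖ₑ

theorem modeNorm_add_le (σ : ℝ) (N : ℕ) (y z : Modes ν → ℂ) :
    modeNorm σ N (y + z) ≤ modeNorm σ N y + modeNorm σ N z := by
  rw [modeNorm, modeNorm, modeNorm, ← ENNReal.tsum_add]
  refine ENNReal.tsum_le_tsum fun g => ?_
  rw [← mul_add]
  gcongr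
  exact enorm_add_le _ _

theorem summable_of_modeNorm {σ : ℝ} {N : ℕ} {y : Modes ν → ℂ} (hy : modeNorm σ N y < ∞) :
    Summable fun g => weight σ N g * ‖y g‖ := by
  have h := ENNReal.summable_toReal hy.ne
  refine h.congr fun g => ?_
  rw [ENNReal.toReal_mul, ENNReal.toReal_ofReal (weight_pos σ N g).le, toReal_enorm]

theorem one_le_weight {σ : ℝ} (hσ : 0 ≤ σ) (N : ℕ) (g : Modes ν) : 1 ≤ weight σ N g :=
  one_le_mul_of_one_le_of_one_le
    (Real.one_le_exp (mul_nonneg hσ (waveLen_nonneg _))) (one_le_pow₀ (one_le_one_add_abs _))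

theorem summable_norm_of_modeNorm {σ : ℝ} (hσ : 0 ≤ σ) {N : ℕ} {y : Modes ν → ℂ}
    (hy : modeNorm σ N y < ∞) : Summable fun g => ‖y g‖ :=
  Summable.of_nonneg_of_le (fun _ => norm_nonneg _)
    (fun g => le_mul_of_one_le_left (norm_nonneg _) (one_le_weight hσ N g))
    (summable_of_modeNorm hy)

/-- Factorization of a difference of squares, by commutativity of convolution; it yields the
Lipschitz dependence of the quadratic term on `ω`. -/
theorem conv_sub_conv {σ : ℝ} (hσ : 0 ≤ σ) {y z : Modes ν → ℂ}
    (hy : modeNorm σ 0 y < ∞) (hz : modeNorm σ 0 z < ∞) :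
    conv y y - conv z z = conv (y - z) (y + z) := by
  have hy' := summable_norm_of_modeNorm hσ hy
  have hz' := summable_norm_of_modeNorm hσ hz
  have key : ∀ {u v : Modes ν → ℂ}, Summable (fun g => ‖u g‖) → Summable (fun g => ‖v g‖) →
      ∀ g, Summable fun h => u h * v (g - h) := by
    intro u v hu hv g
    refine Summable.of_norm_bounded (hu.mul_right (∑' g, ‖v g‖)) fun h => ?_
    rw [norm_mul]
    exact mul_le_mul_of_nonneg_left (hv.le_tsum _ fun _ _ => norm_nonneg _) (norm_nonneg _)
  have hcomm : ∀ g, conv y z g = conv z y g := fun g => by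
    rw [conv, conv, ← (Equiv.subLeft g).tsum_eq]
    exact tsum_congr fun h => by simp [mul_comm]
  funext g
  have h1 : conv (y - z) (y + z) g = conv y y g + conv y z g - (conv z y g + conv z z g) := by
    simp only [conv, Pi.sub_apply, Pi.add_apply]
    rw [← (key hy' hy' g).tsum_add (key hy' hz' g), ← (key hz' hy' g).tsum_add (key hz' hz' g),
      ← ((key hy' hy' g).add (key hy' hz' g)).tsum_sub ((key hz' hy' g).add (key hz' hz' g))]
    exact tsum_congr fun h => by ring
  rw [h1, Pi.sub_apply, hcomm]
  ring

/-! ### Action on Fourier coefficients -/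

/-- The action of `symb A` at the real angle `θ` on Fourier coefficients. -/
def twist (A : Modes ν → ℤ → ℂ) (θ : Fin ν → ℝ) : Oper :=
  fun u n => ∑' g : Modes ν, A g (n - g.2) * angleMode g.1 (toComplex θ) * u (n - g.2)

/-- `A` is dominated by a summable family, uniformly in `j`. -/
def SummablyBounded (A : Modes ν → ℤ → ℂ) : Prop :=
  ∃ a : Modes ν → ℝ, Summable a ∧ ∀ g j, ‖A g j‖ ≤ a g

theorem norm_angleMode_real (k : Fin ν → ℤ) (θ : Fin ν → ℝ) :
    ‖angleMode k (toComplex θ)‖ = 1 := by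
  rw [norm_angleMode]
  simp [phase, toComplex]

theorem conj_angleMode_real (k : Fin ν → ℤ) (θ : Fin ν → ℝ) :
    starRingEnd ℂ (angleMode k (toComplex θ)) = angleMode (-k) (toComplex θ) := by
  rw [angleMode, angleMode, ← Complex.exp_conj]
  simp [phase, toComplex, map_sum]

theorem SummablyBounded.of_ampNorm {σ s : ℝ} (hσ : 0 ≤ σ) (hs : s ≤ 0) {A : Modes ν → ℤ → ℂ}
    (hA : ampNorm σ s 0 0 A < ∞) : SummablyBounded A := by
  refine ⟨_, ENNReal.summable_toReal hA.ne, fun g j => ?_⟩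
  have h1 := ENNReal.ne_top_of_tsum_ne_top hA.ne g
  have h2 : ‖A g j‖ₑ ≤ ENNReal.ofReal (weight σ 0 g) * ⨆ j : ℤ,
      ENNReal.ofReal (bracket j ^ (-s + (0 : ℕ))) * ‖(fwdDiff 1)^[0] (A g) j‖ₑ := by
    refine le_trans ?_ (mul_le_mul' (ENNReal.one_le_ofReal.2 (one_le_weight hσ 0 g))
      (le_iSup (fun j : ℤ => ENNReal.ofReal (bracket j ^ (-s + (0 : ℕ))) *
        ‖(fwdDiff 1)^[0] (A g) j‖ₑ) j))
    rw [one_mul]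
    refine le_mul_of_one_le_left zero_le (ENNReal.one_le_ofReal.2 ?_)
    exact Real.one_le_rpow (one_le_bracket j) (by simpa using hs)
  have h3 := ENNReal.toReal_mono h1 h2
  rwa [toReal_enorm] at h3

theorem integral_spaceMode (l : ℤ) :
    ∫ x in (-Real.pi)..Real.pi, spaceMode l x = if l = 0 then 2 * (Real.pi : ℂ) else 0 := by
  split_ifs with h
  · subst h
    simp only [spaceMode, Int.cast_zero, mul_zero, zero_mul, Complex.exp_zero,
      intervalIntegral.integral_const]
    simp
    ring
  · have hl : Complex.I * (l : ℂ) ≠ 0 := mul_ne_zero Complex.I_ne_zero (by exact_mod_cast h)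
    simp only [spaceMode]
    rw [integral_exp_mul_complex hl]
    have : Complex.exp (Complex.I * l * (Real.pi : ℝ)) =
        Complex.exp (Complex.I * l * ((-Real.pi : ℝ) : ℂ)) := by
      rw [Complex.exp_eq_exp_iff_exists_int]
      exact ⟨l, by push_cast; ring⟩
    rw [this, sub_self, zero_div]

theorem spaceMode_add (l m : ℤ) (x : ℝ) :
    spaceMode (l + m) x = spaceMode l x * spaceMode m x := by
  rw [spaceMode, spaceMode, spaceMode, ← Complex.exp_add]
  congr 1
  push_cast
  ring

theorem continuous_spaceMode (m : ℤ) : Continuous (spaceMode m) := by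
  unfold spaceMode
  fun_prop

/-- Orthogonality of the exponentials leaves, for each mode `(k, m)`, the single input frequency `j
= n - m`. Bounded input and a dominating summable family justify exchanging the sum with the
integral and the two sums with each other. -/
theorem opAt_symb {A : Modes ν → ℤ → ℂ} (hA : SummablyBounded A) (θ : Fin ν → ℝ) {u : Coeffs}
    {c : ℝ} (hu : ∀ j, ‖u j‖ ≤ c) : opAt (symb A) θ u = twist A θ u := by
  obtain ⟨a, ha, hAa⟩ := hA
  have hc : 0 ≤ c := (norm_nonneg _).trans (hu 0)
  funext n
  have hentry : ∀ j : ℤ, (((2 * Real.pi : ℝ) : ℂ)⁻¹ *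
      ∫ x in (-Real.pi)..Real.pi, symb A (toComplex θ) x j * Complex.exp (Complex.I * j * x) *
        Complex.exp (-(Complex.I * n * x))) =
      ∑' g : Modes ν, if g.2 + j - n = 0 then A g j * angleMode g.1 (toComplex θ) else 0 := by
    intro j
    have hint : ∀ x, HasSum (fun g : Modes ν =>
        A g j * angleMode g.1 (toComplex θ) * spaceMode (g.2 + j - n) x)
        (symb A (toComplex θ) x j * Complex.exp (Complex.I * j * x) *
          Complex.exp (-(Complex.I * n * x))) := by
      intro x
      have hs : Summable fun g : Modes ν =>
          A g j * (angleMode g.1 (toComplex θ) * spaceMode g.2 x) := by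
        refine Summable.of_norm_bounded ha fun g => ?_
        rw [norm_mul, norm_mul, norm_angleMode_real, norm_spaceMode, one_mul, mul_one]
        exact hAa g j
      have h := (hs.hasSum.mul_right (Complex.exp (Complex.I * j * x))).mul_right
        (Complex.exp (-(Complex.I * n * x)))
      convert! h using 1
      funext g
      have : spaceMode (g.2 + j - n) x = spaceMode g.2 x * Complex.exp (Complex.I * j * x) *
          Complex.exp (-(Complex.I * n * x)) := by
        rw [sub_eq_add_neg, spaceMode_add, spaceMode_add]
        congr 1
        simp [spaceMode]
      rw [this]; ring
    have h := intervalIntegral.hasSum_integral_of_dominated_convergence (a := -Real.pi)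
      (b := Real.pi) (μ := MeasureTheory.volume) (fun g _ => a g)
      (fun g => ((continuous_spaceMode (g.2 + j - n)).const_mul
        (A g j * angleMode g.1 (toComplex θ))).aestronglyMeasurable)
      (fun g => Filter.Eventually.of_forall fun x _ => by
        simp only [norm_mul, norm_angleMode_real, norm_spaceMode, mul_one]
        exact hAa g j)
      (Filter.Eventually.of_forall fun x _ => ha)
      (by simp) (Filter.Eventually.of_forall fun x _ => hint x)
    have h2 := (h.mul_left ((2 * Real.pi : ℝ) : ℂ)⁻¹).tsum_eq
    rw [← h2]
    refine tsum_congr fun g => ?_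
    rw [intervalIntegral.integral_const_mul, integral_spaceMode]
    have hpi : (Real.pi : ℂ) ≠ 0 := by exact_mod_cast Real.pi_ne_zero
    split_ifs
    · push_cast; field_simp
    · simp
  rw [opAt, quantize, twist]
  simp only [hentry, ← tsum_mul_right]
  -- The double family is supported on the graph `j = n - m` over the modes, so its summability
  -- reduces to that of `a`.
  have hsum : Summable fun p : ℤ × Modes ν =>
      (if p.2.2 + p.1 - n = 0 then A p.2 p.1 * angleMode p.2.1 (toComplex θ) else 0) * u p.1 := by
    have hinj : Function.Injective fun g : Modes ν => (n - g.2, g) := fun g h hgh =>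
      (Prod.ext_iff.1 hgh).2
    rw [← hinj.summable_iff]
    · refine Summable.of_norm_bounded (ha.mul_right c) fun g => ?_
      simp only [Function.comp]
      rw [if_pos (by ring), norm_mul, norm_mul, norm_angleMode_real, mul_one]
      exact mul_le_mul (hAa _ _) (hu _) (norm_nonneg _) ((norm_nonneg _).trans (hAa g 0))
    · rintro ⟨j, g⟩ hjg
      dsimp only
      rw [if_neg, zero_mul]
      intro h
      exact hjg ⟨g, by simp only [Prod.mk.injEq, and_true]; omega⟩
  rw [Summable.tsum_comm (f := fun (g : Modes ν) (j : ℤ) =>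
    (if g.2 + j - n = 0 then A g j * angleMode g.1 (toComplex θ) else 0) * u j)
    ((Equiv.prodComm (Modes ν) ℤ).summable_iff.2 hsum)]
  refine tsum_congr fun g => ?_
  rw [tsum_eq_single (n - g.2), if_pos (by ring)]
  intro j hj
  rw [if_neg (by omega), zero_mul]

theorem memℓp_two_iff {u : ℤ → ℂ} :
    Memℓp (E := fun _ : ℤ => ℂ) u 2 ↔ Summable fun j => ‖u j‖ ^ 2 := by
  rw [memℓp_gen_iff (by norm_num)]
  norm_num

/-- A family dominated by translates of a square summable sequence is square summable. -/
theorem memℓp_weightedShift {u w : ℤ → ℂ} (hu : Memℓp (E := fun _ : ℤ => ℂ) u 2) {c : ℝ} (m : ℤ)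
    (hw : ∀ n, ‖w n‖ ≤ c * ‖u (n - m)‖) : Memℓp (E := fun _ : ℤ => ℂ) w 2 := by
  rw [memℓp_two_iff] at hu ⊢
  have h1 := ((Equiv.subRight m).summable_iff.2 hu).mul_left (c ^ 2)
  refine Summable.of_nonneg_of_le (fun _ => by positivity) (fun n => ?_) h1
  simp only [Function.comp, Equiv.subRight_apply]
  rw [← mul_pow]
  exact pow_le_pow_left₀ (norm_nonneg _) (hw n) 2

theorem norm_lp_two_sq (u : lp (fun _ : ℤ => ℂ) 2) : ‖u‖ ^ 2 = ∑' j, ‖u j‖ ^ 2 := by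
  have := lp.norm_rpow_eq_tsum (p := 2) (by norm_num) u
  norm_num at this
  exact this

theorem norm_weightedShift_le (u w : lp (fun _ : ℤ => ℂ) 2) {c : ℝ} (hc : 0 ≤ c) (m : ℤ)
    (hw : ∀ n, ‖w n‖ ≤ c * ‖u (n - m)‖) : ‖w‖ ≤ c * ‖u‖ := by
  refine le_of_sq_le_sq ?_ (by positivity)
  have hu := memℓp_two_iff.1 (lp.memℓp u)
  have h1 := ((Equiv.subRight m).summable_iff.2 hu).mul_left (c ^ 2)
  rw [mul_pow, norm_lp_two_sq, norm_lp_two_sq,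
    ← (Equiv.subRight m).tsum_eq fun j => ‖u j‖ ^ 2, ← tsum_mul_left]
  refine Summable.tsum_le_tsum (fun n => ?_) (memℓp_two_iff.1 (lp.memℓp w)) h1
  simp only [Equiv.subRight_apply]
  rw [← mul_pow]
  exact pow_le_pow_left₀ (norm_nonneg _) (hw n) 2

/-- The operator is a superposition of weighted shifts, the one of index `g` having norm at most `a
g`; the series converges absolutely in `ℓ²`. -/
theorem summable_sq_twist {A : Modes ν → ℤ → ℂ} (hA : SummablyBounded A) (θ : Fin ν → ℝ)
    {u : Coeffs} (hu : Summable fun j => ‖u j‖ ^ 2) :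
    Summable fun j => ‖twist A θ u j‖ ^ 2 := by
  obtain ⟨a, ha, hAa⟩ := hA
  have hu' := memℓp_two_iff.2 hu
  have hb : ∀ (g : Modes ν) (n : ℤ),
      ‖A g (n - g.2) * angleMode g.1 (toComplex θ) * u (n - g.2)‖ ≤ a g * ‖u (n - g.2)‖ := by
    intro g n
    rw [norm_mul, norm_mul, norm_angleMode_real, mul_one]
    exact mul_le_mul_of_nonneg_right (hAa _ _) (norm_nonneg _)
  let w : Modes ν → lp (fun _ : ℤ => ℂ) 2 := fun g => ⟨fun n =>
    A g (n - g.2) * angleMode g.1 (toComplex θ) * u (n - g.2), memℓp_weightedShift hu' g.2 (hb g)⟩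
  let U : lp (fun _ : ℤ => ℂ) 2 := ⟨u, hu'⟩
  have hw : Summable w := Summable.of_norm_bounded (ha.mul_right ‖U‖) fun g =>
    norm_weightedShift_le U (w g) ((norm_nonneg _).trans (hAa g 0)) g.2 (hb g)
  have h2 : twist A θ u = fun n => (∑' g, w g : lp (fun _ : ℤ => ℂ) 2) n := by
    funext n
    exact ((lp.evalCLM (𝕜 := ℂ) (fun _ : ℤ => ℂ) 2 n).map_tsum hw).symm
  rw [h2]
  exact memℓp_two_iff.1 (lp.memℓp _)

theorem exists_bound_of_summable_sq {u : Coeffs} (hu : Summable fun j => ‖u j‖ ^ 2) :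
    ∃ c : ℝ, ∀ j, ‖u j‖ ≤ c :=
  ⟨‖(⟨u, memℓp_two_iff.2 hu⟩ : lp (fun _ : ℤ => ℂ) 2)‖, fun j =>
    lp.norm_apply_le_norm (by norm_num) (⟨u, memℓp_two_iff.2 hu⟩ : lp (fun _ : ℤ => ℂ) 2) j⟩

/-- Reflection of the space index. -/
def reflectMode : Modes ν ≃ Modes ν := (Equiv.refl _).prodCongr (Equiv.neg ℤ)

theorem parityPreserving_symb {A : Modes ν → ℤ → ℂ} (hA : SummablyBounded A)
    (heven : ∀ k m j, A (k, -m) (-j) = A (k, m) j) (θ : Fin ν → ℝ) :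
    ParityPreserving (opAt (symb A) θ) := by
  -- Both parities are treated together, with `s = 1` for even and `s = -1` for odd functions.
  have key : ∀ (s : ℂ) (u : Coeffs), (∀ j, u (-j) = s * u j) →
      ∀ n, twist A θ u (-n) = s * twist A θ u n := by
    intro s u hu n
    rw [twist, twist, ← reflectMode.tsum_eq, ← tsum_mul_left]
    refine tsum_congr fun ⟨k, m⟩ => ?_
    have h1 : -n - -m = -(n - m) := by ring
    simp only [reflectMode, Equiv.prodCongr_apply, Prod.map, Equiv.refl_apply, Equiv.neg_apply]
    rw [h1, hu, heven]
    ring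
  constructor
  · rintro u ⟨hu, hu'⟩
    obtain ⟨c, hc⟩ := exists_bound_of_summable_sq hu
    rw [opAt_symb hA θ hc]
    refine ⟨summable_sq_twist hA θ hu, fun j => ?_⟩
    simpa using key 1 u (by simpa using hu') j
  · rintro u ⟨hu, hu'⟩
    obtain ⟨c, hc⟩ := exists_bound_of_summable_sq hu
    rw [opAt_symb hA θ hc]
    refine ⟨summable_sq_twist hA θ hu, fun j => ?_⟩
    simpa using key (-1) u (by simpa using hu') j

/-! ### Conjugate and adjoint operators. -/

/-- The amplitude of the conjugate operator. -/
def conjAmp (A : Modes ν → ℤ → ℂ) : Modes ν → ℤ → ℂ := fun g j => starRingEnd ℂ (A (-g) (-j))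

theorem conjOp_symb {A : Modes ν → ℤ → ℂ} (hA : SummablyBounded A) (θ : Fin ν → ℝ) {u : Coeffs}
    {c : ℝ} (hu : ∀ j, ‖u j‖ ≤ c) : conjOp (opAt (symb A) θ) u = twist (conjAmp A) θ u := by
  funext n
  rw [conjOp, opAt_symb hA θ (u := conjFun u) (c := c) fun j => by simpa [conjFun] using hu (-j)]
  rw [conjFun, twist, twist, Complex.conj_tsum, ← (Equiv.neg (Modes ν)).tsum_eq]
  refine tsum_congr fun g => ?_
  simp only [Equiv.neg_apply, map_mul, conj_angleMode_real, conjFun, conjAmp, Complex.conj_conj,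
    Prod.fst_neg, Prod.snd_neg, neg_neg]
  have h1 : -n - -g.2 = -(n - g.2) := by ring
  rw [h1, neg_neg]

/-- The hypothesis says that the entry of `A'` from frequency `j + m` to `j` is conjugate to that of
`A` from `j` to `j + m`. Both sides are then the same double series `F` in two orders of summation;
it converges absolutely because `|u||v| ≤ |u|² + |v|²`. -/
theorem tsum_twist_mul_conj {A A' : Modes ν → ℤ → ℂ} (hA : SummablyBounded A)
    (h : ∀ g j, starRingEnd ℂ (A' (-g) (j + g.2)) = A g j) (θ : Fin ν → ℝ) {u v : Coeffs}
    (hu : Summable fun j => ‖u j‖ ^ 2) (hv : Summable fun j => ‖v j‖ ^ 2) :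
    ∑' j : ℤ, twist A θ u j * starRingEnd ℂ (v j) =
      ∑' j : ℤ, u j * starRingEnd ℂ (twist A' θ v j) := by
  obtain ⟨a, ha, hAa⟩ := hA
  have ha0 : ∀ g, 0 ≤ a g := fun g => (norm_nonneg _).trans (hAa g 0)
  let F : Modes ν × ℤ → ℂ := fun p =>
    A p.1 p.2 * angleMode p.1.1 (toComplex θ) * u p.2 * starRingEnd ℂ (v (p.2 + p.1.2))
  let T : Modes ν × ℤ ≃ Modes ν × ℤ :=
    { toFun := fun p => (p.1, p.2 - p.1.2)
      invFun := fun p => (p.1, p.2 + p.1.2)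
      left_inv := fun p => by simp
      right_inv := fun p => by simp }
  have hF : Summable F := by
    have h1 := Summable.mul_of_nonneg ha hu ha0 (fun _ => by positivity)
    have h2 := T.symm.summable_iff.2 (Summable.mul_of_nonneg ha hv ha0 (fun _ => by positivity))
    refine Summable.of_norm_bounded (h1.add h2) fun p => ?_
    simp only [F, T, Function.comp, Equiv.symm, Equiv.coe_fn_mk]
    rw [norm_mul, norm_mul, norm_mul, norm_angleMode_real, mul_one, RCLike.norm_conj, mul_assoc,
      ← mul_add]
    refine mul_le_mul (hAa _ _) ?_ (by positivity) (ha0 _)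
    nlinarith [sq_nonneg (‖u p.2‖ - ‖v (p.2 + p.1.2)‖), sq_nonneg ‖u p.2‖,
      sq_nonneg ‖v (p.2 + p.1.2)‖]
  have hL : Summable fun p : ℤ × Modes ν => F (T (p.2, p.1)) :=
    (((Equiv.prodComm ℤ (Modes ν)).trans T).summable_iff (f := F)).2 hF
  have hR : Summable fun p : ℤ × Modes ν => F (p.2, p.1) :=
    ((Equiv.prodComm ℤ (Modes ν)).summable_iff (f := F)).2 hF
  have e1 : ∑' j : ℤ, twist A θ u j * starRingEnd ℂ (v j) = ∑' p, F p := by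
    rw [← (((Equiv.prodComm ℤ (Modes ν)).trans T).tsum_eq F)]
    refine Eq.trans ?_ hL.tsum_prod.symm
    refine tsum_congr fun j => ?_
    rw [twist, ← tsum_mul_right]
    exact tsum_congr fun g => by simp [F, T]
  have e2 : ∑' j : ℤ, u j * starRingEnd ℂ (twist A' θ v j) = ∑' p, F p := by
    rw [← ((Equiv.prodComm ℤ (Modes ν)).tsum_eq F)]
    refine Eq.trans ?_ hR.tsum_prod.symm
    refine tsum_congr fun j => ?_
    rw [twist, Complex.conj_tsum, ← tsum_mul_left, ← (Equiv.neg (Modes ν)).tsum_eq]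
    refine tsum_congr fun g => ?_
    simp only [F, Equiv.neg_apply, map_mul, conj_angleMode_real, Prod.fst_neg, Prod.snd_neg,
      neg_neg, sub_neg_eq_add, h]
    ring
  rw [e1, e2]

theorem OddSobolev.norm_coeffs_le {r : ℝ} (u : OddSobolev r) (j : ℤ) :
    ‖u.coeffs j‖ ≤ bracket j ^ (-r) * ‖u‖ := by
  have h : ‖((bracket j ^ r : ℝ) : ℂ) * u.coeffs j‖ ≤ ‖u‖ :=
    lp.norm_apply_le_norm (by norm_num) (toEll2 r u) j
  have hb := Real.rpow_pos_of_pos (bracket_pos j) r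
  rw [norm_mul, Complex.norm_real, Real.norm_eq_abs, abs_of_pos hb] at h
  rw [Real.rpow_neg (bracket_pos j).le, ← div_eq_inv_mul, le_div_iff₀ hb, mul_comm]
  exact h

theorem OddSobolev.norm_coeffs_le' {r : ℝ} (hr : 0 ≤ r) (u : OddSobolev r) (j : ℤ) :
    ‖u.coeffs j‖ ≤ ‖u‖ :=
  (u.norm_coeffs_le j).trans (mul_le_of_le_one_left (norm_nonneg _)
    (Real.rpow_le_one_of_one_le_of_nonpos (one_le_bracket j) (by linarith)))

theorem OddSobolev.summable_sq (u : OddSobolev 0) : Summable fun j => ‖u.coeffs j‖ ^ 2 := by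
  have h := memℓp_two_iff.1 u.2.2
  refine h.congr fun j => ?_
  simp [bracketD, OddSobolev.coeffs]

theorem OddSobolev.coeffs_neg {r : ℝ} (u : OddSobolev r) (j : ℤ) :
    u.coeffs (-j) = -u.coeffs j := u.2.1 j

theorem OddSobolev.coeffs_zero {r : ℝ} (u : OddSobolev r) : u.coeffs 0 = 0 := by
  have := u.coeffs_neg 0
  simpa [self_eq_neg] using this

theorem isAdjointOnOdd_symb {A A' : Modes ν → ℤ → ℂ} (hA : SummablyBounded A)
    (hA' : SummablyBounded A') (h : ∀ g j, starRingEnd ℂ (A' (-g) (j + g.2)) = A g j)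
    (θ : Fin ν → ℝ) : IsAdjointOnOdd (opAt (symb A) θ) (opAt (symb A') θ) := by
  intro u v
  rw [opAt_symb hA θ (u.norm_coeffs_le' le_rfl), opAt_symb hA' θ (v.norm_coeffs_le' le_rfl)]
  exact tsum_twist_mul_conj hA h θ u.summable_sq v.summable_sq

/-- The reflection `j ↦ -(j + m)` exchanges, up to sign, the input frequency `j` and the output
frequency `j + m`. Invariance of the amplitude under it makes the conjugate operator the adjoint. -/
theorem isAdjointOnOdd_conjOp_symb {A : Modes ν → ℤ → ℂ} (hA : SummablyBounded A)
    (h : ∀ (g : Modes ν) j, A g (-(j + g.2)) = A g j)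
    (θ : Fin ν → ℝ) : IsAdjointOnOdd (opAt (symb A) θ) (conjOp (opAt (symb A) θ)) := by
  intro u v
  rw [opAt_symb hA θ (u.norm_coeffs_le' le_rfl), conjOp_symb hA θ (v.norm_coeffs_le' le_rfl)]
  refine tsum_twist_mul_conj hA (fun g j => ?_) θ u.summable_sq v.summable_sq
  simp only [conjAmp, neg_neg, Complex.conj_conj]
  exact h g j

/-! ### Multiplication operators and their composition -/

/-- Multiplication by `∑ y (k, m) e^{ik·θ + imx}`, on Fourier coefficients. -/
def mulModes (y : Modes ν → ℂ) (θ : Fin ν → ℝ) : Oper :=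
  fun u n => ∑' g : Modes ν, y g * angleMode g.1 (toComplex θ) * u (n - g.2)

/-- Absolute convergence of the multiplication operators on sequences of linear growth. -/
theorem summable_mulModes {y : Modes ν → ℂ}
    (hy : Summable fun g : Modes ν => weight 0 1 g * ‖y g‖) (θ : Fin ν → ℝ) {u : Coeffs} {c : ℝ}
    (hu : ∀ j : ℤ, ‖u j‖ ≤ c * bracket j) (n : ℤ) :
    Summable fun g : Modes ν => y g * angleMode g.1 (toComplex θ) * u (n - g.2) := by
  refine Summable.of_norm_bounded (hy.mul_left (c * bracket n)) fun g => ?_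
  rw [norm_mul, norm_mul, norm_angleMode_real, mul_one]
  have hc : 0 ≤ c := by
    have := (norm_nonneg _).trans (hu 0)
    simpa [bracket_zero] using this
  have h1 := bracket_add_le n (-g.2)
  have h2 := hu (n - g.2)
  rw [Int.cast_sub, sub_eq_add_neg (n : ℝ)] at h2
  rw [abs_neg] at h1
  have h3 : weight 0 1 g = 1 + |(g.2 : ℝ)| := by simp [weight]
  rw [h3]
  calc _ ≤ ‖y g‖ * (c * ((1 + |(g.2 : ℝ)|) * bracket n)) := by
        gcongr
        exact h2.trans (by gcongr)
    _ = _ := by ring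

/-- Products of functions correspond to convolutions of coefficients. Boundedness of `u` makes the
double series absolutely convergent, so it may be reindexed by `(g, h) ↦ (h, g - h)`. -/
theorem mulModes_conv {y z : Modes ν → ℂ} (hy : Summable fun g => ‖y g‖)
    (hz : Summable fun g => ‖z g‖) (θ : Fin ν → ℝ) {u : Coeffs} {c : ℝ} (hu : ∀ j, ‖u j‖ ≤ c) :
    mulModes (conv y z) θ u = mulModes y θ (mulModes z θ u) := by
  funext n
  have hc : 0 ≤ c := (norm_nonneg _).trans (hu 0)
  let F : Modes ν × Modes ν → ℂ := fun p => y p.1 * angleMode p.1.1 (toComplex θ) *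
    (z p.2 * angleMode p.2.1 (toComplex θ) * u (n - p.1.2 - p.2.2))
  have hF : Summable F := by
    refine Summable.of_norm_bounded ((Summable.mul_of_nonneg hy hz (fun _ => norm_nonneg _)
      (fun _ => norm_nonneg _)).mul_right c) fun p => ?_
    simp only [F, norm_mul, norm_angleMode_real, mul_one]
    rw [← mul_assoc]
    exact mul_le_mul_of_nonneg_left (hu _) (by positivity)
  let T : Modes ν × Modes ν ≃ Modes ν × Modes ν :=
    { toFun := fun p => (p.2, p.1 - p.2)
      invFun := fun p => (p.2 + p.1, p.1)
      left_inv := fun p => by simp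
      right_inv := fun p => by simp }
  have e1 : mulModes y θ (mulModes z θ u) n = ∑' p, F p := by
    rw [hF.tsum_prod, mulModes]
    refine tsum_congr fun g => ?_
    rw [mulModes, ← tsum_mul_left]
  have e2 : mulModes (conv y z) θ u n = ∑' p, F p := by
    rw [← T.tsum_eq]
    refine Eq.trans ?_ ((T.summable_iff (f := F)).2 hF).tsum_prod.symm
    rw [mulModes]
    refine tsum_congr fun g => ?_
    rw [conv, ← tsum_mul_right, ← tsum_mul_right]
    refine tsum_congr fun h => ?_
    simp only [Function.comp, F, T, Equiv.coe_fn_mk, Prod.fst_sub, Prod.snd_sub]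
    have h1 : angleMode g.1 (toComplex θ) =
        angleMode h.1 (toComplex θ) * angleMode (g.1 - h.1) (toComplex θ) := by
      rw [← angleMode_add, add_sub_cancel]
    have h2 : n - h.2 - (g.2 - h.2) = n - g.2 := by ring
    rw [h1, h2]
    ring
  rw [e1, e2]

theorem mulModes_neg {y : Modes ν → ℂ} (hy : ∀ k m, y (k, -m) = y (k, m)) (θ : Fin ν → ℝ)
    {u : Coeffs} (hu : ∀ j, u (-j) = -u j) (n : ℤ) :
    mulModes y θ u (-n) = -mulModes y θ u n := by
  rw [mulModes, mulModes, ← reflectMode.tsum_eq, ← tsum_neg]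
  refine tsum_congr fun ⟨k, m⟩ => ?_
  have h1 : -n - -m = -(n - m) := by ring
  simp only [reflectMode, Equiv.prodCongr_apply, Prod.map, Equiv.refl_apply, Equiv.neg_apply]
  rw [h1, hu, hy]
  ring

/-! ### Bounded operators on the Sobolev scale -/

theorem OddSobolev.ext_coeffs {r : ℝ} {u v : OddSobolev r} (h : ∀ n, u.coeffs n = v.coeffs n) :
    u = v := Subtype.ext (funext h)

theorem OddSobolev.coeffs_add {r : ℝ} (u v : OddSobolev r) (n : ℤ) :
    (u + v).coeffs n = u.coeffs n + v.coeffs n := rfl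

theorem OddSobolev.coeffs_sub {r : ℝ} (u v : OddSobolev r) (n : ℤ) :
    (u - v).coeffs n = u.coeffs n - v.coeffs n := rfl

theorem OddSobolev.coeffs_smul {r : ℝ} (c : ℂ) (u : OddSobolev r) (n : ℤ) :
    (c • u).coeffs n = c * u.coeffs n := rfl

/-- A Fourier coefficient as a continuous functional. -/
def coeffCLM (r : ℝ) (n : ℤ) : OddSobolev r →L[ℂ] ℂ :=
  LinearMap.mkContinuous
    { toFun := fun u => u.coeffs n
      map_add' := fun u v => u.coeffs_add v n
      map_smul' := fun c u => u.coeffs_smul c n } (bracket n ^ (-r)) fun u => u.norm_coeffs_le n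

theorem exists_invSqrtEig_le (mass : ℝ) : ∃ C : ℝ, 0 ≤ C ∧ ∀ j, |invSqrtEig mass j| ≤ C := by
  obtain ⟨C, hC, p, hp⟩ := (isAmplitude_invSqrtEig mass 0).hasOrder
  refine ⟨C, hC, fun j => ?_⟩
  have h := hp 0 j
  simp only [Int.cast_zero, abs_zero, add_zero, one_pow, mul_one, Complex.norm_real,
    Real.norm_eq_abs] at h
  exact h.trans (mul_le_of_le_one_right hC
    (Real.rpow_le_one_of_one_le_of_nonpos (one_le_bracket j) (by norm_num)))

theorem exists_regEig_le (mass : ℝ) : ∃ C : ℝ, 0 ≤ C ∧ ∀ j, |regEig mass j| ≤ C * bracket j := by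
  obtain ⟨C, hC, p, hp⟩ := (isAmplitude_regEig mass 0).hasOrder
  refine ⟨C, hC, fun j => ?_⟩
  have h := hp 0 j
  simpa only [Int.cast_zero, abs_zero, add_zero, one_pow, mul_one, Complex.norm_real,
    Real.norm_eq_abs, Real.rpow_one] using h

/-- The regularized eigenvalue at `j = 0` is invisible on odd functions. A linear map is enough,
since `B` enters only through coefficient identities. -/
theorem exists_bOp (mass r : ℝ) : ∃ B : OddSobolev r →ₗ[ℂ] OddSobolev (r - 1),
    ∀ u n, (B u).coeffs n = (regEig mass n : ℂ) * u.coeffs n := by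
  obtain ⟨C, hC, hb⟩ := exists_regEig_le mass
  have hmem : ∀ u : OddSobolev r,
      (fun n => (regEig mass n : ℂ) * u.coeffs n) ∈ oddSubmodule (r - 1) := by
    intro u
    refine ⟨fun j => by simp only [regEig_neg, u.coeffs_neg, mul_neg], ?_⟩
    refine memℓp_weightedShift u.2.2 (c := C) 0 fun n => ?_
    have h1 := Real.rpow_pos_of_pos (bracket_pos n) (r - 1)
    have h2 : bracket n ^ (r - 1) * bracket n = bracket n ^ r := by
      rw [← Real.rpow_add_one (bracket_pos n).ne']; simp
    change ‖((bracket n ^ (r - 1) : ℝ) : ℂ) * ((regEig mass n : ℂ) * u.coeffs n)‖ ≤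
      C * ‖((bracket ((n - 0 : ℤ) : ℝ) ^ r : ℝ) : ℂ) * u.coeffs (n - 0)‖
    rw [sub_zero, norm_mul, norm_mul, norm_mul, Complex.norm_real, Complex.norm_real,
      Complex.norm_real, Real.norm_eq_abs, Real.norm_eq_abs, Real.norm_eq_abs, abs_of_pos h1,
      abs_of_pos (Real.rpow_pos_of_pos (bracket_pos n) r), ← h2]
    calc _ ≤ bracket n ^ (r - 1) * (C * bracket n * ‖u.coeffs n‖) := by
          have := hb n
          gcongr
      _ = _ := by ring
  exact ⟨{ toFun := fun u => ⟨_, hmem u⟩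
           map_add' := fun u v => OddSobolev.ext_coeffs fun n => mul_add _ _ _
           map_smul' := fun c u => OddSobolev.ext_coeffs fun n => mul_left_comm _ _ _ },
    fun u n => rfl⟩

/-- `B` as a map from `𝓗^r` to `𝓗^{r-1}`. -/
def bOp (mass r : ℝ) : OddSobolev r →ₗ[ℂ] OddSobolev (r - 1) := (exists_bOp mass r).choose

theorem bOp_coeffs (mass r : ℝ) (u : OddSobolev r) (n : ℤ) :
    (bOp mass r u).coeffs n = (regEig mass n : ℂ) * u.coeffs n :=
  (exists_bOp mass r).choose_spec u n

/-- Multiplication by `e^{imx}` does not preserve odd functions, but `cos(mx)` does; the building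
blocks therefore pair `m` with `-m`. The factor `1/4` is the `½` of `X` times the `½` of the cosine,
and the polynomial growth of the norm in `m` comes from Peetre's inequality. -/
theorem exists_cosOp (mass r : ℝ) : ∃ T : ℤ → (OddSobolev r →L[ℂ] OddSobolev r),
    (∀ m u n, (T m u).coeffs n = (1 / 4) * (invSqrtEig mass n : ℂ) *
      ((invSqrtEig mass (n - m) : ℂ) * u.coeffs (n - m) +
        (invSqrtEig mass (n + m) : ℂ) * u.coeffs (n + m))) ∧
    ∃ C : ℝ, 0 ≤ C ∧ ∃ p : ℕ, ∀ m : ℤ, ‖T m‖ ≤ C * (1 + |(m : ℝ)|) ^ p := by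
  obtain ⟨C, hC, hb⟩ := exists_invSqrtEig_le mass
  obtain ⟨p, hp⟩ := exists_nat_ge |r|
  let w : ℤ → OddSobolev r → ℤ → ℂ := fun m u n =>
    (1 / 4) * (invSqrtEig mass n : ℂ) * ((invSqrtEig mass (n - m) : ℂ) * u.coeffs (n - m))
  have hw : ∀ (m : ℤ) (u : OddSobolev r) (n : ℤ), ‖bracketD r (w m u) n‖ ≤
      (C * C * (1 + |(m : ℝ)|) ^ p) * ‖toEll2 r u (n - m)‖ := by
    intro m u n
    have h1 : ∀ n : ℤ, 0 < bracket n ^ r := fun n => Real.rpow_pos_of_pos (bracket_pos n) r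
    have h2 := bracket_rpow_add_le r ((n - m : ℤ) : ℝ) m hp
    have h3 : ((n - m : ℤ) : ℝ) + m = n := by push_cast; ring
    rw [h3] at h2
    change ‖((bracket n ^ r : ℝ) : ℂ) * ((1 / 4) * (invSqrtEig mass n : ℂ) *
      ((invSqrtEig mass (n - m) : ℂ) * u.coeffs (n - m)))‖ ≤
      (C * C * (1 + |(m : ℝ)|) ^ p) *
        ‖((bracket ((n - m : ℤ) : ℝ) ^ r : ℝ) : ℂ) * u.coeffs (n - m)‖
    simp only [norm_mul, Complex.norm_real, Real.norm_eq_abs, abs_of_pos (h1 _)]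
    have h4 : ‖(1 / 4 : ℂ)‖ ≤ 1 := by norm_num
    calc _ ≤ ((1 + |(m : ℝ)|) ^ p * bracket ((n - m : ℤ) : ℝ) ^ r) *
          (1 * C * (C * ‖u.coeffs (n - m)‖)) := by
          have h5 := hb n
          have h6 := hb (n - m)
          have := (h1 (n - m)).le
          gcongr
      _ = _ := by ring
  have hmem : ∀ m u, Memℓp (E := fun _ : ℤ => ℂ) (bracketD r (w m u)) 2 := fun m u =>
    memℓp_weightedShift (lp.memℓp (toEll2 r u)) m (hw m u)
  have hodd : ∀ m u n, w m u (-n) = -w (-m) u n := by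
    intro m u n
    have h1 : -n - m = -(n - -m) := by ring
    simp only [w]
    rw [h1, invSqrtEig_neg, invSqrtEig_neg, u.coeffs_neg]
    ring
  have hsum : ∀ m u, w m u + w (-m) u ∈ oddSubmodule r := fun m u =>
    ⟨fun j => by simp only [Pi.add_apply, hodd, neg_neg]; ring, by
      rw [map_add]; exact (hmem m u).add (hmem (-m) u)⟩
  let T : ℤ → (OddSobolev r →ₗ[ℂ] OddSobolev r) := fun m =>
    { toFun := fun u => ⟨_, hsum m u⟩
      map_add' := fun u v => OddSobolev.ext_coeffs fun n => by
        change (w m (u + v) + w (-m) (u + v)) n =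
          (w m u + w (-m) u) n + (w m v + w (-m) v) n
        simp only [w, Pi.add_apply, OddSobolev.coeffs_add]
        ring
      map_smul' := fun c u => OddSobolev.ext_coeffs fun n => by
        change (w m (c • u) + w (-m) (c • u)) n = c * (w m u + w (-m) u) n
        simp only [w, Pi.add_apply, OddSobolev.coeffs_smul]
        ring }
  have hT : ∀ m u, ‖T m u‖ ≤ (2 * (C * C)) * (1 + |(m : ℝ)|) ^ p * ‖u‖ := by
    intro m u
    have h1 : toEll2 r (T m u) = (⟨_, hmem m u⟩ : lp (fun _ : ℤ => ℂ) 2) +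
        (⟨_, hmem (-m) u⟩ : lp (fun _ : ℤ => ℂ) 2) :=
      Subtype.ext ((bracketD r).map_add (w m u) (w (-m) u))
    have h2 : ‖T m u‖ = ‖toEll2 r (T m u)‖ := rfl
    have h3 : ‖u‖ = ‖toEll2 r u‖ := rfl
    rw [h2, h1]
    refine (norm_add_le _ _).trans ?_
    have h4 := norm_weightedShift_le (toEll2 r u) ⟨_, hmem m u⟩ (by positivity) m (hw m u)
    have h5 := norm_weightedShift_le (toEll2 r u) ⟨_, hmem (-m) u⟩ (by positivity) (-m) (hw (-m) u)
    rw [← h3] at h4 h5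
    push_cast at h5
    rw [abs_neg] at h5
    linarith
  refine ⟨fun m => (T m).mkContinuous _ (hT m), fun m u n => ?_, 2 * (C * C), by positivity, p,
    fun m => LinearMap.mkContinuous_norm_le _ (by positivity) _⟩
  change (w m u + w (-m) u) n = _
  simp only [w, Pi.add_apply, sub_neg_eq_add]
  ring

/-- The operator `½ B^{-1/2} cos(mx) B^{-1/2}` on `𝓗^r`. -/
def cosOp (mass r : ℝ) : ℤ → (OddSobolev r →L[ℂ] OddSobolev r) := (exists_cosOp mass r).choose

theorem cosOp_coeffs (mass r : ℝ) (m : ℤ) (u : OddSobolev r) (n : ℤ) :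
    (cosOp mass r m u).coeffs n = (1 / 4) * (invSqrtEig mass n : ℂ) *
      ((invSqrtEig mass (n - m) : ℂ) * u.coeffs (n - m) +
        (invSqrtEig mass (n + m) : ℂ) * u.coeffs (n + m)) :=
  (exists_cosOp mass r).choose_spec.1 m u n

/-- Fourier coefficients that decay rapidly in the space index and are summable in the angles. -/
def RapidModes (y : Modes ν → ℂ) : Prop := ∀ N, Summable fun g => weight 0 N g * ‖y g‖

theorem RapidModes.summable_norm {y : Modes ν → ℂ} (hy : RapidModes y) :
    Summable fun g => ‖y g‖ := by
  simpa [weight] using hy 0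

theorem RapidModes.of_modeNorm {σ : ℝ} (hσ : 0 ≤ σ) {y : Modes ν → ℂ}
    (hy : ∀ N, modeNorm σ N y < ∞) : RapidModes y := fun N =>
  Summable.of_nonneg_of_le (fun g => mul_nonneg (weight_pos 0 N g).le (norm_nonneg _)) (fun g => by
    refine mul_le_mul_of_nonneg_right ?_ (norm_nonneg _)
    rw [weight, weight]
    refine mul_le_mul_of_nonneg_right (Real.exp_le_exp.2 ?_) (by positivity)
    exact mul_le_mul_of_nonneg_right hσ (waveLen_nonneg _)) (summable_of_modeNorm (hy N))

theorem RapidModes.summable_norm_cosOp {y : Modes ν → ℂ} (hy : RapidModes y) (mass r : ℝ) :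
    Summable fun g : Modes ν => ‖y g‖ * ‖cosOp mass r g.2‖ := by
  obtain ⟨C, hC, p, hp⟩ := (exists_cosOp mass r).choose_spec.2
  refine Summable.of_nonneg_of_le (fun _ => by positivity) (fun g => ?_) ((hy p).mul_left C)
  have h := hp g.2
  have h2 : weight 0 p g = (1 + |(g.2 : ℝ)|) ^ p := by simp [weight]
  rw [h2]
  calc _ ≤ ‖y g‖ * (C * (1 + |(g.2 : ℝ)|) ^ p) := mul_le_mul_of_nonneg_left h (norm_nonneg _)
    _ = _ := by ring

/-- The operator `½ B^{-1/2} Y(θ, x) B^{-1/2}` on `𝓗^r`, for an even function `Y` with Fourier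
coefficients `y`. -/
def sandOp (mass r : ℝ) (y : Modes ν → ℂ) (θ : Fin ν → ℝ) : OddSobolev r →L[ℂ] OddSobolev r :=
  ∑' g : Modes ν, (y g * angleMode g.1 (toComplex θ)) • cosOp mass r g.2

theorem RapidModes.summable_cosOp {y : Modes ν → ℂ} (hy : RapidModes y) (mass r : ℝ)
    (θ : Fin ν → ℝ) :
    Summable fun g : Modes ν => (y g * angleMode g.1 (toComplex θ)) • cosOp mass r g.2 := by
  refine Summable.of_norm_bounded (hy.summable_norm_cosOp mass r) fun g => ?_
  rw [norm_smul, norm_mul, norm_angleMode_real, mul_one]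

/-- The sequence `G u` for `G = B^{-1/2}`. -/
def invSqrtSeq (mass : ℝ) (u : Coeffs) : Coeffs := fun j => (invSqrtEig mass j : ℂ) * u j

/-- Evenness of `y` in `m` makes the sums over `n - m` and `n + m` equal, so the average built into
`cosOp` returns multiplication by the full series. -/
theorem sandOp_coeffs {y : Modes ν → ℂ} (hy : RapidModes y) (heven : ∀ k m, y (k, -m) = y (k, m))
    (mass r : ℝ) (θ : Fin ν → ℝ) (u : OddSobolev r)
    (hu : ∀ n, Summable fun g : Modes ν => y g * angleMode g.1 (toComplex θ) *
      invSqrtSeq mass u.coeffs (n - g.2)) (n : ℤ) :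
    (sandOp mass r y θ u).coeffs n =
      (1 / 2) * (invSqrtEig mass n : ℂ) * mulModes y θ (invSqrtSeq mass u.coeffs) n := by
  have h1 : (sandOp mass r y θ u).coeffs n = ∑' g : Modes ν, (y g * angleMode g.1 (toComplex θ)) *
      (cosOp mass r g.2 u).coeffs n := by
    have h2 := ((coeffCLM r n).comp (ContinuousLinearMap.apply ℂ (OddSobolev r) u)).map_tsum
      (hy.summable_cosOp mass r θ)
    exact h2
  have hr : ∀ g : Modes ν, y (reflectMode g) * angleMode (reflectMode g).1 (toComplex θ) *
      invSqrtSeq mass u.coeffs (n - (reflectMode g).2) =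
      y g * angleMode g.1 (toComplex θ) * invSqrtSeq mass u.coeffs (n + g.2) := by
    rintro ⟨k, m⟩
    simp [reflectMode, heven]
  have hu2 : Summable fun g : Modes ν => y g * angleMode g.1 (toComplex θ) *
      invSqrtSeq mass u.coeffs (n + g.2) :=
    ((reflectMode.summable_iff (f := fun g : Modes ν => y g * angleMode g.1 (toComplex θ) *
      invSqrtSeq mass u.coeffs (n - g.2))).2 (hu n)).congr hr
  have h3 : mulModes y θ (invSqrtSeq mass u.coeffs) n = ∑' g : Modes ν,
      y g * angleMode g.1 (toComplex θ) * invSqrtSeq mass u.coeffs (n + g.2) := by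
    rw [mulModes, ← reflectMode.tsum_eq]
    exact tsum_congr hr
  have h4 : (2 : ℂ) * mulModes y θ (invSqrtSeq mass u.coeffs) n =
      ∑' g : Modes ν, (y g * angleMode g.1 (toComplex θ) * invSqrtSeq mass u.coeffs (n - g.2) +
        y g * angleMode g.1 (toComplex θ) * invSqrtSeq mass u.coeffs (n + g.2)) := by
    rw [(hu n).tsum_add hu2, ← h3, mulModes, two_mul]
  rw [h1]
  have h5 : (1 / 2) * (invSqrtEig mass n : ℂ) * mulModes y θ (invSqrtSeq mass u.coeffs) n =
      (1 / 4) * (invSqrtEig mass n : ℂ) * (2 * mulModes y θ (invSqrtSeq mass u.coeffs) n) := by ring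
  rw [h5, h4, ← tsum_mul_left]
  refine tsum_congr fun g => ?_
  rw [cosOp_coeffs]
  simp only [invSqrtSeq]
  ring

/-- For `r ≥ -1` the coefficients grow at most linearly, which one power of the weight controls. The
range includes `r - 1` for every `r ≥ 0`, the space in which the equation holds. -/
theorem sandOp_coeffs_of_le {y : Modes ν → ℂ} (hy : RapidModes y)
    (heven : ∀ k m, y (k, -m) = y (k, m)) (mass : ℝ) {r : ℝ} (hr : -1 ≤ r) (θ : Fin ν → ℝ)
    (u : OddSobolev r) (n : ℤ) :
    (sandOp mass r y θ u).coeffs n =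
      (1 / 2) * (invSqrtEig mass n : ℂ) * mulModes y θ (invSqrtSeq mass u.coeffs) n := by
  refine sandOp_coeffs hy heven mass r θ u (fun n => ?_) n
  obtain ⟨C, hC, hb⟩ := exists_invSqrtEig_le mass
  refine summable_mulModes (hy 1) θ (c := C * ‖u‖) (fun j => ?_) n
  rw [invSqrtSeq, norm_mul, Complex.norm_real, Real.norm_eq_abs]
  have h1 : bracket j ^ (-r) ≤ bracket j := by
    simpa using Real.rpow_le_rpow_of_exponent_le (one_le_bracket j) (show -r ≤ 1 by linarith)
  calc _ ≤ C * (bracket j * ‖u‖) := by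
        have := hb j
        have := u.norm_coeffs_le j
        gcongr
        exact this.trans (by gcongr)
    _ = _ := by ring

/-! ### Amplitudes of the normal form -/

/-- The amplitude of `½ B^{-1/2} Y B^{-1/2}`. -/
def ampX (mass : ℝ) (y : Modes ν → ℂ) : Modes ν → ℤ → ℂ := fun g j =>
  y g * ((1 / 2) * ((invSqrtEig mass (j + g.2) : ℂ) * (invSqrtEig mass j : ℂ)))

/-- The amplitude of `a X B + b B X + 2 X B X`, for `X = ½ B^{-1/2} Y B^{-1/2}`. -/
def ampV (mass : ℝ) (a b : ℂ) (y : Modes ν → ℂ) : Modes ν → ℤ → ℂ := fun g j =>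
  y g * ((1 / 2) * ((invSqrtEig mass (j + g.2) : ℂ) * (invSqrtEig mass j : ℂ)) *
    (a * (regEig mass j : ℂ) + b * (regEig mass (j + g.2) : ℂ))) + conv y y g *
      ((1 / 2) * ((invSqrtEig mass (j + g.2) : ℂ) * (invSqrtEig mass j : ℂ)))

theorem conv_reflect {y z : Modes ν → ℂ} (hy : ∀ k m, y (k, -m) = y (k, m))
    (hz : ∀ k m, z (k, -m) = z (k, m)) (k : Fin ν → ℤ) (m : ℤ) :
    conv y z (k, -m) = conv y z (k, m) := by
  rw [conv, conv, ← reflectMode.tsum_eq]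
  refine tsum_congr fun ⟨l, n⟩ => ?_
  have h1 : -m - -n = -(m - n) := by ring
  simp only [reflectMode, Equiv.prodCongr_apply, Prod.map, Equiv.refl_apply, Equiv.neg_apply,
    Prod.mk_sub_mk, h1, hy, hz]

theorem conj_conv_neg {y z : Modes ν → ℂ} (hy : ∀ g, starRingEnd ℂ (y (-g)) = y g)
    (hz : ∀ g, starRingEnd ℂ (z (-g)) = z g) (g : Modes ν) :
    starRingEnd ℂ (conv y z (-g)) = conv y z g := by
  rw [conv, conv, Complex.conj_tsum, ← (Equiv.neg (Modes ν)).tsum_eq]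
  refine tsum_congr fun h => ?_
  have h1 : -g - -h = -(g - h) := by abel
  simp only [Equiv.neg_apply, map_mul, h1, hy, hz]

theorem ampV_reflect (mass : ℝ) (a b : ℂ) {y : Modes ν → ℂ} (hy : ∀ k m, y (k, -m) = y (k, m))
    (k : Fin ν → ℤ) (m j : ℤ) :
    ampV mass a b y (k, -m) (-j) = ampV mass a b y (k, m) j := by
  have h1 : -j + -m = -(j + m) := by ring
  simp only [ampV, conv_reflect hy hy, hy, h1, invSqrtEig_neg, regEig_neg]

theorem ampX_reflect (mass : ℝ) {y : Modes ν → ℂ} (hy : ∀ k m, y (k, -m) = y (k, m))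
    (k : Fin ν → ℤ) (m j : ℤ) : ampX mass y (k, -m) (-j) = ampX mass y (k, m) j := by
  have h1 : -j + -m = -(j + m) := by ring
  simp only [ampX, hy, h1, invSqrtEig_neg]

theorem conjAmp_ampV (mass : ℝ) (a b : ℂ) {y : Modes ν → ℂ}
    (hy : ∀ g, starRingEnd ℂ (y (-g)) = y g) :
    conjAmp (ampV mass a b y) = ampV mass (starRingEnd ℂ a) (starRingEnd ℂ b) y := by
  funext g j
  have h1 : -j + -g.2 = -(j + g.2) := by ring
  simp only [conjAmp, ampV, map_add, map_mul, conj_conv_neg hy hy, hy, Prod.snd_neg, h1,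
    invSqrtEig_neg, regEig_neg, Complex.conj_ofReal, map_div₀, map_one, map_ofNat]

/-- Self-adjointness of `Vᵈ`: taking the adjoint conjugates `a` and `b` and exchanges `j` with `j +
m`, which restores the amplitude when the two constants are conjugate. -/
theorem conj_ampV_neg (mass : ℝ) (a b : ℂ) (hab : starRingEnd ℂ a = b) {y : Modes ν → ℂ}
    (hy : ∀ g, starRingEnd ℂ (y (-g)) = y g) (g : Modes ν) (j : ℤ) :
    starRingEnd ℂ (ampV mass a b y (-g) (j + g.2)) = ampV mass a b y g j := by
  have hba : starRingEnd ℂ b = a := by rw [← hab, Complex.conj_conj]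
  have h1 : j + g.2 + -g.2 = j := by ring
  simp only [ampV, map_add, map_mul, conj_conv_neg hy hy, hy, Prod.snd_neg, h1,
    Complex.conj_ofReal, map_div₀, map_one, map_ofNat, hab, hba]
  ring

/-- The symmetry behind `[Vᵒ]* = conj Vᵒ`: the eigenvalues are even in `j`, and equal constants make
the amplitude symmetric in the two frequencies. -/
theorem ampV_neg_add (mass : ℝ) (a : ℂ) (y : Modes ν → ℂ) (g : Modes ν) (j : ℤ) :
    ampV mass a a y g (-(j + g.2)) = ampV mass a a y g j := by
  have h1 : -(j + g.2) + g.2 = -j := by ring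
  simp only [ampV, h1, invSqrtEig_neg, regEig_neg]
  ring

theorem twist_ampX {y : Modes ν → ℂ} (hy : RapidModes y) (heven : ∀ k m, y (k, -m) = y (k, m))
    (mass : ℝ) {r : ℝ} (hr : 0 ≤ r) (θ : Fin ν → ℝ) (u : OddSobolev r) (n : ℤ) :
    twist (ampX mass y) θ u.coeffs n = (sandOp mass r y θ u).coeffs n := by
  rw [sandOp_coeffs_of_le hy heven mass (by linarith), twist, mulModes, ← tsum_mul_left]
  refine tsum_congr fun g => ?_
  simp only [ampX, invSqrtSeq, sub_add_cancel]
  ring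

theorem twist_ampV {y : Modes ν → ℂ} (hy : RapidModes y) (hyy : RapidModes (conv y y))
    (heven : ∀ k m, y (k, -m) = y (k, m))
    (mass : ℝ) (a b : ℂ) {r : ℝ} (hr : 0 ≤ r) (θ : Fin ν → ℝ) (u : OddSobolev r) (n : ℤ) :
    twist (ampV mass a b y) θ u.coeffs n =
      a * (sandOp mass (r - 1) y θ (bOp mass r u)).coeffs n +
      b * (regEig mass n * (sandOp mass r y θ u).coeffs n) +
      2 * (sandOp mass (r - 1) y θ (bOp mass r (sandOp mass r y θ u))).coeffs n := by
  obtain ⟨C, hC, hb⟩ := exists_invSqrtEig_le mass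
  have hGu : ∀ j : ℤ, ‖invSqrtSeq mass u.coeffs j‖ ≤ C * ‖u‖ := fun j => by
    rw [invSqrtSeq, norm_mul, Complex.norm_real, Real.norm_eq_abs]
    exact mul_le_mul (hb j) (u.norm_coeffs_le' hr j) (norm_nonneg _) hC
  have hGu' : ∀ j : ℤ, ‖invSqrtSeq mass u.coeffs j‖ ≤ C * ‖u‖ * bracket j := fun j =>
    (hGu j).trans (le_mul_of_one_le_right (by positivity) (one_le_bracket j))
  have hGB : ∃ c : ℝ, ∀ j : ℤ, ‖invSqrtSeq mass (bOp mass r u).coeffs j‖ ≤ c * bracket j := by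
    obtain ⟨D, hD, hd⟩ := exists_regEig_le mass
    refine ⟨C * D * ‖u‖, fun j => ?_⟩
    rw [invSqrtSeq, bOp_coeffs, norm_mul, norm_mul, Complex.norm_real, Complex.norm_real,
      Real.norm_eq_abs, Real.norm_eq_abs]
    calc _ ≤ C * (D * bracket j * ‖u‖) := by
          have h1 := hb j
          have h2 := hd j
          have h3 := u.norm_coeffs_le' hr j
          have := bracket_pos j
          gcongr
      _ = _ := by ring
  obtain ⟨c, hc⟩ := hGB
  have hs1 := summable_mulModes (hy 1) θ hGu' n
  have hs2 := summable_mulModes (hy 1) θ hc n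
  have hs3 := summable_mulModes (hyy 1) θ hGu' n
  -- Here `B^{-1/2} B B^{-1/2} = 1`, so the inner multiplier disappears and the two multiplications
  -- by `Y` become one by `Y²`.
  have e3 : invSqrtSeq mass (bOp mass r (sandOp mass r y θ u)).coeffs =
      fun n => (1 / 2) * mulModes y θ (invSqrtSeq mass u.coeffs) n := by
    funext n
    have h := invSqrtEig_mul_regEig mass n
    have h' : (invSqrtEig mass n : ℂ) * (regEig mass n : ℂ) * (invSqrtEig mass n : ℂ) = 1 := by
      exact_mod_cast h
    rw [invSqrtSeq, bOp_coeffs, sandOp_coeffs_of_le hy heven mass (by linarith)]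
    linear_combination (1 / 2) * mulModes y θ (invSqrtSeq mass u.coeffs) n * h'
  have e4 : mulModes y θ (invSqrtSeq mass (bOp mass r (sandOp mass r y θ u)).coeffs) n =
      (1 / 2) * mulModes (conv y y) θ (invSqrtSeq mass u.coeffs) n := by
    rw [e3, mulModes_conv hy.summable_norm hy.summable_norm θ hGu]
    rw [mulModes, mulModes, ← tsum_mul_left]
    exact tsum_congr fun g => by ring
  rw [sandOp_coeffs_of_le hy heven mass (by linarith), sandOp_coeffs_of_le hy heven mass
    (by linarith), sandOp_coeffs_of_le hy heven mass (by linarith), e4]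
  have key : twist (ampV mass a b y) θ u.coeffs n =
      (a * ((1 / 2) * (invSqrtEig mass n : ℂ))) *
        mulModes y θ (invSqrtSeq mass (bOp mass r u).coeffs) n +
      (b * ((1 / 2) * (invSqrtEig mass n : ℂ) * regEig mass n)) *
        mulModes y θ (invSqrtSeq mass u.coeffs) n +
      ((1 / 2) * (invSqrtEig mass n : ℂ)) *
        mulModes (conv y y) θ (invSqrtSeq mass u.coeffs) n := by
    rw [mulModes, mulModes, mulModes, ← tsum_mul_left, ← tsum_mul_left, ← tsum_mul_left,
      ← (hs2.mul_left _).tsum_add (hs1.mul_left _),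
      ← ((hs2.mul_left _).add (hs1.mul_left _)).tsum_add (hs3.mul_left _), twist]
    refine tsum_congr fun g => ?_
    simp only [ampV, invSqrtSeq, bOp_coeffs, sub_add_cancel]
    ring
  rw [key]
  ring

/-! ### Time dependence along the flow `θ = ωt` -/

/-- `ω · k`. -/
def freqDot (ω : Freq ν) (k : Fin ν → ℤ) : ℝ := ∑ i, ω i * (k i : ℝ)

theorem angleMode_angle (k : Fin ν → ℤ) (ω : Freq ν) (t : ℝ) :
    angleMode k (toComplex (angle ω t)) = Complex.exp (Complex.I * freqDot ω k * t) := by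
  rw [angleMode]
  congr 1
  rw [mul_assoc]
  congr 1
  simp only [phase, toComplex, angle, freqDot]
  push_cast
  rw [Finset.sum_mul]
  exact Finset.sum_congr rfl fun i _ => by ring

theorem hasDerivAt_angleMode_angle (k : Fin ν → ℤ) (ω : Freq ν) (t : ℝ) :
    HasDerivAt (fun t => angleMode k (toComplex (angle ω t)))
      (Complex.I * freqDot ω k * angleMode k (toComplex (angle ω t))) t := by
  have h : HasDerivAt (fun t : ℝ => Complex.I * freqDot ω k * (t : ℂ))
      (Complex.I * freqDot ω k) t := by
    simpa using (Complex.ofRealCLM.hasDerivAt (x := t)).const_mul (Complex.I * freqDot ω k)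
  simp only [angleMode_angle]
  exact h.cexp.congr_deriv (mul_comm _ _)

/-- With `v` the modes of the driving this says that `X` differentiates along the flow to `½
B^{-1/2} V B^{-1/2}`. The derivative is in operator norm, the differentiated series being dominated
uniformly in `t`. -/
theorem hasDerivAt_sandOp {y v : Modes ν → ℂ} (hy : RapidModes y) (hv : RapidModes v)
    (ω : Freq ν) (hyv : ∀ g : Modes ν, v g = Complex.I * freqDot ω g.1 * y g) (mass r t : ℝ) :
    HasDerivAt (fun t => sandOp mass r y (angle ω t)) (sandOp mass r v (angle ω t)) t := by
  refine hasDerivAt_tsum (u := fun g : Modes ν => ‖v g‖ * ‖cosOp mass r g.2‖) (y₀ := 0)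
    (g := fun (g : Modes ν) t => (y g * angleMode g.1 (toComplex (angle ω t))) • cosOp mass r g.2)
    (g' := fun (g : Modes ν) t => (v g * angleMode g.1 (toComplex (angle ω t))) • cosOp mass r g.2)
    (hv.summable_norm_cosOp mass r) (fun g t => ?_) (fun g t => ?_)
    (hy.summable_cosOp mass r (angle ω 0)) t
  · have h := ((hasDerivAt_angleMode_angle g.1 ω t).const_mul (y g)).smul_const (cosOp mass r g.2)
    refine h.congr_deriv ?_
    rw [hyv]
    congr 1
    ring
  · rw [norm_smul, norm_mul, norm_angleMode_real, mul_one]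

theorem continuous_sandOp {y : Modes ν → ℂ} (hy : RapidModes y) (ω : Freq ν) (mass r : ℝ) :
    Continuous fun t => sandOp mass r y (angle ω t) := by
  refine continuous_tsum (u := fun g : Modes ν => ‖y g‖ * ‖cosOp mass r g.2‖) (fun g => ?_)
    (hy.summable_norm_cosOp mass r) fun g t => ?_
  · have h : Continuous fun t => angleMode g.1 (toComplex (angle ω t)) :=
      continuous_iff_continuousAt.2 fun t => (hasDerivAt_angleMode_angle g.1 ω t).continuousAt
    exact (continuous_const.mul h).smul continuous_const
  · rw [norm_smul, norm_mul, norm_angleMode_real, mul_one]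

theorem hasDerivAt_clm_apply_real {E F : Type*} [NormedAddCommGroup E] [NormedSpace ℂ E]
    [NormedAddCommGroup F] [NormedSpace ℂ F] {A : ℝ → E →L[ℂ] F} {A' : E →L[ℂ] F} {u : ℝ → E}
    {u' : E} {t : ℝ} (hA : HasDerivAt A A' t) (hu : HasDerivAt u u' t) :
    HasDerivAt (fun t => A t (u t)) (A' (u t) + A t u') t := by
  have h := ((ContinuousLinearMap.restrictScalarsIsometry ℂ E F ℝ
    ℝ).toContinuousLinearMap.hasFDerivAt
    (x := A t)).comp_hasDerivAt t hA
  exact h.clm_apply hu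

/-- The signs in `σ₃`. -/
def blockSign : Fin 2 → ℂ := ![1, -1]

/-- The analytic half of the conjugation, common to both directions, with `c = ±i`. Regularity and
the product rule are settled here; `hcompat` identifies the realizations of `X` on `𝓗^r` and
`𝓗^{r-1}`, and `halg` is the algebra of coefficients left to check. -/
theorem IsSolution.transform {r : ℝ} {H H' : ℝ → BlockOper} {φ : ℝ → Phase r}
    (h : IsSolution r H φ) (c : ℂ) {y v : Modes ν → ℂ} (hy : RapidModes y) (hv : RapidModes v)
    (ω : Freq ν) (hyv : ∀ g : Modes ν, v g = Complex.I * freqDot ω g.1 * y g) (mass : ℝ)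
    (hcompat : ∀ t (u : OddSobolev r) (u₁ : OddSobolev (r - 1)), u₁.coeffs = u.coeffs → ∀ n,
      (sandOp mass (r - 1) y (angle ω t) u₁).coeffs n = (sandOp mass r y (angle ω t) u).coeffs n)
    (halg : ∀ t (u : Phase r) (u₁ e : Phase (r - 1)), (∀ a, (u₁ a).coeffs = (u a).coeffs) →
      (∀ a, Complex.I • (e a).coeffs = (H t).act (fun b => (u b).coeffs) a) →
      ∀ a, Complex.I • (e a + (c * blockSign a) •
        (sandOp mass (r - 1) v (angle ω t) (u₁ 0 + u₁ 1) +
          sandOp mass (r - 1) y (angle ω t) (e 0 + e 1))).coeffs =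
        (H' t).act (fun b => (u b + (c * blockSign b) •
          sandOp mass r y (angle ω t) (u 0 + u 1)).coeffs) a) :
    IsSolution r H' fun t a => φ t a + (c * blockSign a) •
      sandOp mass r y (angle ω t) (φ t 0 + φ t 1) := by
  obtain ⟨φ₁, d, h1, hd, hder, heq⟩ := h.equation
  have hc : ∀ a, Continuous fun t => φ t a := fun a => (continuous_apply a).comp h.continuous
  have hda : ∀ a, Continuous fun t => d t a := fun a => (continuous_apply a).comp hd
  have hder' : ∀ t a, HasDerivAt (fun t => φ₁ t a) (d t a) t := fun t =>
    hasDerivAt_pi.1 (hder t)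
  have hc1 : ∀ a, Continuous fun t => φ₁ t a := fun a =>
    continuous_iff_continuousAt.2 fun t => (hder' t a).continuousAt
  refine ⟨continuous_pi fun a => (hc a).add (Continuous.const_smul
    ((continuous_sandOp hy ω mass r).clm_apply ((hc 0).add (hc 1))) (c * blockSign a)),
    fun t a => φ₁ t a + (c * blockSign a) •
      sandOp mass (r - 1) y (angle ω t) (φ₁ t 0 + φ₁ t 1), fun t a => d t a + (c * blockSign a) •
        (sandOp mass (r - 1) v (angle ω t) (φ₁ t 0 + φ₁ t 1) +
          sandOp mass (r - 1) y (angle ω t) (d t 0 + d t 1)), fun t a => ?_, ?_, fun t => ?_,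
    fun t a => halg t (φ t) (φ₁ t) (d t) (h1 t) (heq t) a⟩
  · funext n
    rw [OddSobolev.coeffs_add, OddSobolev.coeffs_add, OddSobolev.coeffs_smul,
      OddSobolev.coeffs_smul, h1, hcompat t (φ t 0 + φ t 1)]
    funext n
    rw [OddSobolev.coeffs_add, OddSobolev.coeffs_add, h1, h1]
  · exact continuous_pi fun a => (hda a).add (Continuous.const_smul
      (((continuous_sandOp hv ω mass (r - 1)).clm_apply ((hc1 0).add (hc1 1))).add
        ((continuous_sandOp hy ω mass (r - 1)).clm_apply ((hda 0).add (hda 1))))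
      (c * blockSign a))
  · refine hasDerivAt_pi.2 fun a => (hder' t a).fun_add
      (HasDerivAt.fun_const_smul (c * blockSign a) ?_)
    exact hasDerivAt_clm_apply_real (hasDerivAt_sandOp hy hv ω hyv mass (r - 1) t)
      ((hder' t 0).add (hder' t 1))

/-! ### The Hamiltonians on Fourier coefficients -/

theorem opBinvSqrt_eq {mass : ℝ} {u : Coeffs} (hu : u 0 = 0) :
    opBinvSqrt mass u = invSqrtSeq mass u := by
  funext j
  rw [opBinvSqrt, invSqrtSeq]
  split_ifs with h
  · have : j = 0 := by
      by_contra hj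
      exact eigB_ne_zero mass hj h
    rw [this, hu, mul_zero]
  · rw [invSqrtEig, regEig_eq_eigB mass h]

theorem eigB_mul_coeffs (mass : ℝ) {r : ℝ} (u : OddSobolev r) (n : ℤ) :
    (eigB mass n : ℂ) * u.coeffs n = (regEig mass n : ℂ) * u.coeffs n := by
  by_cases hn : n = 0
  · rw [hn, u.coeffs_zero, mul_zero, mul_zero]
  · rw [regEig_eq_eigB mass (eigB_ne_zero mass hn)]

theorem blockW_entry {V : (Fin ν → ℝ) → ℝ → ℝ} {v : Modes ν → ℂ} (hv : RapidModes v)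
    (heven : ∀ k m, v (k, -m) = v (k, m)) (θ : Fin ν → ℝ)
    (hV : ∀ x, (evenExt V θ x : ℂ) =
      ∑' g : Modes ν, v g * (angleMode g.1 (toComplex θ) * spaceMode g.2 x))
    (mass : ℝ) {r : ℝ} (hr : 0 ≤ r) (u : OddSobolev r) (n : ℤ) :
    (1 / 2 : ℂ) * opBinvSqrt mass (opV V θ (opBinvSqrt mass u.coeffs)) n =
      (sandOp mass r v θ u).coeffs n := by
  obtain ⟨C, hC, hb⟩ := exists_invSqrtEig_le mass
  have hGu : ∀ j : ℤ, ‖invSqrtSeq mass u.coeffs j‖ ≤ C * ‖u‖ := fun j => by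
    rw [invSqrtSeq, norm_mul, Complex.norm_real, Real.norm_eq_abs]
    exact mul_le_mul (hb j) (u.norm_coeffs_le' hr j) (norm_nonneg _) hC
  have h1 : opV V θ (invSqrtSeq mass u.coeffs) = mulModes v θ (invSqrtSeq mass u.coeffs) := by
    have h2 : (fun x (_ : ℤ) => (evenExt V θ x : ℂ)) =
        symb (fun (g : Modes ν) _ => v g) (toComplex θ) := by
      funext x j
      exact hV x
    rw [opV, h2]
    exact opAt_symb ⟨fun g => ‖v g‖, hv.summable_norm, fun g j => le_rfl⟩ θ hGu
  have hodd : ∀ j, invSqrtSeq mass u.coeffs (-j) = -invSqrtSeq mass u.coeffs j := fun j => by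
    simp only [invSqrtSeq, invSqrtEig_neg, u.coeffs_neg, mul_neg]
  -- The outer `B^{-1/2}` also sees an odd function, so its value on constants does not matter and
  -- it agrees with the regularized multiplier.
  have h0 : mulModes v θ (invSqrtSeq mass u.coeffs) 0 = 0 := by
    have := mulModes_neg heven θ hodd 0
    simpa [self_eq_neg] using this
  rw [opBinvSqrt_eq u.coeffs_zero, h1, opBinvSqrt_eq h0,
    sandOp_coeffs_of_le hv heven mass (by linarith), invSqrtSeq]
  ring

theorem blockH_act {V : (Fin ν → ℝ) → ℝ → ℝ} {v : Modes ν → ℂ} (hv : RapidModes v)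
    (heven : ∀ k m, v (k, -m) = v (k, m)) (θ : Fin ν → ℝ)
    (hV : ∀ x, (evenExt V θ x : ℂ) =
      ∑' g : Modes ν, v g * (angleMode g.1 (toComplex θ) * spaceMode g.2 x))
    (mass : ℝ) {r : ℝ} (hr : 0 ≤ r) (u : Phase r) (a : Fin 2) (n : ℤ) :
    (blockH0 mass + blockW mass V θ).act (fun b => (u b).coeffs) a n =
      blockSign a * ((regEig mass n : ℂ) * (u a).coeffs n +
        (sandOp mass r v θ (u 0 + u 1)).coeffs n) := by
  rw [map_add, OddSobolev.coeffs_add, ← blockW_entry hv heven θ hV mass hr (u 0) n,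
    ← blockW_entry hv heven θ hV mass hr (u 1) n, ← eigB_mul_coeffs]
  fin_cases a
  · simp [BlockOper.act, blockH0, blockW, tensorPauli, sigma3, sigma4, opB, blockSign, add_assoc]
  · simp [BlockOper.act, blockH0, blockW, tensorPauli, sigma3, sigma4, opB, blockSign]
    ring

/-- Written through `u 0 - u 1` and `u 0 + u 1`: the `XB` terms see the difference, the `BX` and
`XBX` terms the sum. This is the action of `σ₄σ₃`, `σ₃σ₄` and `σ₄σ₃σ₄ = 2σ₄`. The `BX` term alone
carries no sign, because both rows of `σ₃σ₄` are equal. -/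
theorem hamBlock_act {y : Modes ν → ℂ} (hy : RapidModes y) (hyy : RapidModes (conv y y))
    (heven : ∀ k m, y (k, -m) = y (k, m)) (hreal : ∀ g, starRingEnd ℂ (y (-g)) = y g)
    (mass : ℝ) (hd : SummablyBounded (ampV mass Complex.I (-Complex.I) y))
    (ho : SummablyBounded (ampV mass (-Complex.I) (-Complex.I) y))
    {r : ℝ} (hr : 0 ≤ r) (θ : Fin ν → ℝ) (u : Phase r) (a : Fin 2) (n : ℤ) :
    (blockH0 mass + hamBlock (opAt (symb (ampV mass Complex.I (-Complex.I) y)) θ)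
      (opAt (symb (ampV mass (-Complex.I) (-Complex.I) y)) θ)).act (fun b => (u b).coeffs) a n =
      blockSign a * ((regEig mass n : ℂ) * (u a).coeffs n +
        Complex.I * (sandOp mass (r - 1) y θ (bOp mass r (u 0 - u 1))).coeffs n +
        2 * (sandOp mass (r - 1) y θ (bOp mass r (sandOp mass r y θ (u 0 + u 1)))).coeffs n) -
      Complex.I * ((regEig mass n : ℂ) * (sandOp mass r y θ (u 0 + u 1)).coeffs n) := by
  have e : ∀ (a b : ℂ) (hs : SummablyBounded (ampV mass a b y)) (c : Fin 2),
      opAt (symb (ampV mass a b y)) θ (u c).coeffs n =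
        twist (ampV mass a b y) θ (u c).coeffs n := fun a b hs c => by
    rw [opAt_symb hs θ ((u c).norm_coeffs_le' hr)]
  have e' : ∀ (a b : ℂ) (hs : SummablyBounded (ampV mass a b y)) (c : Fin 2),
      conjOp (opAt (symb (ampV mass a b y)) θ) (u c).coeffs n =
        twist (ampV mass (starRingEnd ℂ a) (starRingEnd ℂ b) y) θ (u c).coeffs n :=
    fun a b hs c => by
      rw [conjOp_symb hs θ ((u c).norm_coeffs_le' hr), conjAmp_ampV mass a b hreal]
  fin_cases a
  · simp only [BlockOper.act, blockH0, hamBlock, tensorPauli, sigma3, opB, Fin.sum_univ_two,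
      Matrix.add_apply, Pi.add_apply, Fin.zero_eta, Matrix.of_apply, Matrix.cons_val',
      Matrix.cons_val_zero,
      Matrix.cons_val_one, Matrix.cons_val_fin_one, one_smul, zero_smul, Pi.zero_apply,
      e _ _ hd, e _ _ ho, twist_ampV hy hyy heven mass _ _ hr, eigB_mul_coeffs,
      blockSign, map_add, map_sub,
      OddSobolev.coeffs_add,
      OddSobolev.coeffs_sub]
    ring
  · simp only [BlockOper.act, blockH0, hamBlock, tensorPauli, sigma3, opB, Fin.sum_univ_two,
      Matrix.add_apply, Pi.add_apply, Fin.mk_one, Matrix.of_apply, Matrix.cons_val',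
      Matrix.cons_val_zero,
      Matrix.cons_val_one, Matrix.cons_val_fin_one, neg_smul, one_smul, zero_smul, Pi.zero_apply,
      Pi.neg_apply, e' _ _ hd, e' _ _ ho, twist_ampV hy hyy heven mass _ _ hr, eigB_mul_coeffs,
      blockSign, map_add, map_sub,
      OddSobolev.coeffs_add, OddSobolev.coeffs_sub, map_neg, Complex.conj_I]
    ring

/-! ### Conjugation -/

/-- All terms of the exponential series from the quadratic one on vanish; with `σ₄² = 0` this makes
the change of coordinates affine in `X`. -/
theorem exp_eq_one_add_of_mul_self_eq_zero {E : Type*} [NormedAddCommGroup E] [NormedSpace ℂ E]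
    {T : E →L[ℂ] E} (hT : T * T = 0) : NormedSpace.exp T = 1 + T := by
  rw [NormedSpace.exp_eq_tsum ℂ]
  dsimp only
  rw [tsum_eq_sum (s := Finset.range 2)]
  · simp [Finset.sum_range_succ]
  · intro n hn
    obtain ⟨m, rfl⟩ : ∃ m, n = 2 + m := Nat.exists_eq_add_of_le
      (not_lt.1 fun h => hn (Finset.mem_range.2 h))
    rw [pow_add, sq, hT, zero_mul, smul_zero]

/-- The block operator `X σ₄`, for `X = ½ B^{-1/2} Y B^{-1/2}`. -/
def blockX (mass r : ℝ) (y : Modes ν → ℂ) (θ : Fin ν → ℝ) : Phase r →L[ℂ] Phase r :=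
  ContinuousLinearMap.pi fun a => blockSign a • (sandOp mass r y θ ∘L
    (ContinuousLinearMap.proj (R := ℂ) (φ := fun _ : Fin 2 => OddSobolev r) 0 +
      ContinuousLinearMap.proj (R := ℂ) (φ := fun _ : Fin 2 => OddSobolev r) 1))

theorem blockX_apply (mass r : ℝ) (y : Modes ν → ℂ) (θ : Fin ν → ℝ) (u : Phase r) (a : Fin 2) :
    blockX mass r y θ u a = blockSign a • sandOp mass r y θ (u 0 + u 1) := rfl

theorem blockX_mul_self (mass r : ℝ) (y : Modes ν → ℂ) (θ : Fin ν → ℝ) :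
    blockX mass r y θ * blockX mass r y θ = 0 := by
  ext1 u
  funext a
  change blockSign a • sandOp mass r y θ (blockX mass r y θ u 0 + blockX mass r y θ u 1) = 0
  simp [blockX_apply, blockSign]
  abel

/-- The relation `hyv` is the cohomological equation `ω · ∂_θ Y = V`. With it, the derivative of the
change of coordinates removes the driving and the rest is an identity between coefficients, checked
in each row and for each direction of the equivalence. -/
theorem conjugates_of_cohomological {y v : Modes ν → ℂ} (hy : RapidModes y) (hv : RapidModes v)
    (hyy : RapidModes (conv y y)) (hy_even : ∀ k m, y (k, -m) = y (k, m))
    (hv_even : ∀ k m, v (k, -m) = v (k, m)) (hreal : ∀ g, starRingEnd ℂ (y (-g)) = y g)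
    (ω : Freq ν) (hyv : ∀ g : Modes ν, v g = Complex.I * freqDot ω g.1 * y g) (mass : ℝ)
    (hx : SummablyBounded (ampX mass y))
    (hd : SummablyBounded (ampV mass Complex.I (-Complex.I) y))
    (ho : SummablyBounded (ampV mass (-Complex.I) (-Complex.I) y))
    {V : (Fin ν → ℝ) → ℝ → ℝ} (hV : ∀ θ x, (evenExt V θ x : ℂ) =
      ∑' g : Modes ν, v g * (angleMode g.1 (toComplex θ) * spaceMode g.2 x))
    {r : ℝ} (hr : 0 ≤ r) :
    Conjugates r ω (opAt (symb (ampX mass y)))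
      (fun t => blockH0 mass + blockW mass V (angle ω t))
      (fun t => blockH0 mass +
        hamBlock (opAt (symb (ampV mass Complex.I (-Complex.I) y)) (angle ω t))
          (opAt (symb (ampV mass (-Complex.I) (-Complex.I) y)) (angle ω t))) := by
  refine ⟨blockX mass r y, fun θ u a => ?_, fun φ ψ hφψ => ?_⟩
  · have e : ∀ c : Fin 2, opAt (symb (ampX mass y)) θ (u c).coeffs =
        (sandOp mass r y θ (u c)).coeffs := fun c => by
      rw [opAt_symb hx θ ((u c).norm_coeffs_le' hr)]
      funext n
      exact twist_ampX hy hy_even mass hr θ (u c) n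
    funext n
    rw [blockX_apply, OddSobolev.coeffs_smul, map_add, OddSobolev.coeffs_add, ← e, ← e]
    fin_cases a <;> simp [BlockOper.act, tensorPauli, sigma4, blockSign]
    ring
  have hsq : ∀ t, (-(Complex.I • blockX mass r y (angle ω t))) *
      (-(Complex.I • blockX mass r y (angle ω t))) = 0 := fun t => by
    refine ContinuousLinearMap.ext fun u => ?_
    have h : blockX mass r y (angle ω t) (blockX mass r y (angle ω t) u) = 0 :=
      congrArg (fun T : Phase r →L[ℂ] Phase r => T u) (blockX_mul_self mass r y (angle ω t))
    change -(Complex.I • blockX mass r y (angle ω t)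
      (-(Complex.I • blockX mass r y (angle ω t) u))) = 0
    rw [map_neg, map_smul, h, smul_zero, neg_zero, smul_zero, neg_zero]
  have hφ : φ = fun t a => ψ t a + (-Complex.I * blockSign a) •
      sandOp mass r y (angle ω t) (ψ t 0 + ψ t 1) := by
    funext t a
    rw [hφψ t, exp_eq_one_add_of_mul_self_eq_zero (hsq t)]
    change ψ t a + -(Complex.I • blockX mass r y (angle ω t) (ψ t) a) = _
    rw [blockX_apply, smul_smul, neg_mul, neg_smul]
  have hψ : ψ = fun t a => φ t a + (Complex.I * blockSign a) •
      sandOp mass r y (angle ω t) (φ t 0 + φ t 1) := by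
    -- The columns of `σ₄` sum to zero, so the sum of the components is invariant; the inverse
    -- change of coordinates is thus obtained by reversing one sign.
    have hs : ∀ t, φ t 0 + φ t 1 = ψ t 0 + ψ t 1 := fun t => by
      rw [hφ]
      simp [blockSign]
      abel
    funext t a
    rw [hs, hφ, add_assoc, ← add_smul]
    simp
  have hcompat : ∀ {z : Modes ν → ℂ}, RapidModes z → (∀ k m, z (k, -m) = z (k, m)) →
      ∀ t (u : OddSobolev r) (u₁ : OddSobolev (r - 1)), u₁.coeffs = u.coeffs → ∀ n,
      (sandOp mass (r - 1) z (angle ω t) u₁).coeffs n =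
        (sandOp mass r z (angle ω t) u).coeffs n := by
    intro z hz hz_even t u u₁ h n
    rw [sandOp_coeffs_of_le hz hz_even mass (by linarith),
      sandOp_coeffs_of_le hz hz_even mass (by linarith), h]
  have hI : Complex.I * Complex.I = -1 := Complex.I_mul_I
  constructor
  · intro h
    rw [hψ]
    refine h.transform Complex.I hy hv ω hyv mass (hcompat hy hy_even) fun t u u₁ e hu he a => ?_
    have he' : ∀ a n, Complex.I * (e a).coeffs n = _ := fun a n => (congrFun (he a) n).trans
      (blockH_act hv hv_even (angle ω t) (hV _) mass hr u a n)
    -- The driving enters the two rows with opposite signs and drops out of the sum, so the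
    -- derivative brings only `XB` into the new equation and no product of `X` with the driving.
    have hes : e 0 + e 1 = (-Complex.I) • bOp mass r (u 0 - u 1) := by
      refine OddSobolev.ext_coeffs fun n => ?_
      rw [OddSobolev.coeffs_add, OddSobolev.coeffs_smul, bOp_coeffs, OddSobolev.coeffs_sub]
      have h0 := he' 0 n
      have h1 := he' 1 n
      simp only [blockSign, Matrix.cons_val_zero, Matrix.cons_val_one, Matrix.cons_val_fin_one]
        at h0 h1
      linear_combination (-Complex.I) * h0 + (-Complex.I) * h1 +
        ((e 0).coeffs n + (e 1).coeffs n) * hI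
    have hus : (u₁ 0 + u₁ 1).coeffs = (u 0 + u 1).coeffs := by
      funext n
      rw [OddSobolev.coeffs_add, OddSobolev.coeffs_add, hu, hu]
    funext n
    have h2 := he' a n
    have h3 := hcompat hv hv_even t (u 0 + u 1) (u₁ 0 + u₁ 1) hus n
    rw [hamBlock_act hy hyy hy_even hreal mass hd ho hr, Pi.smul_apply, smul_eq_mul,
      OddSobolev.coeffs_add, OddSobolev.coeffs_smul, OddSobolev.coeffs_add, h3, hes]
    simp only [map_add, map_sub, map_smul, OddSobolev.coeffs_add, OddSobolev.coeffs_sub,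
      OddSobolev.coeffs_smul] at h2 ⊢
    fin_cases a
    · simp only [blockSign, Fin.zero_eta, Matrix.cons_val_zero, Matrix.cons_val_one,
        Matrix.cons_val_fin_one] at h2 ⊢
      linear_combination (norm := (ring_nf; simp only [Complex.I_sq, Complex.I_pow_three]; ring_nf))
        h2
    · simp only [blockSign, Fin.mk_one, Matrix.cons_val_zero, Matrix.cons_val_one,
        Matrix.cons_val_fin_one] at h2 ⊢
      linear_combination (norm := (ring_nf; simp only [Complex.I_sq, Complex.I_pow_three]; ring_nf))
        h2
  · intro h
    rw [hφ]
    refine h.transform (-Complex.I) hy hv ω hyv mass (hcompat hy hy_even)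
      fun t u u₁ e hu he a => ?_
    have he' : ∀ a n, Complex.I * (e a).coeffs n = _ := fun a n => (congrFun (he a) n).trans
      (hamBlock_act hy hyy hy_even hreal mass hd ho hr (angle ω t) u a n)
    -- In the sum of the two rows only `BX` survives, doubled; applying `X` to it produces the term
    -- that cancels `2XBX`.
    have hes : e 0 + e 1 = (-Complex.I) • bOp mass r (u 0 - u 1 -
        (2 * Complex.I) • sandOp mass r y (angle ω t) (u 0 + u 1)) := by
      refine OddSobolev.ext_coeffs fun n => ?_
      rw [OddSobolev.coeffs_add, OddSobolev.coeffs_smul, bOp_coeffs, OddSobolev.coeffs_sub,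
        OddSobolev.coeffs_sub, OddSobolev.coeffs_smul]
      have h0 := he' 0 n
      have h1 := he' 1 n
      simp only [blockSign, Matrix.cons_val_zero, Matrix.cons_val_one, Matrix.cons_val_fin_one]
        at h0 h1
      linear_combination (-Complex.I) * h0 + (-Complex.I) * h1 +
        ((e 0).coeffs n + (e 1).coeffs n) * hI
    have hus : (u₁ 0 + u₁ 1).coeffs = (u 0 + u 1).coeffs := by
      funext n
      rw [OddSobolev.coeffs_add, OddSobolev.coeffs_add, hu, hu]
    funext n
    have h2 := he' a n
    have h3 := hcompat hv hv_even t (u 0 + u 1) (u₁ 0 + u₁ 1) hus n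
    rw [blockH_act hv hv_even (angle ω t) (hV _) mass hr, Pi.smul_apply, smul_eq_mul,
      OddSobolev.coeffs_add, OddSobolev.coeffs_smul, OddSobolev.coeffs_add, h3, hes]
    simp only [map_add, map_sub, map_smul, OddSobolev.coeffs_add, OddSobolev.coeffs_sub,
      OddSobolev.coeffs_smul] at h2 ⊢
    fin_cases a
    · simp only [blockSign, Fin.zero_eta, Matrix.cons_val_zero, Matrix.cons_val_one,
        Matrix.cons_val_fin_one] at h2 ⊢
      linear_combination
        (norm := (ring_nf; simp only [Complex.I_sq, Complex.I_pow_three, Complex.I_pow_four]; ring_nf))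
        h2
    · simp only [blockSign, Fin.mk_one, Matrix.cons_val_zero, Matrix.cons_val_one,
        Matrix.cons_val_fin_one] at h2 ⊢
      linear_combination
        (norm := (ring_nf; simp only [Complex.I_sq, Complex.I_pow_three, Complex.I_pow_four]; ring_nf))
        h2

/-! ### Holomorphic functions of one variable -/

open MeasureTheory Topology in
/-- Integrals of bounded holomorphic families are holomorphic. -/
theorem differentiableOn_integral_of_bounded {α : Type*} [MeasurableSpace α] {μ : Measure α}
    [IsFiniteMeasure μ] {F : ℂ → α → ℂ} {U : Set ℂ} (hU : IsOpen U) {C : ℝ}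
    (hmeas : ∀ z ∈ U, AEStronglyMeasurable (F z) μ) (hbound : ∀ z ∈ U, ∀ a, ‖F z a‖ ≤ C)
    (hdiff : ∀ a, DifferentiableOn ℂ (fun z => F z a) U) :
    DifferentiableOn ℂ (fun z => ∫ a, F z a ∂μ) U := by
  intro z₀ hz₀
  obtain ⟨ε, hε, hball⟩ := Metric.isOpen_iff.1 hU z₀ hz₀
  -- The derivative is measurable as a pointwise limit of difference quotients along `1/(n+1)`,
  -- started at `n₀` so that the points stay in `U`.
  have hF' : AEStronglyMeasurable (fun a => deriv (fun z => F z a) z₀) μ := by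
    have hseq : ∀ᶠ n : ℕ in Filter.atTop, z₀ + ((1 / ((n : ℝ) + 1) : ℝ) : ℂ) ∈ U := by
      have ht : Filter.Tendsto (fun n : ℕ => z₀ + ((1 / ((n : ℝ) + 1) : ℝ) : ℂ)) Filter.atTop
          (𝓝 (z₀ + ((0 : ℝ) : ℂ))) :=
        tendsto_const_nhds.add
          ((Complex.continuous_ofReal.tendsto 0).comp tendsto_one_div_add_atTop_nhds_zero_nat)
      exact ht (hU.mem_nhds (by simpa using hz₀))
    obtain ⟨n₀, hn₀⟩ := Filter.eventually_atTop.1 hseq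
    refine aestronglyMeasurable_of_tendsto_ae Filter.atTop
      (f := fun n : ℕ => fun a => ((1 / (((n + n₀ : ℕ) : ℝ) + 1) : ℝ) : ℂ)⁻¹ *
        (F (z₀ + ((1 / (((n + n₀ : ℕ) : ℝ) + 1) : ℝ) : ℂ)) a - F z₀ a))
      (fun n => ((hmeas _ (hn₀ _ (Nat.le_add_left _ _))).sub (hmeas _ hz₀)).const_mul _)
      (Filter.Eventually.of_forall fun a => ?_)
    have hd := ((hdiff a).differentiableAt (hU.mem_nhds hz₀)).hasDerivAt.tendsto_slope_zero
    have hs : Filter.Tendsto (fun n : ℕ => ((1 / (((n + n₀ : ℕ) : ℝ) + 1) : ℝ) : ℂ)) Filter.atTop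
        (𝓝[≠] 0) := by
      refine tendsto_nhdsWithin_iff.2 ⟨?_, Filter.Eventually.of_forall fun n => ?_⟩
      · have := (Complex.continuous_ofReal.tendsto 0).comp
          (tendsto_one_div_add_atTop_nhds_zero_nat.comp (Filter.tendsto_add_atTop_nat n₀))
        simpa [Function.comp_def] using this
      · have : (0 : ℝ) < 1 / (((n + n₀ : ℕ) : ℝ) + 1) := by positivity
        exact Complex.ofReal_ne_zero.2 this.ne'
    simpa only [smul_eq_mul, Function.comp_def] using hd.comp hs
  refine ((hasDerivAt_integral_of_dominated_loc_of_deriv_le (μ := μ) (F := F)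
    (F' := fun z a => deriv (fun z => F z a) z) (bound := fun _ => C / (ε / 2))
    (Metric.ball_mem_nhds z₀ (half_pos hε)) ?_ ?_ hF' ?_ (integrable_const _)
    ?_).2).differentiableAt.differentiableWithinAt
  · filter_upwards [hU.mem_nhds hz₀] with z hz using hmeas z hz
  · exact Integrable.of_bound (hmeas z₀ hz₀) C (Filter.Eventually.of_forall (hbound z₀ hz₀))
  · refine Filter.Eventually.of_forall fun a z hz => ?_
    have hsub : Metric.closedBall z (ε / 2) ⊆ U := fun w hw => hball (by
      rw [Metric.mem_closedBall] at hw
      rw [Metric.mem_ball] at hz ⊢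
      linarith [dist_triangle w z z₀])
    refine Complex.norm_deriv_le_of_forall_mem_sphere_norm_le (half_pos hε) ?_
      (fun w hw => hbound w (hsub (Metric.sphere_subset_closedBall hw)) a)
    exact (((hdiff a).mono hsub).mono Metric.closure_ball_subset_closedBall).diffContOnCl
  · refine Filter.Eventually.of_forall fun a z hz => ?_
    exact ((hdiff a).differentiableAt (hU.mem_nhds (hball (Metric.ball_subset_ball
      (by linarith) hz)))).hasDerivAt

theorem isOpen_imStrip (c ρ : ℝ) : IsOpen {z : ℂ | |z.im| * c < ρ} :=
  isOpen_lt (by fun_prop) continuous_const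

/-- A holomorphic function on a horizontal strip that is constant on the real axis is constant. -/
theorem eq_of_eq_on_reals {c ρ : ℝ} (hc : 0 ≤ c) (hρ : 0 < ρ) {f : ℂ → ℂ}
    (hf : DifferentiableOn ℂ f {z : ℂ | |z.im| * c < ρ}) {w : ℂ} (hreal : ∀ r : ℝ, f r = w)
    {z : ℂ} (hz : |z.im| * c < ρ) : f z = w := by
  have hconv : Convex ℝ {z : ℂ | |z.im| * c < ρ} := by
    have h1 : ConvexOn ℝ Set.univ fun z : ℂ => |z.im| * c := by
      have := ((convexOn_norm (E := ℝ) convex_univ).comp_linearMap Complex.imLm).smul hc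
      simpa [Function.comp_def, mul_comm] using this
    simpa using h1.convex_lt ρ
  have h0 : (0 : ℂ) ∈ {z : ℂ | |z.im| * c < ρ} := by simpa using hρ
  refine (hf.analyticOnNhd (isOpen_imStrip c ρ)).eqOn_of_preconnected_of_frequently_eq
    (g := fun _ => w) analyticOnNhd_const hconv.isPreconnected h0 ?_ hz
  -- The identity theorem needs agreement only along a sequence accumulating at an interior point.
  have hs : Filter.Tendsto (fun n : ℕ => ((1 / ((n : ℝ) + 1) : ℝ) : ℂ)) Filter.atTop
      (nhdsWithin 0 {0}ᶜ) := by
    refine tendsto_nhdsWithin_iff.2 ⟨?_, Filter.Eventually.of_forall fun n => ?_⟩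
    · simpa [Function.comp_def] using (Complex.continuous_ofReal.tendsto 0).comp
        tendsto_one_div_add_atTop_nhds_zero_nat
    · have : (0 : ℝ) < 1 / ((n : ℝ) + 1) := by positivity
      exact Complex.ofReal_ne_zero.2 this.ne'
  exact hs.frequently (Filter.Frequently.of_forall fun n => hreal _)

/-! ### Fourier coefficients of functions of `x` -/

/-- The `n`-th Fourier coefficient of a `2π`-periodic function. -/
def spaceCoeff (f : ℝ → ℂ) (n : ℤ) : ℂ :=
  ((2 * Real.pi : ℝ) : ℂ)⁻¹ * ∫ x in Set.Ioc 0 (2 * Real.pi), spaceMode (-n) x * f x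

theorem norm_spaceCoeff_le {f : ℝ → ℂ} {C : ℝ} (hf : ∀ x, ‖f x‖ ≤ C) (n : ℤ) :
    ‖spaceCoeff f n‖ ≤ C := by
  have h := MeasureTheory.norm_setIntegral_le_of_norm_le_const (μ := MeasureTheory.volume)
    (s := Set.Ioc 0 (2 * Real.pi)) (f := fun x => spaceMode (-n) x * f x) (C := C)
    measure_Ioc_lt_top
    (fun x _ => by rw [norm_mul, norm_spaceMode, one_mul]; exact hf x)
  rw [spaceCoeff, norm_mul, norm_inv, Complex.norm_real, Real.norm_of_nonneg Real.two_pi_pos.le]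
  rw [MeasureTheory.measureReal_def, Real.volume_Ioc, ENNReal.toReal_ofReal (by
    linarith [Real.two_pi_pos]), sub_zero] at h
  calc _ ≤ (2 * Real.pi)⁻¹ * (C * (2 * Real.pi)) := by gcongr
    _ = C := by field_simp

theorem spaceCoeff_deriv {f : ℝ → ℂ} (hf : ContDiff ℝ 1 f)
    (hper : ∀ x, f (x + 2 * Real.pi) = f x) (n : ℤ) :
    spaceCoeff (deriv f) n = Complex.I * n * spaceCoeff f n := by
  have h2 : (0 : ℝ) ≤ 2 * Real.pi := Real.two_pi_pos.le
  have hi := intervalIntegral.integral_mul_deriv_eq_deriv_mul (a := 0) (b := 2 * Real.pi)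
    (u := spaceMode (-n)) (v := f) (u' := fun x => Complex.I * ((-n : ℤ) : ℂ) * spaceMode (-n) x)
    (v' := deriv f) (fun x _ => hasDerivAt_spaceMode (-n) x)
    (fun x _ => (hf.differentiable (by simp) x).hasDerivAt)
    ((continuous_const.mul (continuous_spaceMode _)).intervalIntegrable _ _)
    ((hf.continuous_deriv le_rfl).intervalIntegrable _ _)
  have hb : spaceMode (-n) (2 * Real.pi) * f (2 * Real.pi) = spaceMode (-n) 0 * f 0 := by
    rw [← hper 0, ← spaceMode_add_two_pi (-n) 0, zero_add]
  rw [hb, sub_self, zero_sub, intervalIntegral.integral_of_le h2,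
    intervalIntegral.integral_of_le h2] at hi
  rw [spaceCoeff, spaceCoeff, hi, mul_left_comm]
  simp only [mul_assoc, MeasureTheory.integral_const_mul]
  push_cast
  ring

theorem iteratedDeriv_periodic {f : ℝ → ℂ} {c : ℝ} (hper : ∀ x, f (x + c) = f x) (ℓ : ℕ) (x : ℝ) :
    iteratedDeriv ℓ f (x + c) = iteratedDeriv ℓ f x := by
  have h := congrFun (iteratedDeriv_comp_add_const ℓ f c) x
  rw [← h]
  congr 1
  ext y
  exact hper y

theorem spaceCoeff_iteratedDeriv {f : ℝ → ℂ} (hf : ContDiff ℝ (⊤ : ℕ∞) f)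
    (hper : ∀ x, f (x + 2 * Real.pi) = f x) (n : ℤ) (ℓ : ℕ) :
    spaceCoeff (iteratedDeriv ℓ f) n = (Complex.I * n) ^ ℓ * spaceCoeff f n := by
  induction ℓ with
  | zero => simp
  | succ ℓ ih =>
    rw [iteratedDeriv_succ, spaceCoeff_deriv ?_ (iteratedDeriv_periodic hper ℓ), ih]
    · ring
    · rw [iteratedDeriv_eq_iterate]
      exact (hf.of_le (by exact_mod_cast le_top)).iterate_deriv' 1 ℓ

/-- `N` integrations by parts, combined with `(1 + |n|)^N ≤ 2^N (1 + |n|^N)`; the second term of the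
bound needs the derivative, the first only the function. -/
theorem norm_spaceCoeff_mul_pow_le {f : ℝ → ℂ} (hf : ContDiff ℝ (⊤ : ℕ∞) f)
    (hper : ∀ x, f (x + 2 * Real.pi) = f x) {N : ℕ} {C₀ C : ℝ} (h₀ : ∀ x, ‖f x‖ ≤ C₀)
    (hN : ∀ x, ‖iteratedDeriv N f x‖ ≤ C) (n : ℤ) :
    ‖spaceCoeff f n‖ * (1 + |(n : ℝ)|) ^ N ≤ 2 ^ N * (C₀ + C) := by
  have h1 := norm_spaceCoeff_le h₀ n
  have h2 := norm_spaceCoeff_le hN n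
  rw [spaceCoeff_iteratedDeriv hf hper, norm_mul, norm_pow, norm_mul, Complex.norm_I, one_mul,
    Complex.norm_intCast] at h2
  have hp : (1 + |(n : ℝ)|) ^ N ≤ 2 ^ N * (1 + |(n : ℝ)| ^ N) := by
    rcases le_total |(n : ℝ)| 1 with h | h
    · calc (1 + |(n : ℝ)|) ^ N ≤ 2 ^ N := by gcongr; linarith
        _ ≤ 2 ^ N * (1 + |(n : ℝ)| ^ N) := le_mul_of_one_le_right (by positivity) (by
          have := pow_nonneg (abs_nonneg (n : ℝ)) N; linarith)
    · calc (1 + |(n : ℝ)|) ^ N ≤ (2 * |(n : ℝ)|) ^ N := by gcongr; linarith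
        _ = 2 ^ N * |(n : ℝ)| ^ N := mul_pow _ _ _
        _ ≤ _ := by gcongr; linarith
  calc _ ≤ ‖spaceCoeff f n‖ * (2 ^ N * (1 + |(n : ℝ)| ^ N)) := by gcongr
    _ = 2 ^ N * (‖spaceCoeff f n‖ + |(n : ℝ)| ^ N * ‖spaceCoeff f n‖) := by ring
    _ ≤ _ := by gcongr

theorem hasSum_spaceCoeff {f : ℝ → ℂ} (hf : Continuous f) (hper : ∀ x, f (x + 2 * Real.pi) = f x)
    (hs : Summable (spaceCoeff f)) (x : ℝ) :
    HasSum (fun n => spaceCoeff f n * spaceMode n x) (f x) := by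
  have : Fact (0 < 2 * Real.pi) := ⟨Real.two_pi_pos⟩
  have hp : Function.Periodic f (2 * Real.pi) := hper
  have hcont : Continuous hp.lift :=
    isQuotientMap_quotient_mk'.continuous_iff.2 hf
  let F : C(AddCircle (2 * Real.pi), ℂ) := ⟨hp.lift, hcont⟩
  have hmode : ∀ (n : ℤ) (y : ℝ), fourier n (y : AddCircle (2 * Real.pi)) = spaceMode n y := by
    intro n y
    rw [fourier_coe_apply, spaceMode]
    congr 1
    have : (Real.pi : ℂ) ≠ 0 := by exact_mod_cast Real.pi_ne_zero
    push_cast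
    field_simp
  have hcoef : fourierCoeff F = spaceCoeff f := by
    ext n
    rw [fourierCoeff_eq_intervalIntegral F n 0, zero_add,
      intervalIntegral.integral_of_le Real.two_pi_pos.le, spaceCoeff]
    simp only [hmode, smul_eq_mul, one_div, Complex.real_smul, Complex.ofReal_inv]
    rfl
  have := has_pointwise_sum_fourier_series_of_summable (f := F) (hcoef ▸ hs) x
  simp only [hmode, hcoef, smul_eq_mul] at this
  exact this

/-! ### Fourier coefficients of functions of the angles -/

/-- The box `(a, a + 1]^ν`. -/
def unitBox (a : Fin ν → ℝ) : Set (Fin ν → ℝ) := {t | ∀ i, t i ∈ Set.Ioc (a i) (a i + 1)}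

theorem unitBox_eq_pi (a : Fin ν → ℝ) :
    unitBox a = Set.pi Set.univ fun i => Set.Ioc (a i) (a i + 1) := by
  ext t
  simp [unitBox]

theorem measurableSet_unitBox (a : Fin ν → ℝ) : MeasurableSet (unitBox a) := by
  rw [unitBox_eq_pi]
  exact MeasurableSet.univ_pi fun _ => measurableSet_Ioc

theorem volume_unitBox (a : Fin ν → ℝ) : MeasureTheory.volume (unitBox a) = 1 := by
  rw [unitBox_eq_pi, Real.volume_pi_Ioc]
  simp

instance (a : Fin ν → ℝ) :
    MeasureTheory.IsProbabilityMeasure (MeasureTheory.volume.restrict (unitBox a)) :=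
  ⟨by rw [MeasureTheory.Measure.restrict_apply_univ, volume_unitBox]⟩

/-- The function on the torus `ℝ^ν / ℤ^ν` induced by a periodic function on `ℝ^ν`. -/
def descend (p : (Fin ν → ℝ) → ℂ) : UnitAddTorus (Fin ν) → ℂ :=
  fun x => p fun i => (AddCircle.equivIoc 1 0 (x i)).1

theorem descend_coe {p : (Fin ν → ℝ) → ℂ} (hp : ∀ (k : Fin ν → ℤ) t, p (fun i => t i + k i) = p t)
    (t : Fin ν → ℝ) : descend p (fun i => (t i : UnitAddCircle)) = p t := by
  have h : ∀ i, ∃ k : ℤ, (AddCircle.equivIoc 1 0 ((t i : ℝ) : UnitAddCircle)).1 = t i + k := by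
    intro i
    have h1 : (((AddCircle.equivIoc (1 : ℝ) 0 ((t i : ℝ) : UnitAddCircle)).1 - t i : ℝ) :
        UnitAddCircle) = 0 := by
      rw [AddCircle.coe_sub, AddCircle.coe_equivIoc, sub_self]
    obtain ⟨k, hk⟩ := AddCircle.coe_eq_zero_iff _ |>.1 h1
    exact ⟨k, by rw [zsmul_eq_mul, mul_one] at hk; linarith⟩
  choose k hk using h
  rw [descend]
  simp only [hk]
  exact hp k t

theorem continuous_descend {p : (Fin ν → ℝ) → ℂ}
    (hp : ∀ (k : Fin ν → ℤ) t, p (fun i => t i + k i) = p t) (hc : Continuous p) :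
    Continuous (descend p) := by
  have hq : IsOpenQuotientMap (fun (t : Fin ν → ℝ) i => ((t i : ℝ) : UnitAddCircle)) :=
    IsOpenQuotientMap.piMap fun _ => QuotientAddGroup.isOpenQuotientMap_mk
  rw [hq.isQuotientMap.continuous_iff]
  exact hc.congr fun t => (descend_coe hp t).symm

/-- Any two unit boxes are fundamental domains of the same torus. -/
theorem integral_unitBox_eq {p : (Fin ν → ℝ) → ℂ}
    (hp : ∀ (k : Fin ν → ℤ) t, p (fun i => t i + k i) = p t) (a b : Fin ν → ℝ) :
    ∫ t in unitBox a, p t = ∫ t in unitBox b, p t := by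
  have := (UnitAddTorus.integral_preimage (descend p) a).symm.trans
    (UnitAddTorus.integral_preimage (descend p) b)
  simp only [descend_coe hp] at this
  exact this

theorem integral_unitBox_translate {p : (Fin ν → ℝ) → ℂ}
    (hp : ∀ (k : Fin ν → ℤ) t, p (fun i => t i + k i) = p t) (c : Fin ν → ℝ) :
    ∫ t in unitBox 0, p (t + c) = ∫ t in unitBox 0, p t := by
  have hpre : unitBox (0 : Fin ν → ℝ) = (fun t => t + c) ⁻¹' unitBox c := by
    ext t
    simp [unitBox, add_comm]
  rw [hpre, (MeasureTheory.measurePreserving_add_right MeasureTheory.volume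
    c).setIntegral_preimage_emb (measurableEmbedding_addRight c), ← hpre]
  exact integral_unitBox_eq hp c 0

/-- The `k`-th Fourier coefficient of a function of the angles. -/
def angleCoeff (g : (Fin ν → ℂ) → ℂ) (k : Fin ν → ℤ) : ℂ :=
  ∫ t in unitBox (0 : Fin ν → ℝ), angleMode (-k) (toComplex fun i => 2 * Real.pi * t i) *
    g (toComplex fun i => 2 * Real.pi * t i)

theorem angleMode_two_pi (k : Fin ν → ℤ) (t : Fin ν → ℝ) :
    angleMode k (toComplex fun i => 2 * Real.pi * t i) =
      UnitAddTorus.mFourier k (fun i => (t i : UnitAddCircle)) := by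
  simp only [angleMode, phase, toComplex, UnitAddTorus.mFourier, ContinuousMap.coe_mk,
    fourier_coe_apply]
  rw [← Complex.exp_sum, Finset.mul_sum]
  congr 1
  refine Finset.sum_congr rfl fun i _ => ?_
  push_cast
  ring

/-- Functions of the angles that are `2π`-periodic on the reals. -/
def AnglePeriodic (g : (Fin ν → ℂ) → ℂ) : Prop :=
  ∀ (k : Fin ν → ℤ) (θ : Fin ν → ℝ),
    g (toComplex fun i => θ i + 2 * Real.pi * k i) = g (toComplex θ)

theorem AnglePeriodic.unit {g : (Fin ν → ℂ) → ℂ} (hg : AnglePeriodic g) (k : Fin ν → ℤ)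
    (t : Fin ν → ℝ) : g (toComplex fun i => 2 * Real.pi * (t i + k i)) =
      g (toComplex fun i => 2 * Real.pi * t i) := by
  simpa only [mul_add] using hg k fun i => 2 * Real.pi * t i

theorem hasSum_angleCoeff {g : (Fin ν → ℂ) → ℂ} (hg : Continuous fun θ => g (toComplex θ))
    (hper : AnglePeriodic g) (hs : Summable (angleCoeff g)) (θ : Fin ν → ℝ) :
    HasSum (fun k => angleCoeff g k * angleMode k (toComplex θ)) (g (toComplex θ)) := by
  set p : (Fin ν → ℝ) → ℂ := fun t => g (toComplex fun i => 2 * Real.pi * t i) with hp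
  have hpp : ∀ (k : Fin ν → ℤ) t, p (fun i => t i + k i) = p t := fun k t => hper.unit k t
  have hpc : Continuous p := hg.comp (by fun_prop : Continuous fun (t : Fin ν → ℝ) i =>
    2 * Real.pi * t i)
  let F : C(UnitAddTorus (Fin ν), ℂ) := ⟨descend p, continuous_descend hpp hpc⟩
  have hcoef : UnitAddTorus.mFourierCoeff F = angleCoeff g := by
    ext k
    rw [UnitAddTorus.mFourierCoeff_eq_integral F k 0, angleCoeff]
    refine MeasureTheory.setIntegral_congr_fun (measurableSet_unitBox 0) fun t _ => ?_
    simp only [angleMode_two_pi, smul_eq_mul]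
    congr 1
    exact descend_coe hpp t
  have := UnitAddTorus.hasSum_mFourier_series_apply_of_summable (f := F) (hcoef ▸ hs)
    (fun i => ((θ i / (2 * Real.pi) : ℝ) : UnitAddCircle))
  have hθ : (fun i => 2 * Real.pi * (θ i / (2 * Real.pi))) = θ := by
    ext i
    field_simp
  simp only [hcoef, smul_eq_mul, ← angleMode_two_pi, hθ] at this
  convert! this using 1
  have h2 := descend_coe hpp fun i => θ i / (2 * Real.pi)
  simp only [hp, hθ] at h2
  exact h2.symm

theorem phase_add (k : Fin ν → ℤ) (θ η : Fin ν → ℂ) : phase k (θ + η) = phase k θ + phase k η := by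
  simp [phase, mul_add, Finset.sum_add_distrib]

theorem imNorm_toComplex_add_smul (θ : Fin ν → ℝ) (z : ℂ) (η : Fin ν → ℝ) :
    imNorm (toComplex θ + z • toComplex η) = |z.im| * Real.sqrt (∑ i, η i ^ 2) := by
  have : ∀ i, ((toComplex θ + z • toComplex η) i).im = z.im * η i := by
    intro i
    simp [toComplex]
  simp only [imNorm, this, mul_pow, ← Finset.mul_sum]
  rw [Real.sqrt_mul (sq_nonneg _), Real.sqrt_sq_eq_abs]

/-- Exponential decay of the Fourier coefficients of functions that are analytic in a strip. -/
theorem norm_angleCoeff_le {ρ σ C : ℝ} (hσ : 0 ≤ σ) (hσρ : σ < ρ) {g : (Fin ν → ℂ) → ℂ}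
    (hC : ∀ θ ∈ openStrip ν ρ, ‖g θ‖ ≤ C) (hcont : ContinuousOn g (openStrip ν ρ))
    (hline : ∀ θ η : Fin ν → ℝ, DifferentiableOn ℂ (fun z : ℂ => g (toComplex θ + z • toComplex η))
      {z | |z.im| * Real.sqrt (∑ i, η i ^ 2) < ρ})
    (hper : AnglePeriodic g) (k : Fin ν → ℤ) :
    ‖angleCoeff g k‖ ≤ C * Real.exp (-(σ * waveLen k)) := by
  -- The direction of the imaginary shift: of length at most `σ` and opposite to `k`, so that
  -- `e^{-ik·θ}` acquires the factor `e^{-σ|k|}`. For `k = 0` the division by zero gives `η = 0` and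
  -- no decay is claimed.
  set η : Fin ν → ℝ := fun i => -(σ / waveLen k) * k i with hη
  have hηn : Real.sqrt (∑ i, η i ^ 2) ≤ σ := by
    have : ∑ i, η i ^ 2 = (σ / waveLen k) ^ 2 * ∑ i, (k i : ℝ) ^ 2 := by
      simp [hη, mul_pow, Finset.mul_sum]
    rw [this, Real.sqrt_mul (sq_nonneg _), Real.sqrt_sq (div_nonneg hσ (waveLen_nonneg k))]
    change σ / waveLen k * waveLen k ≤ σ
    rcases eq_or_ne (waveLen k) 0 with h0 | h0
    · simpa [h0] using hσ
    · rw [div_mul_cancel₀ _ h0]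
  have hphase : phase k (toComplex η) = ((-(σ * waveLen k) : ℝ) : ℂ) := by
    have h2 : phase k (toComplex η) = ((-(σ / waveLen k) * ∑ i, (k i : ℝ) ^ 2 : ℝ) : ℂ) := by
      simp only [phase, toComplex, hη, Finset.mul_sum]
      push_cast
      exact Finset.sum_congr rfl fun i _ => by ring
    rw [h2, ← Real.sq_sqrt (Finset.sum_nonneg fun i _ => sq_nonneg ((k i : ℤ) : ℝ))]
    change ((-(σ / waveLen k) * waveLen k ^ 2 : ℝ) : ℂ) = _
    congr 1
    rcases eq_or_ne (waveLen k) 0 with h0 | h0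
    · simp [h0]
    · field_simp
  set P : (Fin ν → ℂ) → ℂ := fun θ => angleMode (-k) θ * g θ with hP
  set U : Set ℂ := {z | |z.im| * Real.sqrt (∑ i, η i ^ 2) < ρ} with hU
  have hmem : ∀ z ∈ U, ∀ θ : Fin ν → ℝ, toComplex θ + z • toComplex η ∈ openStrip ν ρ := by
    intro z hz θ
    change imNorm _ < ρ
    rw [imNorm_toComplex_add_smul]
    exact hz
  have hdiff : DifferentiableOn ℂ (fun z : ℂ => ∫ t in unitBox (0 : Fin ν → ℝ),
      P (toComplex (fun i => 2 * Real.pi * t i) + z • toComplex η)) U := by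
    refine differentiableOn_integral_of_bounded (isOpen_imStrip _ _)
      (C := Real.exp (ρ * waveLen k) * C) (fun z hz => ?_) (fun z hz t => ?_) fun t => ?_
    · refine Continuous.aestronglyMeasurable ?_
      have hc : Continuous fun t : Fin ν → ℝ =>
          toComplex (fun i => 2 * Real.pi * t i) + z • toComplex η := by
        refine Continuous.add (continuous_pi fun i => ?_) continuous_const
        simp only [toComplex]
        fun_prop
      refine Continuous.mul ?_ (hcont.comp_continuous hc fun t => hmem z hz _)
      simp only [angleMode, phase]
      fun_prop
    · rw [hP, norm_mul]
      have h1 := norm_angleMode_le (-k) (le_of_lt (hmem z hz fun i => 2 * Real.pi * t i))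
      rw [waveLen_neg] at h1
      exact mul_le_mul h1 (hC _ (hmem z hz _)) (norm_nonneg _) (Real.exp_nonneg _)
    · refine DifferentiableOn.mul ?_ (hline _ _)
      simp only [angleMode, phase, Pi.add_apply, Pi.smul_apply, smul_eq_mul]
      fun_prop
  -- The shift of contour is done in one variable: the integral is holomorphic in `z`, constant for
  -- real `z` by translation invariance on the torus, hence constant, and it is evaluated at `z =
  -- i`.
  have hconst : ∀ z ∈ U, ∫ t in unitBox (0 : Fin ν → ℝ),
      P (toComplex (fun i => 2 * Real.pi * t i) + z • toComplex η) = angleCoeff g k := by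
    intro z hz
    refine eq_of_eq_on_reals (Real.sqrt_nonneg _) (hσ.trans_lt hσρ) hdiff (fun r => ?_) hz
    have hper' : ∀ (l : Fin ν → ℤ) (t : Fin ν → ℝ),
        (fun t : Fin ν → ℝ => P (toComplex fun i => 2 * Real.pi * t i)) (fun i => t i + l i) =
        (fun t : Fin ν → ℝ => P (toComplex fun i => 2 * Real.pi * t i)) t := by
      intro l t
      simp only [hP]
      rw [hper.unit l t]
      congr 1
      refine Eq.trans ?_ (angleMode_shift (-k) l _)
      congr 1
      ext i
      simp only [shift, toComplex]
      push_cast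
      ring
    have := integral_unitBox_translate
      (p := fun t : Fin ν → ℝ => P (toComplex fun i => 2 * Real.pi * t i)) hper'
      fun i => r * η i / (2 * Real.pi)
    refine Eq.trans ?_ this
    congr 1
    ext t
    congr 1
    ext i
    simp only [toComplex, Pi.add_apply, Pi.smul_apply, smul_eq_mul]
    have : (Real.pi : ℂ) ≠ 0 := by exact_mod_cast Real.pi_ne_zero
    push_cast
    field_simp
  have hI : Complex.I ∈ U := by
    change |Complex.I.im| * _ < ρ
    rw [Complex.I_im, abs_one, one_mul]
    exact hηn.trans_lt hσρ
  rw [← hconst _ hI]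
  have hb := MeasureTheory.norm_setIntegral_le_of_norm_le_const (μ := MeasureTheory.volume)
    (s := unitBox (0 : Fin ν → ℝ))
    (f := fun t => P (toComplex (fun i => 2 * Real.pi * t i) + Complex.I • toComplex η))
    (C := C * Real.exp (-(σ * waveLen k))) (by rw [volume_unitBox]; exact ENNReal.one_lt_top)
    (fun t _ => ?_)
  · simpa [MeasureTheory.measureReal_def, volume_unitBox] using hb
  · rw [hP, norm_mul, mul_comm C]
    refine mul_le_mul (le_of_eq ?_) (hC _ (hmem _ hI _)) (norm_nonneg _) (Real.exp_nonneg _)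
    have hneg : ∀ θ : Fin ν → ℂ, phase (-k) θ = -phase k θ := fun θ => by simp [phase]
    have hsm : phase k (Complex.I • toComplex η) = Complex.I * phase k (toComplex η) := by
      simp only [phase, Pi.smul_apply, smul_eq_mul, Finset.mul_sum]
      exact Finset.sum_congr rfl fun i _ => by ring
    have hre : (phase k (toComplex fun i => 2 * Real.pi * t i)).im = 0 := by
      simp [phase, toComplex]
    rw [norm_angleMode, hneg, phase_add, hsm, hphase]
    simp only [Complex.neg_im, Complex.add_im, hre, Complex.I_mul_im, Complex.ofReal_re]
    ring_nf

/-! ### Summability over the lattice -/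

/-- The `k` are the points of the lattice spanned by the standard orthonormal basis, over which
powers of the norm below minus the rank are summable. The origin, where norm and bracket are not
comparable, is discarded. -/
theorem summable_bracket_waveLen {s : ℝ} (hs : (ν : ℝ) < s) :
    Summable fun k : Fin ν → ℤ => bracket (waveLen k) ^ (-s) := by
  set b := (EuclideanSpace.basisFun (Fin ν) ℝ).toBasis with hb
  set L := Submodule.span ℤ (Set.range b) with hL
  have hrank : Module.finrank ℤ L = ν := by
    rw [ZLattice.rank ℝ L, finrank_euclideanSpace_fin]
  have h := ZLattice.summable_norm_rpow L (-s) (by rw [hrank]; linarith)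
  have hmem : ∀ k : Fin ν → ℤ,
      (WithLp.toLp 2 fun i => (k i : ℝ) : EuclideanSpace ℝ (Fin ν)) ∈ L := by
    intro k
    have : (WithLp.toLp 2 fun i => (k i : ℝ) : EuclideanSpace ℝ (Fin ν)) = ∑ i, k i • b i := by
      ext j
      simp [hb, Finset.sum_apply, Pi.single_apply]
    rw [this]
    exact Submodule.sum_mem _ fun i _ => Submodule.smul_mem _ _ (Submodule.subset_span ⟨i, rfl⟩)
  have hinj : Function.Injective fun k : Fin ν → ℤ => (⟨_, hmem k⟩ : L) := by
    intro k l hkl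
    have h1 := congrArg (fun w : L => (w : EuclideanSpace ℝ (Fin ν))) hkl
    ext i
    have h2 : (k i : ℝ) = l i := congrArg (fun w : EuclideanSpace ℝ (Fin ν) => w i) h1
    exact_mod_cast h2
  have h' := h.comp_injective hinj
  refine Summable.of_norm_bounded_eventually h' ?_
  have hfin : ({0} : Set (Fin ν → ℤ))ᶜ ∈ Filter.cofinite := by
    simp [Filter.mem_cofinite]
  filter_upwards [hfin] with k hk
  have hk0 : k ≠ 0 := hk
  have hpos : 0 < waveLen k := by
    rw [waveLen_eq_norm, norm_pos_iff]
    intro h0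
    apply hk0
    ext i
    have h2 : (k i : ℝ) = 0 := congrArg (fun w : EuclideanSpace ℝ (Fin ν) => w i) h0
    exact_mod_cast h2
  rw [Real.norm_of_nonneg (Real.rpow_nonneg (bracket_pos _).le _)]
  have : ‖(⟨_, hmem k⟩ : L)‖ = waveLen k := (waveLen_eq_norm k).symm
  simp only [Function.comp_apply, this]
  exact Real.rpow_le_rpow_of_nonpos hpos ((le_abs_self _).trans (abs_le_bracket _))
    (by have := Nat.cast_nonneg (α := ℝ) ν; linarith)

theorem bracket_le_one_add {x : ℝ} (hx : 0 ≤ x) : bracket x ≤ 1 + x := by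
  rw [bracket]
  exact Real.sqrt_le_iff.2 ⟨by linarith, by nlinarith⟩

theorem exists_pow_mul_exp_neg_le (N : ℕ) {δ : ℝ} (hδ : 0 < δ) :
    ∃ C > 0, ∀ x : ℝ, 0 ≤ x → (1 + x) ^ N * Real.exp (-(δ * x)) ≤ C := by
  refine ⟨N.factorial / δ ^ N * Real.exp δ, by positivity, fun x hx => ?_⟩
  have h := Real.pow_div_factorial_le_exp (δ * (1 + x)) (by positivity) N
  rw [mul_pow, div_le_iff₀ (by positivity)] at h
  have he : Real.exp (δ * (1 + x)) = Real.exp δ * Real.exp (δ * x) := by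
    rw [← Real.exp_add]; congr 1; ring
  rw [he] at h
  rw [Real.exp_neg, ← div_eq_mul_inv, div_le_iff₀ (Real.exp_pos _), div_mul_eq_mul_div,
    div_mul_eq_mul_div, le_div_iff₀ (by positivity)]
  linarith

theorem summable_exp_waveLen {δ : ℝ} (hδ : 0 < δ) :
    Summable fun k : Fin ν → ℤ => Real.exp (-(δ * waveLen k)) := by
  obtain ⟨C, hC, hle⟩ := exists_pow_mul_exp_neg_le (ν + 1) hδ
  refine Summable.of_nonneg_of_le (fun k => (Real.exp_pos _).le) (fun k => ?_)
    ((summable_bracket_waveLen (ν := ν) (s := ((ν + 1 : ℕ) : ℝ))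
      (by push_cast; linarith)).mul_left C)
  have h1 := hle _ (waveLen_nonneg k)
  have h2 := bracket_pos (waveLen k)
  rw [Real.rpow_neg h2.le, Real.rpow_natCast, ← div_eq_mul_inv, le_div_iff₀ (by positivity),
    mul_comm]
  refine le_trans ?_ h1
  gcongr
  exact bracket_le_one_add (waveLen_nonneg k)

theorem summable_one_add_abs : Summable fun n : ℤ => ((1 + |(n : ℝ)|) ^ 2)⁻¹ := by
  have h : Summable fun n : ℤ => 2 * (1 / (n : ℝ) ^ 2) + if n = 0 then (1 : ℝ) else 0 :=
    (((Real.summable_one_div_int_pow (p := 2)).2 one_lt_two).mul_left 2).add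
      (summable_of_hasFiniteSupport (Set.Finite.subset (Set.finite_singleton 0) (by
        intro n hn
        by_contra h
        exact hn (if_neg h))))
  refine Summable.of_nonneg_of_le (fun n => by positivity) (fun n => ?_) h
  rcases eq_or_ne n 0 with rfl | hn
  · simp
  · have h1 : (0 : ℝ) < |(n : ℝ)| := abs_pos.2 (by exact_mod_cast hn)
    rw [if_neg hn, add_zero, ← sq_abs (n : ℝ), inv_eq_one_div]
    calc 1 / (1 + |(n : ℝ)|) ^ 2 ≤ 1 / |(n : ℝ)| ^ 2 := by gcongr; linarith
      _ ≤ _ := by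
        have : 0 ≤ 1 / |(n : ℝ)| ^ 2 := by positivity
        linarith

theorem summable_modes {δ : ℝ} (hδ : 0 < δ) :
    Summable fun g : Modes ν => Real.exp (-(δ * waveLen g.1)) * ((1 + |(g.2 : ℝ)|) ^ 2)⁻¹ :=
  (summable_exp_waveLen hδ).mul_of_nonneg summable_one_add_abs (fun _ => (Real.exp_pos _).le)
    fun _ => by positivity

/-! ### Fourier coefficients of the driving -/

theorem evenExt_add_two_pi (V : (Fin ν → ℝ) → ℝ → ℝ) (θ : Fin ν → ℝ) (x : ℝ) :
    evenExt V θ (x + 2 * Real.pi) = evenExt V θ x := by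
  simp [evenExt]

theorem evenExt_neg (V : (Fin ν → ℝ) → ℝ → ℝ) (θ : Fin ν → ℝ) (x : ℝ) :
    evenExt V θ (-x) = evenExt V θ x := by
  simp [evenExt]

theorem toComplex_mem_openStrip {ρ : ℝ} (hρ : 0 < ρ) (θ : Fin ν → ℝ) :
    toComplex θ ∈ openStrip ν ρ := by
  simpa [openStrip, imNorm, toComplex] using hρ

theorem eq_re_add_I_smul_im (θ : Fin ν → ℂ) :
    θ = toComplex (fun i => (θ i).re) + Complex.I • toComplex (fun i => (θ i).im) := by
  ext i
  simp [toComplex, Complex.re_add_im, mul_comm Complex.I]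

theorem differentiableOn_line {ρ : ℝ} {f : (Fin ν → ℂ) → ℂ}
    (hf : DifferentiableOn ℂ f (openStrip ν ρ)) (θ η : Fin ν → ℝ) :
    DifferentiableOn ℂ (fun z : ℂ => f (toComplex θ + z • toComplex η))
      {z | |z.im| * Real.sqrt (∑ i, η i ^ 2) < ρ} := by
  refine hf.comp (f := fun z : ℂ => toComplex θ + z • toComplex η) (by fun_prop) fun z hz => ?_
  change imNorm _ < ρ
  rw [imNorm_toComplex_add_smul]
  exact hz

/-- A function that is holomorphic in a strip and constant on the real angles is constant. -/
theorem eq_of_eq_on_real_angles {ρ : ℝ} (hρ : 0 < ρ) {f : (Fin ν → ℂ) → ℂ}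
    (hf : DifferentiableOn ℂ f (openStrip ν ρ)) {w : ℂ} (hw : ∀ θ : Fin ν → ℝ, f (toComplex θ) = w)
    {θ : Fin ν → ℂ} (hθ : θ ∈ openStrip ν ρ) : f θ = w := by
  rw [eq_re_add_I_smul_im θ]
  refine eq_of_eq_on_reals (Real.sqrt_nonneg _) hρ (differentiableOn_line hf _ _) (fun r => ?_)
    (by simpa [openStrip, imNorm] using hθ)
  rw [← hw fun i => (θ i).re + r * (θ i).im]
  congr 1
  ext i
  simp [toComplex]

theorem spaceCoeff_neg {f : ℝ → ℂ} (hper : ∀ x, f (x + 2 * Real.pi) = f x)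
    (heven : ∀ x, f (-x) = f x) (n : ℤ) : spaceCoeff f (-n) = spaceCoeff f n := by
  have hp : Function.Periodic (fun x => spaceMode (-n) x * f x) (2 * Real.pi) := fun x => by
    change _ * _ = _ * _
    rw [spaceMode_add_two_pi, hper]
  have h1 := hp.intervalIntegral_add_eq (-(2 * Real.pi)) 0
  rw [neg_add_cancel, zero_add] at h1
  have h2 := intervalIntegral.integral_comp_neg (a := 0) (b := 2 * Real.pi)
    fun x => spaceMode (-n) x * f x
  rw [neg_zero, h1] at h2
  rw [spaceCoeff, spaceCoeff, ← intervalIntegral.integral_of_le Real.two_pi_pos.le,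
    ← intervalIntegral.integral_of_le Real.two_pi_pos.le, ← h2]
  congr 2
  ext x
  rw [heven]
  congr 1
  simp [spaceMode]

theorem conj_spaceCoeff_neg (f : ℝ → ℂ) (hreal : ∀ x, starRingEnd ℂ (f x) = f x) (n : ℤ) :
    starRingEnd ℂ (spaceCoeff f (-n)) = spaceCoeff f n := by
  rw [spaceCoeff, spaceCoeff, map_mul, map_inv₀, Complex.conj_ofReal, ← integral_conj]
  congr 2
  ext x
  rw [map_mul, hreal]
  congr 1
  simp [spaceMode, ← Complex.exp_conj]

theorem conj_angleCoeff_neg {g h : (Fin ν → ℂ) → ℂ}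
    (hgh : ∀ θ : Fin ν → ℝ, starRingEnd ℂ (g (toComplex θ)) = h (toComplex θ)) (k : Fin ν → ℤ) :
    starRingEnd ℂ (angleCoeff g (-k)) = angleCoeff h k := by
  rw [angleCoeff, angleCoeff, ← integral_conj]
  congr 1
  ext t
  rw [map_mul, hgh, conj_angleMode_real, neg_neg]

open Pointwise in
theorem integral_unitBox_evenExt {V : (Fin ν → ℝ) → ℝ → ℝ} (h0 : ZeroAverage V) (x : ℝ) :
    ∫ t in unitBox (0 : Fin ν → ℝ), evenExt V (fun i => 2 * Real.pi * t i) x = 0 := by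
  have h := MeasureTheory.Measure.setIntegral_comp_smul (MeasureTheory.volume)
    (fun θ : Fin ν → ℝ => evenExt V θ x) (R := 2 * Real.pi) (s := unitBox (0 : Fin ν → ℝ))
    Real.two_pi_pos.ne'
  have hs : (2 * Real.pi) • unitBox (0 : Fin ν → ℝ) =
      Set.pi Set.univ fun _ => Set.Ioc 0 (2 * Real.pi) := by
    ext t
    rw [Set.mem_smul_set_iff_inv_smul_mem₀ Real.two_pi_pos.ne', unitBox_eq_pi, Set.mem_univ_pi,
      Set.mem_univ_pi]
    refine forall_congr' fun i => ?_
    simp only [Pi.smul_apply, smul_eq_mul, Pi.zero_apply, zero_add, Set.mem_Ioc]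
    rw [inv_mul_le_iff₀ Real.two_pi_pos, mul_one]
    refine and_congr_left fun _ => ?_
    exact mul_pos_iff_of_pos_left (inv_pos.2 Real.two_pi_pos)
  rw [hs] at h
  -- The zero average is stated on the closed box; it differs from the half-open one by a null set.
  have hae := MeasureTheory.Measure.univ_pi_Ioc_ae_eq_Icc (μ := fun _ : Fin ν =>
    (MeasureTheory.volume : MeasureTheory.Measure ℝ)) (f := fun _ => 0) (g := fun _ => 2 * Real.pi)
  have h3 : ∫ θ in Set.pi Set.univ fun _ : Fin ν => Set.Ioc 0 (2 * Real.pi), evenExt V θ x = 0 := by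
    refine (MeasureTheory.setIntegral_congr_set hae).trans ?_
    exact h0 _ ⟨Real.arccos_nonneg _, Real.arccos_le_pi _⟩
  rw [h3, smul_zero] at h
  exact h

open MeasureTheory in
theorem integral_unitBox_spaceCoeff {V : (Fin ν → ℝ) → ℝ → ℝ} (h0 : ZeroAverage V)
    (hcont : Continuous fun p : (Fin ν → ℝ) × ℝ => evenExt V p.1 p.2) {C : ℝ}
    (hC : ∀ θ x, |evenExt V θ x| ≤ C) (n : ℤ) :
    ∫ t in unitBox (0 : Fin ν → ℝ),
      spaceCoeff (fun x => (evenExt V (fun i => 2 * Real.pi * t i) x : ℂ)) n = 0 := by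
  simp only [spaceCoeff]
  rw [integral_const_mul, integral_integral_swap]
  · have h : ∀ x : ℝ, ∫ t in unitBox (0 : Fin ν → ℝ),
        spaceMode (-n) x * (evenExt V (fun i => 2 * Real.pi * t i) x : ℂ) = 0 := by
      intro x
      rw [integral_const_mul]
      have h1 : ∫ t in unitBox (0 : Fin ν → ℝ),
          (evenExt V (fun i => 2 * Real.pi * t i) x : ℂ) = 0 := by
        rw [integral_complex_ofReal, integral_unitBox_evenExt h0, Complex.ofReal_zero]
      rw [h1, mul_zero]
    simp only [h, integral_zero, mul_zero]
  · refine Integrable.of_bound (C := C) (Continuous.aestronglyMeasurable ?_)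
      (Filter.Eventually.of_forall fun p => ?_)
    · refine Continuous.mul ((continuous_spaceMode _).comp continuous_snd)
        (Complex.continuous_ofReal.comp ?_)
      exact hcont.comp (f := fun p : (Fin ν → ℝ) × ℝ => ((fun i => 2 * Real.pi * p.1 i), p.2))
        (by fun_prop)
    · simp only [Function.uncurry]
      rw [norm_mul, norm_spaceMode, one_mul, Complex.norm_real]
      exact hC _ _

/-- The driving is the sum of a Fourier series with coefficients that decay exponentially in the
angular modes and rapidly in the space modes. -/
theorem exists_modes_of_analyticDriving {ρ σ : ℝ} (hσ : 0 < σ) (hσρ : σ < ρ)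
    {V : (Fin ν → ℝ) → ℝ → ℝ} (hV : AnalyticDriving ρ V) (h0 : ZeroAverage V) :
    ∃ v : Modes ν → ℂ,
      (∀ N : ℕ, ∃ C : ℝ, 0 ≤ C ∧ ∀ g,
        ‖v g‖ * (1 + |(g.2 : ℝ)|) ^ N ≤ C * Real.exp (-(σ * waveLen g.1))) ∧
      (∀ θ x, HasSum (fun g : Modes ν => v g * (angleMode g.1 (toComplex θ) * spaceMode g.2 x))
        (evenExt V θ x : ℂ)) ∧
      (∀ n, v (0, n) = 0) ∧ (∀ k m, v (k, -m) = v (k, m)) ∧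
      ∀ g, starRingEnd ℂ (v (-g)) = v g := by
  obtain ⟨hper, hsm, Vc, hreal, hhol, hsmx, hbd⟩ := hV
  have hρ : 0 < ρ := hσ.trans hσρ
  -- Periodicity in `x` is known only at real angles and propagates to the strip by the identity
  -- theorem.
  have hperx : ∀ θ ∈ openStrip ν ρ, ∀ x, Vc θ (x + 2 * Real.pi) = Vc θ x := by
    intro θ hθ x
    refine sub_eq_zero.1 (eq_of_eq_on_real_angles hρ
      (f := fun θ => Vc θ (x + 2 * Real.pi) - Vc θ x) ((hhol _).sub (hhol _)) (fun θ => ?_) hθ)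
    rw [hreal, hreal, evenExt_add_two_pi, sub_self]
  obtain ⟨C₀, hC₀, hbd₀⟩ := hbd 0
  simp only [iteratedDeriv_zero] at hbd₀
  have hVreal : ∀ θ : Fin ν → ℝ, Vc (toComplex θ) = fun x => (evenExt V θ x : ℂ) :=
    fun θ => funext fun x => hreal θ x
  -- The expansion is made in `x` at complex angles, and only then in the angles: each coefficient
  -- stays analytic in the strip with bounds decaying rapidly in `n`.
  set c : ℤ → (Fin ν → ℂ) → ℂ := fun n θ => spaceCoeff (Vc θ) n with hc
  have hc_bound : ∀ N : ℕ, ∃ C : ℝ, 0 ≤ C ∧ ∀ θ ∈ openStrip ν ρ, ∀ n : ℤ,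
      ‖c n θ‖ ≤ C * ((1 + |(n : ℝ)|) ^ N)⁻¹ := by
    intro N
    obtain ⟨C, hC, hbdN⟩ := hbd N
    refine ⟨2 ^ N * (C₀ + C), by positivity, fun θ hθ n => ?_⟩
    rw [← div_eq_mul_inv, le_div_iff₀ (by positivity)]
    exact norm_spaceCoeff_mul_pow_le (hsmx θ hθ) (hperx θ hθ) (hbd₀ θ hθ) (hbdN θ hθ) n
  have hmeas : ∀ n : ℤ, ∀ θ ∈ openStrip ν ρ, MeasureTheory.AEStronglyMeasurable
      (fun x => spaceMode (-n) x * Vc θ x)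
      (MeasureTheory.volume.restrict (Set.Ioc 0 (2 * Real.pi))) := fun n θ hθ =>
    ((continuous_spaceMode _).mul (hsmx θ hθ).continuous).aestronglyMeasurable
  have hnorm : ∀ n : ℤ, ∀ θ ∈ openStrip ν ρ, ∀ x, ‖spaceMode (-n) x * Vc θ x‖ ≤ C₀ := by
    intro n θ hθ x
    rw [norm_mul, norm_spaceMode, one_mul]
    exact hbd₀ θ hθ x
  have hc_cont : ∀ n, ContinuousOn (c n) (openStrip ν ρ) := by
    intro n
    refine continuousOn_const.mul (MeasureTheory.continuousOn_of_dominated (bound := fun _ => C₀)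
      (hmeas n) (fun θ hθ => Filter.Eventually.of_forall (hnorm n θ hθ))
      (MeasureTheory.integrable_const _) (Filter.Eventually.of_forall fun x => ?_))
    exact continuousOn_const.mul (hhol x).continuousOn
  have hc_line : ∀ n, ∀ θ η : Fin ν → ℝ,
      DifferentiableOn ℂ (fun z : ℂ => c n (toComplex θ + z • toComplex η))
        {z | |z.im| * Real.sqrt (∑ i, η i ^ 2) < ρ} := by
    intro n θ η
    have hmem : ∀ z ∈ {z : ℂ | |z.im| * Real.sqrt (∑ i, η i ^ 2) < ρ},
        toComplex θ + z • toComplex η ∈ openStrip ν ρ := by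
      intro z hz
      change imNorm _ < ρ
      rw [imNorm_toComplex_add_smul]
      exact hz
    refine DifferentiableOn.const_mul (differentiableOn_integral_of_bounded (isOpen_imStrip _ _)
      (fun z hz => hmeas n _ (hmem z hz)) (fun z hz => hnorm n _ (hmem z hz)) fun x => ?_) _
    exact (differentiableOn_line (hhol x) θ η).const_mul _
  have hc_per : ∀ n, AnglePeriodic (c n) := by
    intro n k θ
    simp only [hc, hVreal]
    congr 1
    ext x
    exact congrArg _ (hper k θ _ ⟨Real.arccos_nonneg _, Real.arccos_le_pi _⟩)
  have hdecay : ∀ N : ℕ, ∃ C : ℝ, 0 ≤ C ∧ ∀ (k : Fin ν → ℤ) (n : ℤ), ‖angleCoeff (c n) k‖ ≤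
      C * (Real.exp (-(σ * waveLen k)) * ((1 + |(n : ℝ)|) ^ N)⁻¹) := by
    intro N
    obtain ⟨C, hC, hb⟩ := hc_bound N
    refine ⟨C, hC, fun k n => ?_⟩
    refine (norm_angleCoeff_le hσ.le hσρ (fun θ hθ => hb θ hθ n) (hc_cont n) (hc_line n)
      (hc_per n) k).trans (le_of_eq (by ring))
  refine ⟨fun g => angleCoeff (c g.2) g.1, fun N => ?_, fun θ x => ?_, fun n => ?_, fun k m => ?_,
    fun g => ?_⟩
  · obtain ⟨C, hC, hb⟩ := hdecay N
    refine ⟨C, hC, fun g => ?_⟩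
    rw [← le_div_iff₀ (by positivity)]
    exact (hb g.1 g.2).trans (le_of_eq (by ring))
  · obtain ⟨C, hC, hb⟩ := hdecay 2
    have hsum : Summable fun g : Modes ν =>
        angleCoeff (c g.2) g.1 * (angleMode g.1 (toComplex θ) * spaceMode g.2 x) := by
      refine Summable.of_norm_bounded ((summable_modes hσ).mul_left C) fun g => ?_
      rw [norm_mul, norm_mul, norm_angleMode_real, norm_spaceMode, one_mul, mul_one]
      exact hb g.1 g.2
    have hinner : ∀ n : ℤ, HasSum (fun k : Fin ν → ℤ =>
        angleCoeff (c n) k * (angleMode k (toComplex θ) * spaceMode n x))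
        (c n (toComplex θ) * spaceMode n x) := by
      intro n
      have hs : Summable (angleCoeff (c n)) := by
        refine Summable.of_norm_bounded ((summable_exp_waveLen hσ).mul_left
          (C * ((1 + |(n : ℝ)|) ^ 2)⁻¹)) fun k => (hb k n).trans (le_of_eq (by ring))
      have hcr : Continuous fun θ : Fin ν → ℝ => c n (toComplex θ) :=
        (hc_cont n).comp_continuous (continuous_pi fun i => by
          simp only [toComplex]; fun_prop) fun θ => toComplex_mem_openStrip hρ θ
      simpa only [mul_assoc] using (hasSum_angleCoeff hcr (hc_per n) hs θ).mul_right (spaceMode n x)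
    have hθ := toComplex_mem_openStrip hρ θ
    have houter : HasSum (fun n => c n (toComplex θ) * spaceMode n x) (Vc (toComplex θ) x) := by
      refine hasSum_spaceCoeff (hsmx _ hθ).continuous (hperx _ hθ) ?_ x
      obtain ⟨C', hC', hb'⟩ := hc_bound 2
      exact Summable.of_norm_bounded (summable_one_add_abs.mul_left C') fun n => hb' _ hθ n
    -- The double series converges absolutely, so its sum is the iterated sum, which the two
    -- one-step inversions identify.
    have hswap := (Equiv.prodComm ℤ (Fin ν → ℤ)).hasSum_iff.2 hsum.hasSum
    have := (hswap.prod_fiberwise hinner).unique houter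
    rw [← hreal, ← this]
    exact hsum.hasSum
  · have hb : ∀ θ x, |evenExt V θ x| ≤ C₀ := by
      intro θ x
      have := hbd₀ _ (toComplex_mem_openStrip hρ θ) x
      rwa [hreal, Complex.norm_real] at this
    have h1 := integral_unitBox_spaceCoeff h0 hsm.continuous hb n
    rw [← h1]
    simp only [angleCoeff, hc, hVreal]
    congr 1
    ext t
    simp [angleMode, phase]
  · simp only [angleCoeff, hc, hVreal]
    congr 1
    ext t
    rw [spaceCoeff_neg]
    · intro x; rw [evenExt_add_two_pi]
    · intro x; rw [evenExt_neg]
  · refine conj_angleCoeff_neg (fun θ => ?_) g.1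
    simp only [hc, hVreal]
    exact conj_spaceCoeff_neg _ (fun x => Complex.conj_ofReal _) g.2

/-! ### Measure of the resonant frequencies -/

theorem det_updateRow_one (i : Fin ν) (b : Fin ν → ℝ) :
    ((1 : Matrix (Fin ν) (Fin ν) ℝ).updateRow i b).det = b i := by
  rw [← Matrix.det_transpose, ← Matrix.updateCol_transpose, Matrix.transpose_one,
    ← Matrix.cramer_apply, Matrix.cramer_one]
  rfl

open MeasureTheory in
-- Replacing the coordinate `ω i` by `ω · k` is a linear map of determinant `k i`, which sends the
-- slab into a box with one side `2δ` and the others `2R`.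
theorem volume_slab_le (k : Fin ν → ℤ) (i : Fin ν) (hki : k i ≠ 0) {R δ : ℝ} (hR : 0 ≤ R)
    (hδ : 0 ≤ δ) :
    volume {ω : Freq ν | ω ∈ Metric.closedBall 0 R ∧ |∑ j, ω j * (k j : ℝ)| < δ} ≤
      ENNReal.ofReal (|(k i : ℝ)|⁻¹ * (2 * δ * (2 * R) ^ (ν - 1))) := by
  set A : Matrix (Fin ν) (Fin ν) ℝ := (1 : Matrix (Fin ν) (Fin ν) ℝ).updateRow i fun j => (k j : ℝ)
    with hA
  have hdet : LinearMap.det (Matrix.toLin' A) = k i := by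
    rw [LinearMap.det_toLin', hA, det_updateRow_one]
  have hdet0 : LinearMap.det (Matrix.toLin' A) ≠ 0 := by
    rw [hdet]
    exact_mod_cast hki
  set b : Fin ν → ℝ := Function.update (fun _ => R) i δ with hb
  have hsub : {ω : Freq ν | ω ∈ Metric.closedBall 0 R ∧ |∑ j, ω j * (k j : ℝ)| < δ} ⊆
      (WithLp.ofLp : Freq ν → Fin ν → ℝ) ⁻¹' (Matrix.toLin' A ⁻¹' Set.Icc (-b) b) := by
    rintro ω ⟨h1, h2⟩
    have hval : ∀ j, |Matrix.toLin' A ω.ofLp j| ≤ b j := by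
      intro j
      rw [Matrix.toLin'_apply, Matrix.mulVec, hA, hb]
      rcases eq_or_ne j i with rfl | hj
      · rw [Matrix.updateRow_self, Function.update_self]
        simpa only [dotProduct, mul_comm] using h2.le
      · rw [Matrix.updateRow_ne hj, Function.update_of_ne hj]
        have h3 : (fun l => (1 : Matrix (Fin ν) (Fin ν) ℝ) j l) ⬝ᵥ ω.ofLp = ω j :=
          congrFun (Matrix.one_mulVec ω.ofLp) j
        refine (congrArg abs h3).le.trans (le_trans ?_ (mem_closedBall_zero_iff.1 h1))
        exact PiLp.norm_apply_le (p := 2) ω j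
    exact ⟨fun j => (abs_le.1 (hval j)).1, fun j => (abs_le.1 (hval j)).2⟩
  refine (measure_mono hsub).trans ?_
  have hmeas : MeasurableSet (Matrix.toLin' A ⁻¹' Set.Icc (-b) b) :=
    (isClosed_Icc.preimage (Matrix.toLin' A).continuous_of_finiteDimensional).measurableSet
  rw [(PiLp.volume_preserving_ofLp (Fin ν)).measure_preimage hmeas.nullMeasurableSet,
    Measure.addHaar_preimage_linearMap _ hdet0, hdet, Real.volume_Icc_pi, abs_inv,
    ENNReal.ofReal_mul (inv_nonneg.2 (abs_nonneg _))]
  refine mul_le_mul_right (le_of_eq ?_) _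
  rw [← Finset.mul_prod_erase _ _ (Finset.mem_univ i),
    ENNReal.ofReal_mul (by positivity : (0 : ℝ) ≤ 2 * δ), ENNReal.ofReal_pow (by positivity)]
  have h1 : b i - (-b) i = 2 * δ := by
    rw [Pi.neg_apply, hb, Function.update_self]; ring
  have h2 : ∀ j ∈ Finset.univ.erase i,
      ENNReal.ofReal (b j - (-b) j) = ENNReal.ofReal (2 * R) := by
    intro j hj
    rw [Pi.neg_apply, hb, Function.update_of_ne (Finset.ne_of_mem_erase hj)]; ring_nf
  rw [h1, Finset.prod_congr rfl h2, Finset.prod_const,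
    Finset.card_erase_of_mem (Finset.mem_univ i), Finset.card_univ, Fintype.card_fin]

theorem exists_waveLen_le (k : Fin ν → ℤ) (hk : k ≠ 0) :
    ∃ i, k i ≠ 0 ∧ waveLen k ≤ ν * |(k i : ℝ)| := by
  obtain ⟨i₀, hi₀⟩ := Function.ne_iff.1 hk
  obtain ⟨i, -, hi⟩ := Finset.exists_max_image Finset.univ (fun i => |(k i : ℝ)|) ⟨i₀, by simp⟩
  have hpos : 0 < |(k i : ℝ)| :=
    (abs_pos.2 (by exact_mod_cast hi₀)).trans_le (hi i₀ (Finset.mem_univ _))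
  have hν : (1 : ℝ) ≤ ν := by exact_mod_cast i.pos
  refine ⟨i, by exact_mod_cast abs_pos.1 hpos, Real.sqrt_le_iff.2 ⟨by positivity, ?_⟩⟩
  calc ∑ j, (k j : ℝ) ^ 2 ≤ ∑ _j : Fin ν, |(k i : ℝ)| ^ 2 :=
        Finset.sum_le_sum fun j hj => by
          rw [← sq_abs]
          exact pow_le_pow_left₀ (abs_nonneg _) (hi j hj) 2
    _ = ν * |(k i : ℝ)| ^ 2 := by simp
    _ ≤ (ν * |(k i : ℝ)|) ^ 2 := by
        rw [mul_pow]
        gcongr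
        nlinarith

theorem one_le_waveLen {k : Fin ν → ℤ} (hk : k ≠ 0) : 1 ≤ waveLen k := by
  obtain ⟨i, hi⟩ := Function.ne_iff.1 hk
  refine le_trans ?_ (abs_le_waveLen k i)
  have : (1 : ℤ) ≤ |k i| := Int.one_le_abs hi
  exact_mod_cast this

theorem bracket_le_two_mul {x : ℝ} (hx : 1 ≤ x) : bracket x ≤ 2 * x :=
  (bracket_le_one_add (by linarith)).trans (by linarith)

open MeasureTheory in
-- One slab for each `k`, of width `γ₀ M ⟨k⟩^{-τ₀}` divided by the largest entry of `k`, which is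
-- comparable to `⟨k⟩`. The sum over `k` converges because `τ₀ + 1 > ν`.
theorem volume_resonant_le {M γ₀ τ₀ : ℝ} (hM : 0 < M) (hγ : 0 < γ₀) (hτ : (ν : ℝ) - 1 < τ₀) :
    volume (annulus ν M \ diophantine ν M γ₀ τ₀) ≤ ENNReal.ofReal
      (γ₀ * M ^ ν * (ν * 4 ^ ν) * ∑' k : Fin ν → ℤ, bracket (waveLen k) ^ (-(τ₀ + 1))) := by
  set S : (Fin ν → ℤ) → Set (Freq ν) := fun k => {ω | k ≠ 0 ∧ ω ∈ Metric.closedBall 0 (2 * M) ∧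
    |∑ j, ω j * (k j : ℝ)| < γ₀ / bracket (waveLen k) ^ τ₀ * M} with hS
  have hsub : annulus ν M \ diophantine ν M γ₀ τ₀ ⊆ ⋃ k, S k := by
    rintro ω ⟨h1, h2⟩
    simp only [diophantine, Set.mem_ofPred_eq, not_and, not_forall, not_le] at h2
    obtain ⟨k, hk, hlt⟩ := h2 h1
    exact Set.mem_iUnion.2 ⟨k, hk, h1.1, hlt⟩
  have hsum := summable_bracket_waveLen (ν := ν) (s := τ₀ + 1) (by linarith)
  have hnn : ∀ k : Fin ν → ℤ, 0 ≤ bracket (waveLen k) ^ (-(τ₀ + 1)) :=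
    fun k => Real.rpow_nonneg (bracket_pos _).le _
  have hbound : ∀ k, volume (S k) ≤ ENNReal.ofReal
      (γ₀ * M ^ ν * (ν * 4 ^ ν) * bracket (waveLen k) ^ (-(τ₀ + 1))) := by
    intro k
    rcases eq_or_ne k 0 with rfl | hk
    · simp [hS]
    obtain ⟨i, hi, hle⟩ := exists_waveLen_le k hk
    have hb := bracket_pos (waveLen k)
    have hki : 0 < |(k i : ℝ)| := abs_pos.2 (by exact_mod_cast hi)
    refine (measure_mono (fun ω hω => hω.2)).trans ((volume_slab_le k i hi (by positivity)
      (by positivity)).trans (ENNReal.ofReal_le_ofReal ?_))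
    -- Here `⟨k⟩ ≤ 2|k| ≤ 2ν|k i|`, the first inequality because a nonzero integer vector has length
    -- at least `1`.
    have h1 : |(k i : ℝ)|⁻¹ ≤ 2 * ν * (bracket (waveLen k))⁻¹ := by
      rw [← div_eq_mul_inv, inv_le_comm₀ hki (by have := i.pos; positivity), inv_div]
      have h2 := bracket_le_two_mul (one_le_waveLen hk)
      have hν : (0 : ℝ) < ν := by exact_mod_cast i.pos
      rw [div_le_iff₀ (by positivity)]
      linarith
    have h4 : M ^ ν * 4 ^ ν = 4 * M * (2 * (2 * M)) ^ (ν - 1) := by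
      obtain ⟨n, rfl⟩ : ∃ n, ν = n + 1 := ⟨ν - 1, by have := i.pos; omega⟩
      rw [Nat.add_sub_cancel, ← mul_pow, pow_succ]
      ring
    have h5 : bracket (waveLen k) ^ (-(τ₀ + 1)) =
        (bracket (waveLen k) ^ τ₀)⁻¹ * (bracket (waveLen k))⁻¹ := by
      rw [Real.rpow_neg hb.le, Real.rpow_add hb, Real.rpow_one, mul_inv]
    calc _ ≤ 2 * ν * (bracket (waveLen k))⁻¹ *
          (2 * (γ₀ / bracket (waveLen k) ^ τ₀ * M) * (2 * (2 * M)) ^ (ν - 1)) := by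
          gcongr
      _ = γ₀ * ν * (4 * M * (2 * (2 * M)) ^ (ν - 1)) *
          ((bracket (waveLen k) ^ τ₀)⁻¹ * (bracket (waveLen k))⁻¹) := by ring
      _ = _ := by rw [← h4, h5]; ring
  calc _ ≤ ∑' k, volume (S k) := (measure_mono hsub).trans (measure_iUnion_le S)
    _ ≤ ∑' k : Fin ν → ℤ, ENNReal.ofReal
        (γ₀ * M ^ ν * (ν * 4 ^ ν) * bracket (waveLen k) ^ (-(τ₀ + 1))) :=
        ENNReal.tsum_le_tsum hbound
    _ = _ := by
        rw [← ENNReal.ofReal_tsum_of_nonneg (fun k => mul_nonneg (by positivity) (hnn k))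
          (hsum.mul_left _), tsum_mul_left]

open MeasureTheory in
-- The volume is `(2^ν - 1) M^ν` times that of the unit ball, and `2^ν - 1 ≥ 1` for `ν ≥ 1`.
theorem le_volume_annulus (hν : 1 ≤ ν) {M : ℝ} (hM : 0 < M) :
    M ^ ν * volume.real (Metric.ball (0 : Freq ν) 1) ≤ volume.real (annulus ν M) := by
  have hsub : Metric.ball (0 : Freq ν) M ⊆ Metric.closedBall 0 (2 * M) :=
    Metric.ball_subset_closedBall.trans (Metric.closedBall_subset_closedBall (by linarith))
  have hball : volume.real (Metric.ball (0 : Freq ν) M) =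
      M ^ ν * volume.real (Metric.ball (0 : Freq ν) 1) := by
    rw [measureReal_def, Measure.addHaar_ball_of_pos _ _ hM, finrank_euclideanSpace_fin,
      ENNReal.toReal_mul, ENNReal.toReal_ofReal (by positivity), measureReal_def]
  rw [annulus, measureReal_sdiff hsub measurableSet_ball measure_closedBall_lt_top.ne,
    Measure.addHaar_real_closedBall _ _ (by positivity : (0 : ℝ) ≤ 2 * M), hball,
    finrank_euclideanSpace_fin, mul_pow]
  have h2 : (2 : ℝ) ≤ 2 ^ ν := by
    calc (2 : ℝ) = 2 ^ 1 := by norm_num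
      _ ≤ 2 ^ ν := pow_le_pow_right₀ (by norm_num) hν
  have h3 : 0 ≤ M ^ ν * volume.real (Metric.ball (0 : Freq ν) 1) := by positivity
  nlinarith

open MeasureTheory in
theorem exists_volume_ratio_le (hν : 1 ≤ ν) {τ₀ : ℝ} (hτ : (ν : ℝ) - 1 < τ₀) :
    ∃ c₀ : ℝ, 0 < c₀ ∧ ∀ M γ₀ : ℝ, 0 < M → 0 < γ₀ →
      volume.real (annulus ν M \ diophantine ν M γ₀ τ₀) / volume.real (annulus ν M) ≤ c₀ * γ₀ := by
  set s := ∑' k : Fin ν → ℤ, bracket (waveLen k) ^ (-(τ₀ + 1)) with hs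
  have hs0 : 0 ≤ s := tsum_nonneg fun k => Real.rpow_nonneg (bracket_pos _).le _
  set β := volume.real (Metric.ball (0 : Freq ν) 1) with hβ
  have hβ0 : 0 < β := ENNReal.toReal_pos (Metric.measure_ball_pos _ _ one_pos).ne'
    measure_ball_lt_top.ne
  refine ⟨ν * 4 ^ ν * s / β + 1, by positivity, fun M γ₀ hM hγ => ?_⟩
  have hann := le_volume_annulus hν hM
  have hpos : 0 < M ^ ν * β := by positivity
  have hres : volume.real (annulus ν M \ diophantine ν M γ₀ τ₀) ≤ γ₀ * M ^ ν * (ν * 4 ^ ν) * s :=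
    ENNReal.toReal_le_of_le_ofReal (by positivity) (volume_resonant_le hM hγ hτ)
  rw [div_le_iff₀ (hpos.trans_le hann)]
  calc _ ≤ γ₀ * M ^ ν * (ν * 4 ^ ν) * s := hres
    _ = ν * 4 ^ ν * s / β * γ₀ * (M ^ ν * β) := by field_simp
    _ ≤ (ν * 4 ^ ν * s / β + 1) * γ₀ * (M ^ ν * β) := by gcongr; linarith
    _ ≤ _ := by gcongr

/-! ### The cohomological equation -/

/-- The solution `y` of `ω · ∂_θ y = v` on Fourier modes. -/
def solveCohom (v : Modes ν → ℂ) (ω : Freq ν) : Modes ν → ℂ :=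
  fun g => v g / (Complex.I * (freqDot ω g.1 : ℂ))

/-- A family of modes of size `1 / M`, with Lipschitz constant `1 / M²`. -/
structure IsModeFamily (σ : ℝ) (a : ℕ → ℝ) (M : ℝ) (Ω : Set (Freq ν))
    (y : Freq ν → Modes ν → ℂ) : Prop where
  bound : ∀ ω ∈ Ω, ∀ N, modeNorm σ N (y ω) ≤ ENNReal.ofReal (a N / M)
  lipschitz : ∀ ω₁ ∈ Ω, ∀ ω₂ ∈ Ω, ∀ N,
    modeNorm σ N (y ω₁ - y ω₂) ≤ ENNReal.ofReal (a N / M ^ 2 * ‖ω₁ - ω₂‖)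

theorem modeNorm_le_of_norm_le {σ c : ℝ} {N : ℕ} (hc : 0 ≤ c) {y z : Modes ν → ℂ}
    (h : ∀ g, ‖y g‖ ≤ c * ‖z g‖) : modeNorm σ N y ≤ ENNReal.ofReal c * modeNorm σ N z := by
  rw [modeNorm, modeNorm, ← ENNReal.tsum_mul_left]
  refine ENNReal.tsum_le_tsum fun g => ?_
  rw [mul_left_comm, ← ofReal_norm (y g), ← ofReal_norm (z g), ← ENNReal.ofReal_mul hc]
  gcongr
  exact h g

/-- Half of the gap `σ₁ - σ` absorbs the powers of `|k|`, the other half makes the sum over `k`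
converge; two spare powers of `1 + |m|` do the same for `m`. -/
theorem exists_modeNorm_pow_mul_le {σ σ₁ : ℝ} (hσ : σ < σ₁) {v : Modes ν → ℂ}
    (hv : ∀ N : ℕ, ∃ C : ℝ, 0 ≤ C ∧ ∀ g,
      ‖v g‖ * (1 + |(g.2 : ℝ)|) ^ N ≤ C * Real.exp (-(σ₁ * waveLen g.1))) (q N : ℕ) :
    ∃ B : ℝ, 0 ≤ B ∧
      modeNorm σ N (fun g => (((1 + waveLen g.1) ^ q : ℝ) : ℂ) * v g) ≤ ENNReal.ofReal B := by
  obtain ⟨C, hC, hle⟩ := hv (N + 2)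
  have hδ : 0 < (σ₁ - σ) / 2 := by linarith
  obtain ⟨C', hC', hle'⟩ := exists_pow_mul_exp_neg_le q hδ
  have hs := (summable_modes (ν := ν) hδ).mul_left (C * C')
  have hnn : ∀ g : Modes ν, 0 ≤ C * C' * (Real.exp (-((σ₁ - σ) / 2 * waveLen g.1)) *
      ((1 + |(g.2 : ℝ)|) ^ 2)⁻¹) := fun g => by positivity
  refine ⟨∑' g : Modes ν, C * C' * (Real.exp (-((σ₁ - σ) / 2 * waveLen g.1)) *
    ((1 + |(g.2 : ℝ)|) ^ 2)⁻¹), tsum_nonneg hnn, ?_⟩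
  rw [ENNReal.ofReal_tsum_of_nonneg hnn hs, modeNorm]
  refine ENNReal.tsum_le_tsum fun g => ?_
  rw [← ofReal_norm, ← ENNReal.ofReal_mul (weight_pos _ _ _).le]
  refine ENNReal.ofReal_le_ofReal ?_
  have hw := waveLen_nonneg g.1
  rw [norm_mul, Complex.norm_real, Real.norm_of_nonneg (by positivity), weight, ← div_eq_mul_inv,
    ← mul_div_assoc, le_div_iff₀ (by positivity)]
  have he : Real.exp (σ * waveLen g.1) * Real.exp (-(σ₁ * waveLen g.1)) =
      Real.exp (-((σ₁ - σ) / 2 * waveLen g.1)) * Real.exp (-((σ₁ - σ) / 2 * waveLen g.1)) := by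
    rw [← Real.exp_add, ← Real.exp_add]; ring_nf
  calc _ = (Real.exp (σ * waveLen g.1) * (1 + waveLen g.1) ^ q) *
        (‖v g‖ * (1 + |(g.2 : ℝ)|) ^ (N + 2)) := by ring
    _ ≤ (Real.exp (σ * waveLen g.1) * (1 + waveLen g.1) ^ q) *
        (C * Real.exp (-(σ₁ * waveLen g.1))) :=
        mul_le_mul_of_nonneg_left (hle g) (by positivity)
    _ = C * ((1 + waveLen g.1) ^ q) *
        (Real.exp (σ * waveLen g.1) * Real.exp (-(σ₁ * waveLen g.1))) := by ring
    _ = C * ((1 + waveLen g.1) ^ q * Real.exp (-((σ₁ - σ) / 2 * waveLen g.1))) *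
        Real.exp (-((σ₁ - σ) / 2 * waveLen g.1)) := by rw [he]; ring
    _ ≤ C * C' * Real.exp (-((σ₁ - σ) / 2 * waveLen g.1)) := by gcongr; exact hle' _ hw

theorem abs_freqDot_le (ω : Freq ν) (k : Fin ν → ℤ) : |freqDot ω k| ≤ ‖ω‖ * waveLen k := by
  rw [waveLen_eq_norm, mul_comm]
  refine le_of_eq_of_le ?_ (abs_real_inner_le_norm _ ω)
  simp [freqDot, PiLp.inner_apply]

theorem freqDot_sub (ω₁ ω₂ : Freq ν) (k : Fin ν → ℤ) :
    freqDot (ω₁ - ω₂) k = freqDot ω₁ k - freqDot ω₂ k := by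
  simp [freqDot, sub_mul]

theorem inv_abs_freqDot_le {M γ₀ τ₀ : ℝ} (hM : 0 < M) (hγ : 0 < γ₀) {q : ℕ} (hq : τ₀ ≤ q)
    {ω : Freq ν} (hω : ω ∈ diophantine ν M γ₀ τ₀) {k : Fin ν → ℤ} (hk : k ≠ 0) :
    0 < |freqDot ω k| ∧ |freqDot ω k|⁻¹ ≤ (γ₀ * M)⁻¹ * (1 + waveLen k) ^ q := by
  have h : γ₀ / bracket (waveLen k) ^ τ₀ * M ≤ |freqDot ω k| := hω.2 k hk
  have hb : 0 < bracket (waveLen k) ^ τ₀ := Real.rpow_pos_of_pos (bracket_pos _) _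
  have hpos : 0 < γ₀ / bracket (waveLen k) ^ τ₀ * M := by positivity
  refine ⟨hpos.trans_le h, (inv_anti₀ hpos h).trans ?_⟩
  have hle : bracket (waveLen k) ^ τ₀ ≤ (1 + waveLen k) ^ q := by
    calc _ ≤ bracket (waveLen k) ^ (q : ℝ) :=
          Real.rpow_le_rpow_of_exponent_le (one_le_bracket _) hq
      _ = bracket (waveLen k) ^ q := Real.rpow_natCast _ _
      _ ≤ _ := pow_le_pow_left₀ (bracket_pos _).le (bracket_le_one_add (waveLen_nonneg k)) q
  calc (γ₀ / bracket (waveLen k) ^ τ₀ * M)⁻¹ = (γ₀ * M)⁻¹ * bracket (waveLen k) ^ τ₀ := by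
        field_simp
    _ ≤ _ := by gcongr

/-- Each small divisor costs `(γ₀ M)⁻¹ (1 + |k|)^q`. The sequence `a` is chosen before `M`, which
makes the later constants independent of `M`. -/
theorem exists_isModeFamily_solveCohom {σ σ₁ : ℝ} (hσ : σ < σ₁) {v : Modes ν → ℂ}
    (hv : ∀ N : ℕ, ∃ C : ℝ, 0 ≤ C ∧ ∀ g,
      ‖v g‖ * (1 + |(g.2 : ℝ)|) ^ N ≤ C * Real.exp (-(σ₁ * waveLen g.1)))
    (hv0 : ∀ n, v (0, n) = 0) {γ₀ : ℝ} (hγ : 0 < γ₀) (τ₀ : ℝ) :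
    ∃ a : ℕ → ℝ, (∀ N, 0 ≤ a N) ∧ ∀ M, 0 < M →
      IsModeFamily σ a M (diophantine ν M γ₀ τ₀) (solveCohom v) := by
  obtain ⟨q, hq⟩ := exists_nat_ge τ₀
  choose B₁ hB₁ h₁ using exists_modeNorm_pow_mul_le hσ hv q
  choose B₂ hB₂ h₂ using exists_modeNorm_pow_mul_le hσ hv (2 * q + 1)
  refine ⟨fun N => B₁ N / γ₀ + B₂ N / γ₀ ^ 2, fun N => by
    have := hB₁ N; have := hB₂ N; positivity, fun M hM => ⟨fun ω hω N => ?_,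
    fun ω₁ hω₁ ω₂ hω₂ N => ?_⟩⟩
  · have hb₁ := hB₁ N
    have hb₂ := hB₂ N
    refine (modeNorm_le_of_norm_le (c := (γ₀ * M)⁻¹) (by positivity) fun g => ?_).trans
      ((mul_le_mul_right (h₁ N) _).trans ?_)
    · obtain ⟨k, n⟩ := g
      rcases eq_or_ne k 0 with rfl | hk
      · simp [solveCohom, hv0]
      · obtain ⟨-, hle⟩ := inv_abs_freqDot_le hM hγ hq hω hk
        have hw := waveLen_nonneg k
        rw [solveCohom, norm_div, norm_mul, Complex.norm_I, one_mul, Complex.norm_real, norm_mul,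
          Complex.norm_real, Real.norm_of_nonneg (by positivity : 0 ≤ (1 + waveLen k) ^ q),
          div_eq_mul_inv, Real.norm_eq_abs, ← mul_assoc, mul_comm ‖v (k, n)‖]
        gcongr
    · rw [← ENNReal.ofReal_mul (by positivity)]
      refine ENNReal.ofReal_le_ofReal ?_
      calc (γ₀ * M)⁻¹ * B₁ N = B₁ N / γ₀ / M := by field_simp
        _ ≤ _ := by gcongr; exact le_add_of_nonneg_right (by positivity)
  · have hb₁ := hB₁ N
    have hb₂ := hB₂ N
    refine (modeNorm_le_of_norm_le (c := ((γ₀ * M)⁻¹) ^ 2 * ‖ω₁ - ω₂‖) (by positivity)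
      fun g => ?_).trans ((mul_le_mul_right (h₂ N) _).trans ?_)
    · obtain ⟨k, n⟩ := g
      rcases eq_or_ne k 0 with rfl | hk
      · simp [solveCohom, hv0]
      · obtain ⟨hp₁, hle₁⟩ := inv_abs_freqDot_le hM hγ hq hω₁ hk
        obtain ⟨hp₂, hle₂⟩ := inv_abs_freqDot_le hM hγ hq hω₂ hk
        have hn₁ : (freqDot ω₁ k : ℂ) ≠ 0 := Complex.ofReal_ne_zero.2 (abs_pos.1 hp₁)
        have hn₂ : (freqDot ω₂ k : ℂ) ≠ 0 := Complex.ofReal_ne_zero.2 (abs_pos.1 hp₂)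
        have hw := waveLen_nonneg k
        have hI := Complex.I_ne_zero
        -- A difference of reciprocals: two divisors give `M⁻²` and `2q` powers of `1 + |k|`, and
        -- `(ω₁ - ω₂)·k` gives the remaining power in `2 * q + 1`.
        have heq : (solveCohom v ω₁ - solveCohom v ω₂) (k, n) = -(v (k, n) / Complex.I *
            (freqDot (ω₁ - ω₂) k : ℂ) * ((freqDot ω₁ k : ℂ)⁻¹ * (freqDot ω₂ k : ℂ)⁻¹)) := by
          simp only [Pi.sub_apply, solveCohom, freqDot_sub, Complex.ofReal_sub]
          field_simp
          ring
        rw [heq, norm_neg, norm_mul, norm_mul, norm_div, Complex.norm_I, div_one, norm_mul,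
          norm_inv, norm_inv, Complex.norm_real, Complex.norm_real, Complex.norm_real, norm_mul,
          Complex.norm_real,
          Real.norm_of_nonneg (by positivity : 0 ≤ (1 + waveLen k) ^ (2 * q + 1))]
        simp only [Real.norm_eq_abs]
        have hd := abs_freqDot_le (ω₁ - ω₂) k
        calc ‖v (k, n)‖ * |freqDot (ω₁ - ω₂) k| * (|freqDot ω₁ k|⁻¹ * |freqDot ω₂ k|⁻¹)
            ≤ ‖v (k, n)‖ * (‖ω₁ - ω₂‖ * (1 + waveLen k)) *
              (((γ₀ * M)⁻¹ * (1 + waveLen k) ^ q) * ((γ₀ * M)⁻¹ * (1 + waveLen k) ^ q)) := by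
              gcongr
              exact hd.trans (by gcongr; linarith)
          _ = _ := by ring
    · rw [← ENNReal.ofReal_mul (by positivity)]
      refine ENNReal.ofReal_le_ofReal ?_
      calc (γ₀ * M)⁻¹ ^ 2 * ‖ω₁ - ω₂‖ * B₂ N = B₂ N / γ₀ ^ 2 / M ^ 2 * ‖ω₁ - ω₂‖ := by field_simp
        _ ≤ _ := by gcongr; exact le_add_of_nonneg_left (by positivity)

/-! ### Symbols that are quadratic in the modes -/

/-- The amplitude `y K + (y * y) L`. -/
def quadAmp (K L : ℤ → ℤ → ℂ) (y : Modes ν → ℂ) : Modes ν → ℤ → ℂ :=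
  fun g j => y g * K g.2 j + conv y y g * L g.2 j

/-- `M⁻¹ + M⁻² + M⁻³`. -/
def invSize (M : ℝ) : ℝ := 1 / M + 1 / M ^ 2 + 1 / M ^ 3

theorem invSize_nonneg {M : ℝ} (hM : 0 < M) : 0 ≤ invSize M := by
  rw [invSize]; positivity

theorem invSize_le {M : ℝ} (hM : 1 ≤ M) : invSize M ≤ 3 / M := by
  have h0 : 0 < M := by linarith
  have h2 : 1 / M ^ 2 ≤ 1 / M := one_div_le_one_div_of_le h0 (le_self_pow₀ hM (by norm_num))
  have h3 : 1 / M ^ 3 ≤ 1 / M := one_div_le_one_div_of_le h0 (le_self_pow₀ hM (by norm_num))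
  rw [invSize]
  calc _ ≤ 1 / M + 1 / M + 1 / M := by gcongr
    _ = 3 / M := by ring

/-- Powers of `1/M`: the linear term has size `M⁻¹` and Lipschitz constant `M⁻²`, the quadratic term
`M⁻²` and `M⁻³`. `invSize` dominates all of them, also for `M < 1`. -/
theorem exists_ampNorm_quadAmp_le {σ s : ℝ} (hσ : 0 ≤ σ) {K L : ℤ → ℤ → ℂ} {β : ℕ}
    (hK : IsAmplitude β s K) (hL : IsAmplitude β s L) {a : ℕ → ℝ} (ha : ∀ N, 0 ≤ a N) (N : ℕ) :
    ∃ D : ℝ, 0 ≤ D ∧ ∀ (M : ℝ) (Ω : Set (Freq ν)) (y : Freq ν → Modes ν → ℂ), 0 < M →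
      IsModeFamily σ a M Ω y →
      (∀ ω ∈ Ω, ampNorm σ s β N (quadAmp K L (y ω)) ≤ ENNReal.ofReal (D * invSize M)) ∧
      ∀ ω₁ ∈ Ω, ∀ ω₂ ∈ Ω, ampNorm σ s β N (quadAmp K L (y ω₁) - quadAmp K L (y ω₂)) ≤
        ENNReal.ofReal (D * invSize M * ‖ω₁ - ω₂‖) := by
  obtain ⟨C₁, hC₁, p₁, h₁⟩ := exists_ampNorm_mul_le (ν := ν) hK
  obtain ⟨C₂, hC₂, p₂, h₂⟩ := exists_ampNorm_mul_le (ν := ν) hL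
  have ha₁ := ha (N + p₁)
  have ha₂ := ha (N + p₂)
  refine ⟨C₁ * a (N + p₁) + C₂ * (2 * a (N + p₂) ^ 2), by positivity, fun M Ω y hM hy =>
    ⟨fun ω hω => ?_, fun ω₁ hω₁ ω₂ hω₂ => ?_⟩⟩
  · refine (ampNorm_add_le σ s β N (fun g j => y ω g * K g.2 j) _).trans
      ((add_le_add (h₁ σ N _) (h₂ σ N _)).trans ?_)
    refine (add_le_add (mul_le_mul_right (hy.bound ω hω _) _) (mul_le_mul_right
      ((modeNorm_conv_le hσ _ _ _).trans (mul_le_mul' (hy.bound ω hω _) (hy.bound ω hω _)))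
      _)).trans ?_
    rw [← ENNReal.ofReal_mul (by positivity), ← ENNReal.ofReal_mul (by positivity),
      ← ENNReal.ofReal_mul (by positivity), ← ENNReal.ofReal_add (by positivity) (by positivity)]
    refine ENNReal.ofReal_le_ofReal ?_
    have e₁ : C₁ * (a (N + p₁) / M) = C₁ * a (N + p₁) * (1 / M) := by ring
    have e₂ : C₂ * (a (N + p₂) / M * (a (N + p₂) / M)) = C₂ * a (N + p₂) ^ 2 * (1 / M ^ 2) := by
      field_simp
    rw [e₁, e₂, add_mul]
    refine add_le_add ?_ ?_
    · gcongr
      rw [invSize, add_assoc]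
      exact le_add_of_nonneg_right (by positivity)
    · gcongr
      · exact le_mul_of_one_le_left (by positivity) (by norm_num)
      · rw [invSize, add_comm (1 / M), add_assoc]
        exact le_add_of_nonneg_right (by positivity)
  · have hfin : ∀ ω ∈ Ω, modeNorm σ 0 (y ω) < ∞ :=
      fun ω hω => (hy.bound ω hω 0).trans_lt ENNReal.ofReal_lt_top
    have heq : quadAmp K L (y ω₁) - quadAmp K L (y ω₂) = fun g j =>
        (y ω₁ - y ω₂) g * K g.2 j + conv (y ω₁ - y ω₂) (y ω₁ + y ω₂) g * L g.2 j := by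
      rw [← conv_sub_conv hσ (hfin ω₁ hω₁) (hfin ω₂ hω₂)]
      funext g j
      simp only [quadAmp, Pi.sub_apply]
      ring
    rw [heq]
    refine (ampNorm_add_le σ s β N (fun g j => (y ω₁ - y ω₂) g * K g.2 j) _).trans
      ((add_le_add (h₁ σ N _) (h₂ σ N _)).trans ?_)
    refine (add_le_add (mul_le_mul_right (hy.lipschitz ω₁ hω₁ ω₂ hω₂ _) _) (mul_le_mul_right
      ((modeNorm_conv_le hσ _ _ _).trans (mul_le_mul' (hy.lipschitz ω₁ hω₁ ω₂ hω₂ _)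
        ((modeNorm_add_le _ _ _ _).trans (add_le_add (hy.bound ω₁ hω₁ _) (hy.bound ω₂ hω₂ _)))))
      _)).trans ?_
    rw [← ENNReal.ofReal_add (by positivity) (by positivity), ← ENNReal.ofReal_mul (by positivity),
      ← ENNReal.ofReal_mul (by positivity), ← ENNReal.ofReal_mul (by positivity),
      ← ENNReal.ofReal_add (by positivity) (by positivity)]
    refine ENNReal.ofReal_le_ofReal ?_
    have e₁ : C₁ * (a (N + p₁) / M ^ 2 * ‖ω₁ - ω₂‖) =
        C₁ * a (N + p₁) * (1 / M ^ 2) * ‖ω₁ - ω₂‖ := by ring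
    have e₂ : C₂ * (a (N + p₂) / M ^ 2 * ‖ω₁ - ω₂‖ * (a (N + p₂) / M + a (N + p₂) / M)) =
        C₂ * (2 * a (N + p₂) ^ 2) * (1 / M ^ 3) * ‖ω₁ - ω₂‖ := by
      field_simp
      ring
    rw [e₁, e₂, add_mul, add_mul]
    refine add_le_add ?_ ?_
    · gcongr
      rw [invSize, add_comm (1 / M), add_assoc]
      exact le_add_of_nonneg_right (by positivity)
    · gcongr
      rw [invSize]
      exact le_add_of_nonneg_left (by positivity)

theorem exists_lipSeminorm_symb_quadAmp_le {σ ρ s : ℝ} (hσ : 0 ≤ σ) (hρ : ρ ≤ σ)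
    {K L : ℤ → ℤ → ℂ} (hK : ∀ β, IsAmplitude β s K) (hL : ∀ β, IsAmplitude β s L) {a : ℕ → ℝ}
    (ha : ∀ N, 0 ≤ a N) (w : ℝ) (ℓ : ℕ) :
    ∃ D : ℝ, 0 ≤ D ∧ ∀ (M : ℝ) (Ω : Set (Freq ν)) (y : Freq ν → Modes ν → ℂ), 0 < M →
      IsModeFamily σ a M Ω y →
      lipSeminorm w Ω s ρ ℓ (fun ω => symb (quadAmp K L (y ω))) ≤
        ENNReal.ofReal (D * invSize M) := by
  choose D hD hle using fun p : ℕ × ℕ =>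
    exists_ampNorm_quadAmp_le (ν := ν) hσ (hK p.2) (hL p.2) ha p.1
  have hsum : 0 ≤ ∑ p ∈ derivIndices ℓ, D p := Finset.sum_nonneg fun p _ => hD p
  refine ⟨(1 + |w|) * ∑ p ∈ derivIndices ℓ, D p, by positivity, fun M Ω y hM hy => ?_⟩
  have hq := invSize_nonneg hM
  have hW : ∀ ω ∈ Ω, WeightSummable σ (quadAmp K L (y ω)) := fun ω hω =>
    WeightSummable.of_ampNorm fun N =>
      ((hle (N, 0) M Ω y hM hy).1 ω hω).trans_lt ENNReal.ofReal_lt_top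
  have h1 : ∀ ω ∈ Ω, seminorm s ρ ℓ (symb (quadAmp K L (y ω))) ≤
      ENNReal.ofReal ((∑ p ∈ derivIndices ℓ, D p) * invSize M) := by
    intro ω hω
    refine (seminorm_symb_le hρ (hW ω hω) s ℓ).trans
      ((Finset.sum_le_sum fun p _ => (hle p M Ω y hM hy).1 ω hω).trans (le_of_eq ?_))
    rw [Finset.sum_mul, ENNReal.ofReal_sum_of_nonneg fun p _ => mul_nonneg (hD p) hq]
  have h2 : ∀ ω₁ ∈ Ω, ∀ ω₂ ∈ Ω, ω₁ ≠ ω₂ →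
      seminorm s ρ ℓ (symb (quadAmp K L (y ω₁)) - symb (quadAmp K L (y ω₂))) / ‖ω₁ - ω₂‖ₑ ≤
        ENNReal.ofReal ((∑ p ∈ derivIndices ℓ, D p) * invSize M) := by
    intro ω₁ hω₁ ω₂ hω₂ _
    refine ENNReal.div_le_of_le_mul ?_
    refine (seminorm_symb_sub_le hρ (hW ω₁ hω₁) (hW ω₂ hω₂) s ℓ).trans
      ((Finset.sum_le_sum fun p _ => (hle p M Ω y hM hy).2 ω₁ hω₁ ω₂ hω₂).trans (le_of_eq ?_))
    rw [← ofReal_norm, ← ENNReal.ofReal_mul (mul_nonneg hsum hq), Finset.sum_mul, Finset.sum_mul,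
      ENNReal.ofReal_sum_of_nonneg fun p _ =>
        mul_nonneg (mul_nonneg (hD p) hq) (norm_nonneg _)]
  calc _ ≤ ENNReal.ofReal ((∑ p ∈ derivIndices ℓ, D p) * invSize M) + ENNReal.ofReal |w| *
        ENNReal.ofReal ((∑ p ∈ derivIndices ℓ, D p) * invSize M) :=
        add_le_add (iSup₂_le h1) (mul_le_mul' (ENNReal.ofReal_le_ofReal (le_abs_self w))
          (iSup₂_le fun ω₁ hω₁ => iSup₂_le fun ω₂ hω₂ => iSup_le (h2 ω₁ hω₁ ω₂ hω₂)))
    _ = _ := by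
        rw [← ENNReal.ofReal_mul (abs_nonneg _), ← ENNReal.ofReal_add (by positivity)
          (by positivity)]
        congr 1
        ring

/-! ### The amplitudes of the normal form -/

theorem isAmplitude_sandwich (mass : ℝ) (β : ℕ) : IsAmplitude β (-1) fun m j =>
    (1 / 2) * ((invSqrtEig mass (j + m) : ℂ) * (invSqrtEig mass j : ℂ)) := by
  have h := (isAmplitude_invSqrtEig mass β).translate.mul (isAmplitude_invSqrtEig mass β)
  norm_num at h
  exact h.const_mul _

/-- The symbol contains `λ_{j+m} - λ_j`, of order `0` rather than `1`, so the commutator keeps the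
order of `X`. -/
theorem isAmplitude_commutator (mass : ℝ) (β : ℕ) : IsAmplitude β (-1) fun m j =>
    (1 / 2) * ((invSqrtEig mass (j + m) : ℂ) * (invSqrtEig mass j : ℂ)) *
      (Complex.I * (regEig mass j : ℂ) + -Complex.I * (regEig mass (j + m) : ℂ)) := by
  have h := (isAmplitude_sandwich mass β).mul
    ((IsAmplitude.translate_sub (isAmplitude_regEig mass) β).const_mul (-Complex.I))
  norm_num at h
  convert h using 3
  ring

theorem isAmplitude_anticommutator (mass : ℝ) (β : ℕ) : IsAmplitude β 0 fun m j =>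
    (1 / 2) * ((invSqrtEig mass (j + m) : ℂ) * (invSqrtEig mass j : ℂ)) *
      (-Complex.I * (regEig mass j : ℂ) + -Complex.I * (regEig mass (j + m) : ℂ)) := by
  have h := (isAmplitude_sandwich mass β).mul
    (((isAmplitude_regEig mass β).const_mul (-Complex.I)).add
      ((isAmplitude_regEig mass β).translate.const_mul (-Complex.I)))
  norm_num at h
  convert h using 3
  ring

/-- The quadratic part is zero, so the estimates for quadratic amplitudes cover `X` as well. -/
theorem ampX_eq_quadAmp (mass : ℝ) (y : Modes ν → ℂ) : ampX mass y = quadAmp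
    (fun m j => (1 / 2) * ((invSqrtEig mass (j + m) : ℂ) * (invSqrtEig mass j : ℂ)))
    (fun m j => 0 * ((1 / 2) * ((invSqrtEig mass (j + m) : ℂ) * (invSqrtEig mass j : ℂ)))) y := by
  funext g j
  simp only [ampX, quadAmp]
  ring

theorem solveCohom_even {v : Modes ν → ℂ} (hv : ∀ k m, v (k, -m) = v (k, m)) (ω : Freq ν)
    (k : Fin ν → ℤ) (m : ℤ) : solveCohom v ω (k, -m) = solveCohom v ω (k, m) := by
  simp only [solveCohom, hv]

theorem conj_solveCohom_neg {v : Modes ν → ℂ} (hv : ∀ g, starRingEnd ℂ (v (-g)) = v g)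
    (ω : Freq ν) (g : Modes ν) : starRingEnd ℂ (solveCohom v ω (-g)) = solveCohom v ω g := by
  have h : freqDot ω (-g.1) = -freqDot ω g.1 := by simp [freqDot]
  simp only [solveCohom, map_div₀, hv, map_mul, Complex.conj_I, Prod.fst_neg, h,
    Complex.ofReal_neg, map_neg, Complex.conj_ofReal]
  ring

theorem solveCohom_spec {v : Modes ν → ℂ} (hv0 : ∀ n, v (0, n) = 0) {M γ₀ τ₀ : ℝ} (hM : 0 < M)
    (hγ : 0 < γ₀) {ω : Freq ν} (hω : ω ∈ diophantine ν M γ₀ τ₀) (g : Modes ν) :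
    v g = Complex.I * freqDot ω g.1 * solveCohom v ω g := by
  obtain ⟨k, n⟩ := g
  rcases eq_or_ne k 0 with rfl | hk
  · simp [solveCohom, hv0]
  · obtain ⟨q, hq⟩ := exists_nat_ge τ₀
    have h := (inv_abs_freqDot_le hM hγ hq hω hk).1
    have hn : (freqDot ω k : ℂ) ≠ 0 := Complex.ofReal_ne_zero.2 (abs_pos.1 h)
    rw [solveCohom, mul_div_cancel₀ _ (mul_ne_zero Complex.I_ne_zero hn)]

end MagnusKG

end

/-! ### Assembly of the normal form theorem. -/

open MagnusKG in
theorem theorem3p1 (ν : ℕ) (hν : 1 ≤ ν) (τ₀ : ℝ) (hτ₀ : (ν : ℝ) - 1 < τ₀) :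
    ∃ c₀ : ℝ, 0 < c₀ ∧
      ∀ (mass ρ : ℝ) (V : (Fin ν → ℝ) → ℝ → ℝ), 0 ≤ mass → 0 < ρ →
        AnalyticDriving ρ V → ZeroAverage V →
      ∀ γ₀ : ℝ, 0 < γ₀ → γ₀ < 1 →
      ∃ C : ℝ → ℕ → ℝ, (∀ w ℓ, 0 < C w ℓ) ∧
      ∀ M : ℝ, 0 < M →
        MeasureTheory.volume.real (annulus ν M \ diophantine ν M γ₀ τ₀) /
            MeasureTheory.volume.real (annulus ν M) ≤ c₀ * γ₀ ∧
        ∃ X Vd Vo : Freq ν → Symb ν,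
          (∀ w : ℝ, 0 < w →
            IsLipParityPseudo w (diophantine ν M γ₀ τ₀) (-1) (ρ / 2) X ∧
            IsLipParityPseudo w (diophantine ν M γ₀ τ₀) (-1) (ρ / 2) Vd ∧
            IsLipParityPseudo w (diophantine ν M γ₀ τ₀) 0 (ρ / 2) Vo) ∧
          (∀ ω ∈ diophantine ν M γ₀ τ₀, ∀ θ : Fin ν → ℝ,
            IsAdjointOnOdd (opAt (Vd ω) θ) (opAt (Vd ω) θ) ∧
            IsAdjointOnOdd (opAt (Vo ω) θ) (conjOp (opAt (Vo ω) θ))) ∧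
          (∀ ω ∈ diophantine ν M γ₀ τ₀, ∀ r : ℝ, 0 ≤ r →
            Conjugates r ω (opAt (X ω))
              (fun t => blockH0 mass + blockW mass V (angle ω t))
              (fun t => blockH0 mass +
                hamBlock (opAt (Vd ω) (angle ω t)) (opAt (Vo ω) (angle ω t)))) ∧
          (1 ≤ M → ∀ w : ℝ, 0 < w → ∀ ℓ : ℕ,
            lipSeminorm w (diophantine ν M γ₀ τ₀) (-1) (ρ / 2) ℓ Vd +
              lipSeminorm w (diophantine ν M γ₀ τ₀) 0 (ρ / 2) ℓ Vo ≤
            ENNReal.ofReal (C w ℓ / M)) := by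
  obtain ⟨c₀, hc₀, hmeas⟩ := exists_volume_ratio_le hν hτ₀
  refine ⟨c₀, hc₀, fun mass ρ V _ hρ hV hV0 γ₀ hγ _ => ?_⟩
  -- The widths decrease from `ρ` to `3ρ/4` for the decay of the modes of `V`, to `5ρ/8` after the
  -- small divisors, and to `ρ/2`, with room left for holomorphy near the closed strip.
  obtain ⟨v, hdecay, hsum, hv0, hv_even, hv_real⟩ :=
    exists_modes_of_analyticDriving (σ := 3 / 4 * ρ) (by linarith) (by linarith) hV hV0
  obtain ⟨a, ha, hfam⟩ :=
    exists_isModeFamily_solveCohom (σ := 5 / 8 * ρ) (by linarith) hdecay hv0 hγ τ₀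
  have hσ : 0 ≤ 5 / 8 * ρ := by linarith
  have hρσ : ρ / 2 < 5 / 8 * ρ := by linarith
  have hL := isAmplitude_sandwich mass
  -- The quadratic part of `Vᵒ` has order `-1` and is regarded as having the order `0` of the
  -- anticommutator.
  have hL₀ : ∀ β, IsAmplitude β 0 fun m j =>
      (1 / 2) * ((invSqrtEig mass (j + m) : ℂ) * (invSqrtEig mass j : ℂ)) :=
    fun β => (hL β).mono (by norm_num)
  choose Dx hDx hlipx using exists_lipSeminorm_symb_quadAmp_le (ν := ν) hσ hρσ.le hL
    (fun β => (hL β).const_mul 0) ha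
  choose Dd hDd hlipd using exists_lipSeminorm_symb_quadAmp_le (ν := ν) hσ hρσ.le
    (isAmplitude_commutator mass) hL ha
  choose Do hDo hlipo using exists_lipSeminorm_symb_quadAmp_le (ν := ν) hσ hρσ.le
    (isAmplitude_anticommutator mass) hL₀ ha
  have hx : ∀ M, 0 < M → ∀ ω ∈ diophantine ν M γ₀ τ₀, ∀ β N,
      ampNorm (5 / 8 * ρ) (-1) β N (ampX mass (solveCohom v ω)) < ∞ := by
    intro M hM ω hω β N
    rw [ampX_eq_quadAmp]
    obtain ⟨D, -, h⟩ := exists_ampNorm_quadAmp_le hσ (hL β) ((hL β).const_mul 0) ha N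
    exact ((h M _ _ hM (hfam M hM)).1 ω hω).trans_lt ENNReal.ofReal_lt_top
  have hd : ∀ M, 0 < M → ∀ ω ∈ diophantine ν M γ₀ τ₀, ∀ β N, ampNorm (5 / 8 * ρ) (-1) β N
      (ampV mass Complex.I (-Complex.I) (solveCohom v ω)) < ∞ := by
    intro M hM ω hω β N
    obtain ⟨D, -, h⟩ := exists_ampNorm_quadAmp_le hσ (isAmplitude_commutator mass β) (hL β) ha N
    exact ((h M _ _ hM (hfam M hM)).1 ω hω).trans_lt ENNReal.ofReal_lt_top
  have ho : ∀ M, 0 < M → ∀ ω ∈ diophantine ν M γ₀ τ₀, ∀ β N, ampNorm (5 / 8 * ρ) 0 β N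
      (ampV mass (-Complex.I) (-Complex.I) (solveCohom v ω)) < ∞ := by
    intro M hM ω hω β N
    obtain ⟨D, -, h⟩ :=
      exists_ampNorm_quadAmp_le hσ (isAmplitude_anticommutator mass β) (hL₀ β) ha N
    exact ((h M _ _ hM (hfam M hM)).1 ω hω).trans_lt ENNReal.ofReal_lt_top
  have hxb := fun M hM ω hω =>
    SummablyBounded.of_ampNorm hσ (by norm_num) (hx M hM ω hω 0 0)
  have hdb := fun M hM ω hω =>
    SummablyBounded.of_ampNorm hσ (by norm_num) (hd M hM ω hω 0 0)
  have hob := fun M hM ω hω => SummablyBounded.of_ampNorm hσ le_rfl (ho M hM ω hω 0 0)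
  have hy_even := fun ω => solveCohom_even hv_even ω
  have hy_real := fun ω => conj_solveCohom_neg hv_real ω
  -- The factor `3` comes from `invSize M ≤ 3 / M` for `M ≥ 1`; the added `1` makes the constant
  -- positive.
  refine ⟨fun w ℓ => (Dd w ℓ + Do w ℓ) * 3 + 1, fun w ℓ => ?_, fun M hM =>
    ⟨hmeas M γ₀ hM hγ, fun ω => symb (ampX mass (solveCohom v ω)),
      fun ω => symb (ampV mass Complex.I (-Complex.I) (solveCohom v ω)),
      fun ω => symb (ampV mass (-Complex.I) (-Complex.I) (solveCohom v ω)),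
      fun w _ => ⟨⟨fun ω hω => isSymbol_symb hρσ (hx M hM ω hω),
          fun ω hω => parityPreserving_symb (hxb M hM ω hω) (ampX_reflect mass (hy_even ω)),
          fun ℓ => ?_⟩,
        ⟨fun ω hω => isSymbol_symb hρσ (hd M hM ω hω),
          fun ω hω => parityPreserving_symb (hdb M hM ω hω) (ampV_reflect mass _ _ (hy_even ω)),
          fun ℓ => (hlipd w ℓ M _ _ hM (hfam M hM)).trans_lt ENNReal.ofReal_lt_top⟩,
        ⟨fun ω hω => isSymbol_symb hρσ (ho M hM ω hω),
          fun ω hω => parityPreserving_symb (hob M hM ω hω) (ampV_reflect mass _ _ (hy_even ω)),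
          fun ℓ => (hlipo w ℓ M _ _ hM (hfam M hM)).trans_lt ENNReal.ofReal_lt_top⟩⟩,
      fun ω hω θ => ⟨isAdjointOnOdd_symb (hdb M hM ω hω) (hdb M hM ω hω)
          (conj_ampV_neg mass _ _ Complex.conj_I (hy_real ω)) θ,
        isAdjointOnOdd_conjOp_symb (hob M hM ω hω) (ampV_neg_add mass _ _) θ⟩,
      fun ω hω r hr => ?_, fun hM1 w _ ℓ => ?_⟩⟩
  · have := hDd w ℓ
    have := hDo w ℓ
    positivity
  · simp only [ampX_eq_quadAmp]
    exact (hlipx w ℓ M _ _ hM (hfam M hM)).trans_lt ENNReal.ofReal_lt_top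
  · have hN : ∀ N, modeNorm (5 / 8 * ρ) N (solveCohom v ω) < ∞ :=
      fun N => ((hfam M hM).bound ω hω N).trans_lt ENNReal.ofReal_lt_top
    have hNN : ∀ N, modeNorm (5 / 8 * ρ) N (conv (solveCohom v ω) (solveCohom v ω)) < ∞ :=
      fun N => (modeNorm_conv_le hσ N _ _).trans_lt (ENNReal.mul_lt_top (hN N) (hN N))
    have hvN : ∀ N, modeNorm (5 / 8 * ρ) N v < ∞ := fun N => by
      obtain ⟨B, -, hB⟩ :=
        exists_modeNorm_pow_mul_le (σ := 5 / 8 * ρ) (by linarith) hdecay 0 N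
      simp only [pow_zero, Complex.ofReal_one, one_mul] at hB
      exact hB.trans_lt ENNReal.ofReal_lt_top
    exact conjugates_of_cohomological (RapidModes.of_modeNorm hσ hN) (RapidModes.of_modeNorm hσ hvN)
      (RapidModes.of_modeNorm hσ hNN) (hy_even ω) hv_even (hy_real ω) ω
      (solveCohom_spec hv0 hM hγ hω) mass (hxb M hM ω hω) (hdb M hM ω hω) (hob M hM ω hω)
      (fun θ x => (hsum θ x).tsum_eq.symm) hr
  · have hq := invSize_nonneg hM
    have h₁ := hDd w ℓ
    have h₂ := hDo w ℓ
    refine (add_le_add (hlipd w ℓ M _ _ hM (hfam M hM)) (hlipo w ℓ M _ _ hM (hfam M hM))).trans ?_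
    rw [← ENNReal.ofReal_add (by positivity) (by positivity), ← add_mul]
    refine ENNReal.ofReal_le_ofReal ?_
    calc (Dd w ℓ + Do w ℓ) * invSize M ≤ (Dd w ℓ + Do w ℓ) * (3 / M) := by
          gcongr
          exact invSize_le hM1
      _ = (Dd w ℓ + Do w ℓ) * 3 / M := by ring
      _ ≤ _ := by gcongr; linarith
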